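/- Let $n\ge 1$ and let $\mathbb R^{n+4}_1$ be $\mathbb R^{n+4}$ with the Lorentzian product $\langle x,y\rangle=x^tI_{1,n+3}y$, $I_{1,n+3}=\mathrm{diag}(-1,1,\dots,1)$. Let $SO^+(1,n+3)$ be the identity component of its isometry group, and let $SO^+(1,3)\times SO(n)$ be embedded in it block diagonally. The pseudo-Riemannian symmetric space $SO^+(1,n+3)/SO^+(1,3)\times SO(n)$ is identified with the set of oriented $4$-dimensional Lorentzian subspaces of $\mathbb R^{n+4}_1$: the class of $F$ is the span of the first four columns of $F$, oriented by these columns. Let $M$ be a Riemann surface. A smooth map $y:M\to S^{n+2}$ is a *conformal immersion* on an open set $W\subseteq M$ if the lift $Y=(1,y)$ into the forward light cone satisfies $\langle Y_z,Y_z\rangle=0$ and $\langle Y_z,Y_{\bar z}\rangle>0$ on $W$ for every local complex coordinate $z=u+iv$. Its *conformal Gauss map* $Gr:W\to SO^+(1,n+3)/SO^+(1,3)\times SO(n)$ then assigns to $p$ the subspace $V_p$ spanned and oriented by $\{Y,N,Y_u,Y_v\}$, where $Y$ is now the positive multiple of $(1,y)$ with $\langle Y_z,Y_{\bar z}\rangle=\frac12$,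 and $N\in\mathrm{Span}\{Y,Y_u,Y_v,Y_{z\bar z}\}$ is determined by $\langle N,Y_z\rangle=\langle N,Y_{\bar z}\rangle=\langle N,N\rangle=0$, $\langle N,Y\rangle=-1$. An immersion $y$ on $W$ is *Willmore* if it is a critical point of the Willmore functional $\int(|\vec H|^2-K+1)\,\mathrm dM$ with respect to all smooth variations with compact support in $W$; here $\vec H$ is the mean curvature vector in $S^{n+2}$ and $K$ is the Gauss curvature. A smooth map $y:M\to S^{n+2}$ is a *Willmore map* if it is a conformal Willmore immersion on an open dense subset of $M$; let $\hat M$ be the maximal open subset with this property. It is a *strong Willmore map* if moreover its conformal Gauss map $Gr:\hat M\to SO^+(1,n+3)/SO^+(1,3)\times SO(n)$ extends to a smooth map $f$ on $M$, which is then called the conformal Gauss map of $y$. **Statement.** Let $y:M\to S^{n+2}$ be a strong Willmore map and let $f:M\to SO^+(1,n+3)/SO^+(1,3)\times SO(n)$ be its (extended) conformal Gauss map. Then $f$ is *strongly conformally harmonic*, that is: $f$ is a harmonic map (its tension field vanishes), and every $p\in M$ has an open neighbourhood $U_p$ with a smooth frame $F:U_p\to SO^+(1,n+3)$ of $f$ (a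 smooth lift of $f|_{U_p}$) such that, for every complex coordinate $z$ on an open subset of $U_p$, the upper right $4\times n$ block $B_1$ of $F^{-1}F_z$ satisfies $$B_1^t\,I_{1,3}\,B_1=0,\qquad I_{1,3}=\mathrm{diag}(-1,1,1,1),$$ on the domain of $z$. -/

import Mathlib

open scoped Manifold ContDiff Matrix

noncomputable section

/-! ## Minkowski space and the group `SO⁺` -/

/-- The Lorentzian form `diag(-1, 1, …, 1)`, the entry `-1` sitting at the index `i₀`. -/
def lorentzForm {ι : Type} [DecidableEq ι] (i₀ : ι) : Matrix ι ι ℝ :=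
  Matrix.diagonal fun i => if i = i₀ then -1 else 1

lemma lorentzForm_mul_self {ι : Type} [Fintype ι] [DecidableEq ι] (i₀ : ι) :
    lorentzForm i₀ * lorentzForm i₀ = 1 := by
  unfold lorentzForm
  rw [Matrix.diagonal_mul_diagonal, ← Matrix.diagonal_one]
  congr 1
  funext i
  split_ifs <;> norm_num

/-- If `Aᵀ J A = J` then also `A J Aᵀ = J`, for `J` the Lorentzian form. -/
lemma lorentz_transpose {ι : Type} [Fintype ι] [DecidableEq ι] (i₀ : ι) {A : Matrix ι ι ℝ}
    (h : Aᵀ * lorentzForm i₀ * A = lorentzForm i₀) :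
    A * lorentzForm i₀ * Aᵀ = lorentzForm i₀ := by
  have hJ := lorentzForm_mul_self i₀
  have h1 : (lorentzForm i₀ * Aᵀ * lorentzForm i₀) * A = 1 := by
    rw [Matrix.mul_assoc, Matrix.mul_assoc, ← Matrix.mul_assoc Aᵀ, h, hJ]
  have h2 : A * (lorentzForm i₀ * Aᵀ * lorentzForm i₀) = 1 := mul_eq_one_comm.mp h1
  calc A * lorentzForm i₀ * Aᵀ
      = A * (lorentzForm i₀ * Aᵀ * lorentzForm i₀) * lorentzForm i₀ := by
        simp only [Matrix.mul_assoc, hJ, Matrix.mul_one]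
    _ = lorentzForm i₀ := by rw [h2, Matrix.one_mul]

lemma lorentz_col {ι : Type} [Fintype ι] [DecidableEq ι] (i₀ : ι) {A : Matrix ι ι ℝ}
    (h : Aᵀ * lorentzForm i₀ * A = lorentzForm i₀) :
    ∑ i ∈ Finset.univ.erase i₀, A i i₀ ^ 2 = A i₀ i₀ ^ 2 - 1 := by
  have h1 := congrFun (congrFun h i₀) i₀
  rw [lorentzForm, Matrix.mul_apply] at h1
  simp only [Matrix.mul_diagonal, Matrix.transpose_apply, Matrix.diagonal_apply_eq, if_true] at h1
  rw [← Finset.add_sum_erase _ _ (Finset.mem_univ i₀)] at h1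
  have h2 : ∑ x ∈ Finset.univ.erase i₀, (A x i₀ * (if x = i₀ then -1 else 1)) * A x i₀
      = ∑ i ∈ Finset.univ.erase i₀, A i i₀ ^ 2 := by
    refine Finset.sum_congr rfl fun x hx => ?_
    rw [if_neg (Finset.ne_of_mem_erase hx)]
    ring
  rw [h2] at h1
  simp only [if_true] at h1
  linarith

/-- A product of two Lorentz matrices with positive `(i₀, i₀)` entry has this property, too. -/
lemma lorentz_mul_pos {ι : Type} [Fintype ι] [DecidableEq ι] (i₀ : ι) {A B : Matrix ι ι ℝ}
    (hA : Aᵀ * lorentzForm i₀ * A = lorentzForm i₀) (hA0 : 0 < A i₀ i₀)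
    (hB : Bᵀ * lorentzForm i₀ * B = lorentzForm i₀) (hB0 : 0 < B i₀ i₀) :
    0 < (A * B) i₀ i₀ := by
  have ha : ∑ i ∈ Finset.univ.erase i₀, A i₀ i ^ 2 = A i₀ i₀ ^ 2 - 1 := by
    have := lorentz_col i₀ (A := Aᵀ) (by simpa using lorentz_transpose i₀ hA)
    simpa using this
  have hb := lorentz_col i₀ hB
  have hcs := Finset.sum_mul_sq_le_sq_mul_sq (Finset.univ.erase i₀)
    (fun i => A i₀ i) (fun i => B i i₀)
  rw [ha, hb] at hcs
  rw [Matrix.mul_apply, ← Finset.add_sum_erase _ _ (Finset.mem_univ i₀)]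
  have hb1 : 0 ≤ B i₀ i₀ ^ 2 - 1 := hb ▸ Finset.sum_nonneg fun _ _ => sq_nonneg _
  have ha1 : 0 ≤ A i₀ i₀ ^ 2 - 1 := ha ▸ Finset.sum_nonneg fun _ _ => sq_nonneg _
  by_contra hneg
  have hp := mul_pos hA0 hB0
  have : (A i₀ i₀ * B i₀ i₀) ^ 2
      ≤ (∑ i ∈ Finset.univ.erase i₀, A i₀ i * B i i₀) ^ 2 := by nlinarith
  nlinarith

/-- The group `SO⁺`: the matrices of determinant one that preserve the Lorentzian form and the
forward light cone, i.e. the identity component of the Lorentzian isometry group. -/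
def SOPlus {ι : Type} [Fintype ι] [DecidableEq ι] (i₀ : ι) : Subgroup (GL ι ℝ) where
  carrier := {A | (A : Matrix ι ι ℝ)ᵀ * lorentzForm i₀ * (A : Matrix ι ι ℝ) = lorentzForm i₀ ∧
    (A : Matrix ι ι ℝ).det = 1 ∧ 0 < (A : Matrix ι ι ℝ) i₀ i₀}
  one_mem' := by simp
  mul_mem' := by
    rintro A B ⟨hA, hA1, hA0⟩ ⟨hB, hB1, hB0⟩
    refine ⟨?_, ?_, ?_⟩
    · rw [Units.val_mul, Matrix.transpose_mul]
      calc _ = (B : Matrix ι ι ℝ)ᵀ * ((A : Matrix ι ι ℝ)ᵀ * lorentzForm i₀ * A) * B := by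
            simp only [Matrix.mul_assoc]
        _ = _ := by rw [hA, hB]
    · rw [Units.val_mul, Matrix.det_mul, hA1, hB1, one_mul]
    · rw [Units.val_mul]
      exact lorentz_mul_pos i₀ hA hA0 hB hB0
  inv_mem' := by
    rintro A ⟨hA, hA1, hA0⟩
    have hJ := lorentzForm_mul_self i₀
    have hinv : ((A⁻¹ : GL ι ℝ) : Matrix ι ι ℝ)
        = lorentzForm i₀ * (A : Matrix ι ι ℝ)ᵀ * lorentzForm i₀ := by
      have h1 : (lorentzForm i₀ * (A : Matrix ι ι ℝ)ᵀ * lorentzForm i₀) * (A : Matrix ι ι ℝ)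
          = 1 := by
        rw [Matrix.mul_assoc, Matrix.mul_assoc, ← Matrix.mul_assoc (A : Matrix ι ι ℝ)ᵀ, hA, hJ]
      have h2 : (A : Matrix ι ι ℝ) * ((A⁻¹ : GL ι ℝ) : Matrix ι ι ℝ) = 1 := by
        rw [← Units.val_mul, mul_inv_cancel, Units.val_one]
      exact (left_inv_eq_right_inv h1 h2).symm
    refine ⟨?_, ?_, ?_⟩
    · have ht := lorentz_transpose i₀ hA
      have hJt : (lorentzForm i₀)ᵀ = lorentzForm i₀ := Matrix.diagonal_transpose _
      rw [hinv]
      simp only [Matrix.transpose_mul, hJt, Matrix.transpose_transpose]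
      calc _ = lorentzForm i₀ * ((A : Matrix ι ι ℝ) * (lorentzForm i₀ *
              (lorentzForm i₀ * lorentzForm i₀)) * (A : Matrix ι ι ℝ)ᵀ) * lorentzForm i₀ := by
            simp only [Matrix.mul_assoc]
        _ = _ := by rw [hJ, Matrix.mul_one, ht, hJ, Matrix.one_mul]
    · have h2 : (A : Matrix ι ι ℝ).det * ((A⁻¹ : GL ι ℝ) : Matrix ι ι ℝ).det = 1 := by
        rw [← Matrix.det_mul, ← Units.val_mul, mul_inv_cancel, Units.val_one, Matrix.det_one]
      rwa [hA1, one_mul] at h2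
    · rw [hinv]
      simp only [lorentzForm, Matrix.mul_diagonal, Matrix.diagonal_mul, Matrix.transpose_apply,
        if_true]
      linarith

/-- Coordinates of Minkowski space `ℝ₁^{n+4}`; the time coordinate is `Sum.inl 0`. -/
abbrev MinkIdx (n : ℕ) : Type := Fin 4 ⊕ Fin n

/-- The underlying vector space of Minkowski space `ℝ₁^{n+4}`. -/
abbrev Mink (n : ℕ) : Type := MinkIdx n → ℝ

/-- The Lorentzian product `⟨x, y⟩ = -x₀ y₀ + ∑ xⱼ yⱼ`. -/
def minkInner {n : ℕ} (x y : Mink n) : ℝ :=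
  x ⬝ᵥ (lorentzForm (Sum.inl 0 : MinkIdx n) *ᵥ y)

/-- The group `SO⁺(1, n+3)`. -/
abbrev LorentzG (n : ℕ) : Subgroup (GL (MinkIdx n) ℝ) := SOPlus (Sum.inl 0 : MinkIdx n)

/-- The matrix `D = diag(-I₄, Iₙ)`. -/
def involD (n : ℕ) : Matrix (MinkIdx n) (MinkIdx n) ℝ := Matrix.fromBlocks (-1) 0 0 1

/-- The subgroup `SO⁺(1,3) × SO(n)` of `SO⁺(1, n+3)`, embedded block diagonally. -/
def LorentzK (n : ℕ) : Subgroup (LorentzG n) where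
  carrier := {g | ∃ A ∈ SOPlus (0 : Fin 4), ∃ B ∈ Matrix.specialOrthogonalGroup (Fin n) ℝ,
    ((g : GL (MinkIdx n) ℝ) : Matrix (MinkIdx n) (MinkIdx n) ℝ)
      = Matrix.fromBlocks (A : Matrix (Fin 4) (Fin 4) ℝ) 0 0 B}
  one_mem' := ⟨1, one_mem _, 1, one_mem _, by simp⟩
  mul_mem' := by
    rintro g h ⟨A, hA, B, hB, hg⟩ ⟨A', hA', B', hB', hh⟩
    refine ⟨A * A', mul_mem hA hA', B * B', mul_mem hB hB', ?_⟩
    simp [hg, hh, Matrix.fromBlocks_multiply]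
  inv_mem' := by
    rintro g ⟨A, hA, B, hB, hg⟩
    refine ⟨A⁻¹, inv_mem hA, star B, ?_, ?_⟩
    · rw [Matrix.mem_specialOrthogonalGroup_iff] at hB ⊢
      refine ⟨?_, ?_⟩
      · exact Unitary.star_mem hB.1
      · rw [Matrix.star_eq_conjTranspose, Matrix.det_conjTranspose, hB.2, star_one]
    · have hBB : B * star B = 1 := by
        rw [Matrix.mem_specialOrthogonalGroup_iff] at hB
        exact (Matrix.mem_orthogonalGroup_iff (Fin n) ℝ).1 hB.1
      have h1 : ((g : GL (MinkIdx n) ℝ) : Matrix (MinkIdx n) (MinkIdx n) ℝ) *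
          Matrix.fromBlocks ((A⁻¹ : GL (Fin 4) ℝ) : Matrix (Fin 4) (Fin 4) ℝ) 0 0 (star B)
          = 1 := by
        rw [hg, Matrix.fromBlocks_multiply]
        simp only [Matrix.mul_zero, Matrix.zero_mul, add_zero, zero_add, hBB]
        rw [← Units.val_mul, mul_inv_cancel, Units.val_one, Matrix.fromBlocks_one]
      have h2 : (((g⁻¹ : LorentzG n) : GL (MinkIdx n) ℝ) : Matrix (MinkIdx n) (MinkIdx n) ℝ) *
          ((g : GL (MinkIdx n) ℝ) : Matrix (MinkIdx n) (MinkIdx n) ℝ) = 1 := by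
        rw [Subgroup.coe_inv, ← Units.val_mul, inv_mul_cancel, Units.val_one]
      exact left_inv_eq_right_inv h2 h1

/-- The symmetric space `SO⁺(1,n+3) / (SO⁺(1,3) × SO(n))`. The class of `g` corresponds to the
Lorentzian 4-plane spanned by the first four columns of `g`, oriented by these columns. -/
abbrev LorentzGr (n : ℕ) : Type := LorentzG n ⧸ LorentzK n

/-- The matrix underlying an element of `SO⁺(1, n+3)`. -/
def LorentzG.mat {n : ℕ} (g : LorentzG n) : Matrix (MinkIdx n) (MinkIdx n) ℝ :=
  ((g : GL (MinkIdx n) ℝ) : Matrix (MinkIdx n) (MinkIdx n) ℝ)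

lemma LorentzG.mat_mul {n : ℕ} (g h : LorentzG n) :
    LorentzG.mat (g * h) = LorentzG.mat g * LorentzG.mat h := rfl

lemma LorentzG.mat_mul_inv {n : ℕ} (g : LorentzG n) :
    LorentzG.mat g * LorentzG.mat g⁻¹ = 1 := by
  rw [← LorentzG.mat_mul, mul_inv_cancel]; rfl

lemma LorentzG.mat_comm_involD {n : ℕ} (g : LorentzG n) (hg : g ∈ LorentzK n) :
    LorentzG.mat g * involD n = involD n * LorentzG.mat g := by
  obtain ⟨A, -, B, -, h⟩ := hg
  have h' : LorentzG.mat g = Matrix.fromBlocks (A : Matrix (Fin 4) (Fin 4) ℝ) 0 0 B := h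
  rw [h', involD, Matrix.fromBlocks_multiply, Matrix.fromBlocks_multiply]
  simp

/-- The standard (Cartan) realization `gK ↦ g D g⁻¹` of the symmetric space in the space of
matrices: a plane `V` is sent to the linear map that is `-1` on `V` and `+1` on `V^⊥`. It is an
immersion, equivariant under conjugation, and the trace form `tr(XY)` of the space of matrices
induces a constant multiple of the invariant pseudo-Riemannian metric. -/
def LorentzGr.cartan {n : ℕ} (x : LorentzGr n) : Matrix (MinkIdx n) (MinkIdx n) ℝ :=
  Quotient.liftOn' x (fun g => LorentzG.mat g * involD n * LorentzG.mat g⁻¹) (by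
    intro g h hgh
    rw [QuotientGroup.leftRel_apply] at hgh
    have hh : h = g * (g⁻¹ * h) := by group
    generalize g⁻¹ * h = k at hgh hh
    subst hh
    have hk := LorentzG.mat_comm_involD k hgh
    have e := LorentzG.mat_mul_inv k
    simp only [mul_inv_rev, LorentzG.mat_mul]
    calc _ = LorentzG.mat g * involD n * (LorentzG.mat k * LorentzG.mat k⁻¹)
            * LorentzG.mat g⁻¹ := by rw [e, Matrix.mul_one]
      _ = LorentzG.mat g * (involD n * LorentzG.mat k) * LorentzG.mat k⁻¹
            * LorentzG.mat g⁻¹ := by simp only [Matrix.mul_assoc]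
      _ = _ := by rw [← hk]; simp only [Matrix.mul_assoc])

/-! ## Coordinate derivatives

For a function of the complex coordinate `z = u + i v`. -/

section Coordinates

variable {E : Type*} [NormedAddCommGroup E] [NormedSpace ℝ E]

/-- The partial derivative `∂/∂u`. -/
def dU (g : ℂ → E) (z : ℂ) : E := fderiv ℝ g z 1

/-- The partial derivative `∂/∂v`. -/
def dV (g : ℂ → E) (z : ℂ) : E := fderiv ℝ g z Complex.I

/-- The flat Laplacian `∂²/∂u² + ∂²/∂v² = 4 ∂²/∂z∂z̄`. -/
def flatLaplacian (g : ℂ → E) (z : ℂ) : E := dU (dU g) z + dV (dV g) z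

end Coordinates

/-- `∂/∂z = (∂/∂u - i ∂/∂v)/2` of a real valued function. -/
def dZ (g : ℂ → ℝ) (z : ℂ) : ℂ := (((dU g z : ℝ) : ℂ) - Complex.I * ((dV g z : ℝ) : ℂ)) / 2

/-! ## The unit sphere and the Willmore functional -/

/-- Euclidean space `ℝ^{n+3}`. -/
abbrev Euc (n : ℕ) : Type := EuclideanSpace ℝ (Fin 3 ⊕ Fin n)

/-- The unit sphere `S^{n+2}` of `ℝ^{n+3}`. -/
abbrev Sph (n : ℕ) : Type := Metric.sphere (0 : Euc n) 1

/-- Normal part in `T S^{n+2}` of a vector of `ℝ^{n+3}`, for the parametrized surface `g` at `z`: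
the orthogonal projection to the complement of the span of `g`, `g_u`, `g_v`. -/
def normalPart {n : ℕ} (g : ℂ → Euc n) (z : ℂ) (x : Euc n) : Euc n :=
  (Submodule.span ℝ {g z, dU g z, dV g z})ᗮ.starProjection x

/-- The coefficient at `(∂_u, ∂_u)` of the second fundamental form of the immersion `g` into
`S^{n+2}`. -/
def secondUU {n : ℕ} (g : ℂ → Euc n) (z : ℂ) : Euc n := normalPart g z (dU (dU g) z)
/-- The coefficient of the second fundamental form at `(∂_u, ∂_v)`. -/
def secondUV {n : ℕ} (g : ℂ → Euc n) (z : ℂ) : Euc n := normalPart g z (dU (dV g) z)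
/-- The coefficient of the second fundamental form at `(∂_v, ∂_v)`. -/
def secondVV {n : ℕ} (g : ℂ → Euc n) (z : ℂ) : Euc n := normalPart g z (dV (dV g) z)

/-- The coefficient `E` of the induced metric `E du² + 2 F du dv + G dv²`. -/
def metE {n : ℕ} (g : ℂ → Euc n) (z : ℂ) : ℝ := inner ℝ (dU g z) (dU g z)
/-- The coefficient `F` of the induced metric. -/
def metF {n : ℕ} (g : ℂ → Euc n) (z : ℂ) : ℝ := inner ℝ (dU g z) (dV g z)
/-- The coefficient `G` of the induced metric. -/
def metG {n : ℕ} (g : ℂ → Euc n) (z : ℂ) : ℝ := inner ℝ (dV g z) (dV g z)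

/-- The determinant of the induced metric. -/
def metDet {n : ℕ} (g : ℂ → Euc n) (z : ℂ) : ℝ := metE g z * metG g z - metF g z ^ 2

/-- The mean curvature vector in `S^{n+2}`: half the trace of the second fundamental form. -/
def meanCurvatureVec {n : ℕ} (g : ℂ → Euc n) (z : ℂ) : Euc n :=
  (2 * metDet g z)⁻¹ •
    (metG g z • secondUU g z - (2 * metF g z) • secondUV g z + metE g z • secondVV g z)

/-- The Gauss curvature of the induced metric, expressed by the Gauss equation in `S^{n+2}`. -/
def gaussCurvature {n : ℕ} (g : ℂ → Euc n) (z : ℂ) : ℝ :=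
  1 + (inner ℝ (secondUU g z) (secondVV g z) - inner ℝ (secondUV g z) (secondUV g z)) / metDet g z

/-- The integrand `(|H|² - K + 1) dM` of the Willmore functional, as a multiple of `du dv`. -/
def willmoreDensity {n : ℕ} (g : ℂ → Euc n) (z : ℂ) : ℝ :=
  (‖meanCurvatureVec g z‖ ^ 2 - gaussCurvature g z + 1) * Real.sqrt (metDet g z)

/-! ## Lifts to the light cone -/

/-- The lift `(1, x)` of a point `x` of the sphere to the forward light cone. -/
def coneLift {n : ℕ} (x : Euc n) : Mink n :=
  Sum.elim (Fin.cons 1 fun i => x (Sum.inl i)) fun j => x (Sum.inr j)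

/-- The canonical lift `Y` of a conformal immersion `g`: the positive multiple of `(1, g)` with
`|dY|² = |dz|²`. -/
def canonicalLift {n : ℕ} (g : ℂ → Euc n) (z : ℂ) : Mink n := ‖dU g z‖⁻¹ • coneLift (g z)

/-- The section `N = 2 Y_{z z̄} + 2 ⟨Y_{z z̄}, Y_{z z̄}⟩ Y`, which is the one of the span of
`Y, Y_u, Y_v, Y_{z z̄}` with `⟨N, Y_u⟩ = ⟨N, Y_v⟩ = ⟨N, N⟩ = 0` and `⟨N, Y⟩ = -1`. -/
def lightlikeN {n : ℕ} (g : ℂ → Euc n) (z : ℂ) : Mink n :=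
  (1 / 2 : ℝ) • flatLaplacian (canonicalLift g) z +
    (1 / 8 * minkInner (flatLaplacian (canonicalLift g) z) (flatLaplacian (canonicalLift g) z)) •
      canonicalLift g z

/-- The basis `{Y, N, Y_u, Y_v}` of the fibre `V_p`, which also fixes its orientation. -/
def gaussBasis {n : ℕ} (g : ℂ → Euc n) (z : ℂ) : Fin 4 → Mink n :=
  ![canonicalLift g z, lightlikeN g z, dU (canonicalLift g) z, dV (canonicalLift g) z]

/-- The linearly independent families `b` and `b'` of four vectors span the same subspace and
define the same orientation of it: `b'` arises from `b` by a matrix of positive determinant. -/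
def SameOrientedSpan {n : ℕ} (b b' : Fin 4 → Mink n) : Prop :=
  ∃ C : Matrix (Fin 4) (Fin 4) ℝ, 0 < C.det ∧ ∀ j, b' j = ∑ i, C i j • b i

/-! ## Surfaces -/

section Surfaces

variable {M : Type*} [TopologicalSpace M] [ChartedSpace ℂ M] {n : ℕ}

/-- `φ` is a holomorphic coordinate `z = u + i v` of the Riemann surface `M`. -/
def IsCoordinate (φ : OpenPartialHomeomorph M ℂ) : Prop :=
  φ ∈ IsManifold.maximalAtlas 𝓘(ℂ) ω M

/-- The map `y` written in the coordinate `φ`. -/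
def inCoord (y : M → Sph n) (φ : OpenPartialHomeomorph M ℂ) (z : ℂ) : Euc n :=
  (y (φ.symm z) : Euc n)

/-- Smooth maps into the sphere. -/
def IsSmoothSphereMap (y : M → Sph n) : Prop :=
  ContMDiff 𝓘(ℝ, ℂ) 𝓘(ℝ, Euc n) ∞ fun p => (y p : Euc n)

/-- `y` is a conformal immersion on `W`. The conditions say `⟨Y_z, Y_z⟩ = 0` and
`⟨Y_z, Y_z̄⟩ > 0` for the lift `Y = (1, y)`, hence for every positive multiple of it. -/
def IsConformalImmersionOn (y : M → Sph n) (W : Set M) : Prop :=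
  ∀ φ : OpenPartialHomeomorph M ℂ, IsCoordinate φ → ∀ p ∈ φ.source ∩ W,
    metE (inCoord y φ) (φ p) = metG (inCoord y φ) (φ p) ∧
    metF (inCoord y φ) (φ p) = 0 ∧
    0 < metE (inCoord y φ) (φ p)

/-- `v` is a smooth variation `t ↦ v t` of `y` on `W`, supported in the compact set `K ⊆ W`. -/
structure IsVariation (y : M → Sph n) (W K : Set M) (v : ℝ → M → Sph n) : Prop where
  isCompact : IsCompact K
  subset : K ⊆ W
  smooth : ContMDiffOn (𝓘(ℝ, ℝ).prod 𝓘(ℝ, ℂ)) 𝓘(ℝ, Euc n) ∞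
    (fun q : ℝ × M => (v q.1 q.2 : Euc n)) (Set.univ ×ˢ W)
  zero : v 0 = y
  support : ∀ t, ∀ p ∉ K, v t p = y p

/-- A decomposition of `K` into finitely many disjoint measurable pieces, each relatively compact
in the domain of a coordinate. Integrals over `K` are computed with such decompositions. -/
structure CoordDecomposition (K : Set M) where
  size : ℕ
  chart : Fin size → OpenPartialHomeomorph M ℂ
  piece : Fin size → Set M
  isCoordinate : ∀ i, IsCoordinate (chart i)
  closure_subset : ∀ i, closure (piece i) ⊆ (chart i).source
  measurable : ∀ i, MeasurableSet (chart i '' piece i)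
  disjoint : Pairwise fun i j => Disjoint (piece i) (piece j)
  union : ⋃ i, piece i = K

/-- The Willmore functional `∫_K (|H|² - K + 1) dM`. As the integrand is an invariantly defined
density, the value does not depend on the decomposition. -/
def CoordDecomposition.willmoreEnergy {K : Set M} (D : CoordDecomposition K) (y : M → Sph n) : ℝ :=
  ∑ i, ∫ z in D.chart i '' D.piece i, willmoreDensity (inCoord y (D.chart i)) z

/-- The immersion `y` on `W` is a Willmore surface: it is a critical point of the Willmore
functional with respect to all variations with compact support in `W`. -/
def IsWillmoreOn (y : M → Sph n) (W : Set M) : Prop :=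
  ∀ (K : Set M) (v : ℝ → M → Sph n), IsVariation y W K v → ∀ D : CoordDecomposition K,
    HasDerivAt (fun t => D.willmoreEnergy (v t)) 0 0

/-- `W` is an open set on which `y` is a conformal Willmore immersion. -/
def IsConformalWillmoreImmersionOn (y : M → Sph n) (W : Set M) : Prop :=
  IsOpen W ∧ IsConformalImmersionOn y W ∧ IsWillmoreOn y W

/-- Willmore maps: smooth maps that are conformal Willmore immersions on an open dense subset. -/
def IsWillmoreMap (y : M → Sph n) : Prop :=
  IsSmoothSphereMap y ∧ ∃ W : Set M, Dense W ∧ IsConformalWillmoreImmersionOn y W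

/-- The maximal open subset of `M` on which `y` is a conformal Willmore immersion; its complement
is the set of branch points. -/
def willmoreLocus (y : M → Sph n) : Set M :=
  ⋃₀ {W | IsConformalWillmoreImmersionOn y W}

/-- A smooth frame `F` of `f` on `U`: a smooth map `F` on `U` into `SO⁺(1,n+3)` that lifts `f`. -/
def IsFrameOn (f : M → LorentzGr n) (F : M → LorentzG n) (U : Set M) : Prop :=
  (∀ i j, ContMDiffOn 𝓘(ℝ, ℂ) 𝓘(ℝ, ℝ) ∞ (fun q => LorentzG.mat (F q) i j) U) ∧
    ∀ q ∈ U, (QuotientGroup.mk (F q) : LorentzGr n) = f q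

/-- Smooth maps into the homogeneous space: those that locally have smooth frames. -/
def IsSmoothGrMap (f : M → LorentzGr n) : Prop :=
  ∀ p : M, ∃ U : Set M, IsOpen U ∧ p ∈ U ∧ ∃ F : M → LorentzG n, IsFrameOn f F U

/-- `f` is on `W` the conformal Gauss map of the conformal immersion `y`: `f p` is the 4-plane
`V_p` spanned and oriented by `{Y, N, Y_u, Y_v}`. -/
def IsConformalGaussMapOn (y : M → Sph n) (f : M → LorentzGr n) (W : Set M) : Prop :=
  ∀ φ : OpenPartialHomeomorph M ℂ, IsCoordinate φ → ∀ p ∈ φ.source ∩ W,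
    ∀ g : LorentzG n, (QuotientGroup.mk g : LorentzGr n) = f p →
      SameOrientedSpan (fun (i : Fin 4) k => LorentzG.mat g k (Sum.inl i))
        (gaussBasis (inCoord y φ) (φ p))

/-- `f` is a smooth map on all of `M` that extends the conformal Gauss map of `y`. -/
def IsExtendedConformalGaussMap (y : M → Sph n) (f : M → LorentzGr n) : Prop :=
  IsSmoothGrMap f ∧ IsConformalGaussMapOn y f (willmoreLocus y)

/-- Strong Willmore maps: Willmore maps whose conformal Gauss map extends smoothly to `M`. -/
def IsStrongWillmoreMap (y : M → Sph n) : Prop :=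
  IsWillmoreMap y ∧ ∃ f : M → LorentzGr n, IsExtendedConformalGaussMap y f

/-! ## Harmonicity -/

/-- The Laplacian in the coordinate `φ` of the realization of `f` in the space of matrices. -/
def cartanLaplacian (f : M → LorentzGr n) (φ : OpenPartialHomeomorph M ℂ) (z : ℂ) :
    Matrix (MinkIdx n) (MinkIdx n) ℝ :=
  Matrix.of fun i j => flatLaplacian (fun w => LorentzGr.cartan (f (φ.symm w)) i j) z

/-- Harmonic maps into the symmetric space. With the symmetric space realized in the space of
matrices with the trace form, the tension field is the tangential part of the Laplacian; tangent
vectors at `S` are the commutators `[X, S]` with `X ∈ so(1,n+3)`. So the tension field vanishes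
if and only if the Laplacian is orthogonal to all of these. -/
def IsHarmonicGrMap (f : M → LorentzGr n) : Prop :=
  IsSmoothGrMap f ∧
    ∀ φ : OpenPartialHomeomorph M ℂ, IsCoordinate φ → ∀ z ∈ φ.target,
      ∀ X : Matrix (MinkIdx n) (MinkIdx n) ℝ,
        Xᵀ * lorentzForm (Sum.inl 0) + lorentzForm (Sum.inl 0) * X = 0 →
          Matrix.trace ((X * LorentzGr.cartan (f (φ.symm z)) - LorentzGr.cartan (f (φ.symm z)) * X)
            * cartanLaplacian f φ z) = 0

/-- The value `α(∂/∂z) = F⁻¹ F_z` of the Maurer-Cartan form `α = F⁻¹ dF`. -/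
def maurerCartanZ (F : M → LorentzG n) (φ : OpenPartialHomeomorph M ℂ) (z : ℂ) :
    Matrix (MinkIdx n) (MinkIdx n) ℂ :=
  (LorentzG.mat (F (φ.symm z))⁻¹).map Complex.ofReal *
    Matrix.of fun i j => dZ (fun w => LorentzG.mat (F (φ.symm w)) i j) z

/-- The `(1,2)`-block `B₁` of `α(∂/∂z)`, which is the one of its `𝔭`-part. -/
def blockB (F : M → LorentzG n) (φ : OpenPartialHomeomorph M ℂ) (z : ℂ) :
    Matrix (Fin 4) (Fin n) ℂ :=
  (maurerCartanZ F φ z).toBlocks₁₂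

/-- Strongly conformally harmonic maps: harmonic maps such that near every point there is a frame
with `B₁ᵗ I_{1,3} B₁ = 0`. -/
def IsStronglyConformallyHarmonic (f : M → LorentzGr n) : Prop :=
  IsHarmonicGrMap f ∧
    ∀ p : M, ∃ U : Set M, IsOpen U ∧ p ∈ U ∧ ∃ F : M → LorentzG n, IsFrameOn f F U ∧
      ∀ φ : OpenPartialHomeomorph M ℂ, IsCoordinate φ → ∀ q ∈ φ.source ∩ U,
        (blockB F φ (φ q))ᵀ * (lorentzForm (0 : Fin 4)).map Complex.ofReal * blockB F φ (φ q) = 0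

end Surfaces

end

noncomputable section

/-! ### Lorentzian linear algebra: self-adjoint and rank one operators. -/

section MinkAlgebra

variable {n : ℕ}

/-! A Lorentzian 4-plane $V$ is encoded by the orthogonal projection $P$ to $V^\perp$; its Cartan
realization is $S = 2P-1$. Where $y$ is a conformal immersion, $V$ is spanned by $Y=(1,y)$, $y_u$,
$y_v$ and a second null vector $N$ built from the mean curvature vector $H$. So $P$ is an explicit
function of the 2-jet of $y$ (`surfProj`), and the same formula makes sense for immersions that are
not conformal.

The heart of the proof is a comparison of two functionals which avoids the Willmore equation. Let $k
= II - gH$ be the trace-free second fundamental form. For every immersion into the sphere, the flat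
Dirichlet density $\frac14\mathrm{tr}(P_u^2+P_v^2)$ is $\frac{E+G}{2\sqrt{EG-F^2}}$ times the
Willmore density (`dirichlet_density`, `jetWillmore_eq`). Since the latter is nonnegative, the
Dirichlet integral dominates the Willmore integral, with equality for conformal immersions. Along a
variation starting at a conformal $y$, the difference of the two therefore has a minimum at $t=0$,
and a critical point of the Willmore functional is critical for the Dirichlet integral along the
same variation (`setIntegral_dirD_gaussDirichlet_eq_zero`). The variation itself need not stay
conformal.

Integration by parts turns this into $\int \mathrm{tr}(\Delta P\,\delta P)=0$. The tension
$P\,\Delta P\,(1-P)$ kills $Y$, $y_u$ and $y_v$ by the structure equations, so it is determined by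
the vector $T = P\,\Delta P\,N$ (`surfTension`). From $\delta P\,Y=-P\,\delta y$ it follows that
$\mathrm{tr}(\Delta P\,\delta P) = -2\langle T,\delta y\rangle$ (`trace_dirLap_mul`), and the
fundamental lemma of the calculus of variations gives $T=0$. Then $P$ commutes with $\Delta P$,
which is harmonicity in the Cartan realization.

Strong conformality comes from the trace-freeness of $k$: in a conformal coordinate $P y_{vv}=-P
y_{uu}$, whence $PP_uP_uP = PP_vP_vP$ and $PP_uP_vP=-PP_vP_uP$ (`strongly_conformal`). Conjugation
by a frame $F$ turns $S_u$ and $S_v$ into commutators of $F^{-1}F_u$ and $F^{-1}F_v$ with $D$, so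
these two identities are the real and imaginary parts of $B_1^tI_{1,3}B_1=0$.

Both conclusions are closed conditions on the 2-jet of $S$, which is smooth on all of $M$. They hold
on the dense immersed locus, hence everywhere. -/

lemma minkInner_comm (x y : Mink n) : minkInner x y = minkInner y x := by
  simp only [minkInner, lorentzForm, Matrix.mulVec_diagonal, dotProduct]
  exact Finset.sum_congr rfl fun i _ => by ring

lemma minkInner_add_left (x y z : Mink n) :
    minkInner (x + y) z = minkInner x z + minkInner y z := add_dotProduct _ _ _

lemma minkInner_smul_left (c : ℝ) (x y : Mink n) :
    minkInner (c • x) y = c * minkInner x y := smul_dotProduct _ _ _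

lemma minkInner_add_right (x y z : Mink n) :
    minkInner x (y + z) = minkInner x y + minkInner x z := by
  simp only [minkInner, Matrix.mulVec_add, dotProduct_add]

lemma minkInner_smul_right (c : ℝ) (x y : Mink n) :
    minkInner x (c • y) = c * minkInner x y := by
  simp only [minkInner, Matrix.mulVec_smul, dotProduct_smul, smul_eq_mul]

lemma minkInner_neg_left (x y : Mink n) : minkInner (-x) y = -minkInner x y :=
  neg_dotProduct _ _

lemma minkInner_neg_right (x y : Mink n) : minkInner x (-y) = -minkInner x y := by
  rw [minkInner_comm, minkInner_neg_left, minkInner_comm]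

lemma minkInner_sub_left (x y z : Mink n) :
    minkInner (x - y) z = minkInner x z - minkInner y z := sub_dotProduct _ _ _

lemma minkInner_sub_right (x y z : Mink n) :
    minkInner x (y - z) = minkInner x y - minkInner x z := by
  rw [minkInner_comm, minkInner_sub_left, minkInner_comm y, minkInner_comm z]

lemma minkInner_zero_left (x : Mink n) : minkInner 0 x = 0 := zero_dotProduct _

lemma minkInner_zero_right (x : Mink n) : minkInner x 0 = 0 := by
  rw [minkInner_comm, minkInner_zero_left]

/-- The Lorentzian product is nondegenerate. -/
lemma eq_zero_of_minkInner_left {w : Mink n} (h : ∀ x, minkInner x w = 0) : w = 0 := by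
  have h1 : lorentzForm (Sum.inl 0 : MinkIdx n) *ᵥ w = 0 :=
    dotProduct_eq_zero _ fun x => by rw [dotProduct_comm]; exact h x
  have h2 := congrArg (fun v => lorentzForm (Sum.inl 0 : MinkIdx n) *ᵥ v) h1
  simpa [Matrix.mulVec_mulVec, lorentzForm_mul_self] using h2

/-- The matrix `A` is self-adjoint for the Lorentzian product. -/
def IsMinkSym (A : Matrix (MinkIdx n) (MinkIdx n) ℝ) : Prop :=
  Aᵀ * lorentzForm (Sum.inl 0) = lorentzForm (Sum.inl 0) * A

lemma lorentzForm_transpose {ι : Type} [DecidableEq ι] (i₀ : ι) :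
    (lorentzForm i₀)ᵀ = lorentzForm i₀ := Matrix.diagonal_transpose _

lemma IsMinkSym.minkInner_mulVec {A : Matrix (MinkIdx n) (MinkIdx n) ℝ} (hA : IsMinkSym A)
    (x y : Mink n) : minkInner (A *ᵥ x) y = minkInner x (A *ᵥ y) := by
  unfold minkInner
  rw [Matrix.mulVec_mulVec, ← hA, ← Matrix.mulVec_mulVec, Matrix.dotProduct_mulVec,
    Matrix.dotProduct_mulVec x, Matrix.vecMul_transpose, ← Matrix.dotProduct_mulVec]

lemma isMinkSym_one : IsMinkSym (1 : Matrix (MinkIdx n) (MinkIdx n) ℝ) := by simp [IsMinkSym]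

lemma IsMinkSym.add {A B : Matrix (MinkIdx n) (MinkIdx n) ℝ} (hA : IsMinkSym A)
    (hB : IsMinkSym B) : IsMinkSym (A + B) := by
  unfold IsMinkSym at *
  rw [Matrix.transpose_add, Matrix.add_mul, Matrix.mul_add, hA, hB]

lemma IsMinkSym.smul {A : Matrix (MinkIdx n) (MinkIdx n) ℝ} (hA : IsMinkSym A) (c : ℝ) :
    IsMinkSym (c • A) := by
  unfold IsMinkSym at *
  rw [Matrix.transpose_smul, Matrix.smul_mul, Matrix.mul_smul, hA]

lemma IsMinkSym.sub {A B : Matrix (MinkIdx n) (MinkIdx n) ℝ} (hA : IsMinkSym A)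
    (hB : IsMinkSym B) : IsMinkSym (A - B) := by
  unfold IsMinkSym at *
  rw [Matrix.transpose_sub, Matrix.sub_mul, Matrix.mul_sub, hA, hB]

/-- Transposition preserves the trace and reverses the product, and it replaces each self-adjoint
factor by its conjugate under the form; these conjugations cancel in the trace. -/
lemma trace_mul_mul_of_isMinkSym {A B C : Matrix (MinkIdx n) (MinkIdx n) ℝ}
    (hA : IsMinkSym A) (hB : IsMinkSym B) (hC : IsMinkSym C) :
    (A * B * C).trace = (C * B * A).trace := by
  have hJ := lorentzForm_mul_self (Sum.inl 0 : MinkIdx n)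
  unfold IsMinkSym at *
  rw [← Matrix.trace_transpose (A * B * C), Matrix.transpose_mul, Matrix.transpose_mul]
  have : Cᵀ * (Bᵀ * Aᵀ) = lorentzForm (Sum.inl 0) * ((C * B * A) * lorentzForm (Sum.inl 0)) := by
    calc Cᵀ * (Bᵀ * Aᵀ) = Cᵀ * (Bᵀ * (Aᵀ * lorentzForm (Sum.inl 0))) * lorentzForm (Sum.inl 0) := by
          simp only [Matrix.mul_assoc, hJ, Matrix.mul_one]
      _ = Cᵀ * (Bᵀ * lorentzForm (Sum.inl 0)) * A * lorentzForm (Sum.inl 0) := by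
          rw [hA]; simp only [Matrix.mul_assoc]
      _ = Cᵀ * lorentzForm (Sum.inl 0) * B * A * lorentzForm (Sum.inl 0) := by
          rw [hB]; simp only [Matrix.mul_assoc]
      _ = _ := by rw [hC]; simp only [Matrix.mul_assoc]
  rw [this, Matrix.trace_mul_comm, Matrix.mul_assoc, hJ, Matrix.mul_one]

/-- The rank one operator `z ↦ ⟨y, z⟩ x`. -/
def minkOuter (x y : Mink n) : Matrix (MinkIdx n) (MinkIdx n) ℝ :=
  Matrix.vecMulVec x (lorentzForm (Sum.inl 0) *ᵥ y)

lemma minkOuter_mulVec (x y z : Mink n) : minkOuter x y *ᵥ z = minkInner y z • x := by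
  rw [minkOuter, Matrix.vecMulVec_mulVec, minkInner_comm, minkInner, dotProduct_comm]
  ext; simp [mul_comm]

lemma mul_minkOuter (A : Matrix (MinkIdx n) (MinkIdx n) ℝ) (x y : Mink n) :
    A * minkOuter x y = minkOuter (A *ᵥ x) y := Matrix.mul_vecMulVec _ _ _

lemma minkOuter_mul {A : Matrix (MinkIdx n) (MinkIdx n) ℝ} (hA : IsMinkSym A) (x y : Mink n) :
    minkOuter x y * A = minkOuter x (A *ᵥ y) := by
  rw [minkOuter, minkOuter, Matrix.vecMulVec_mul, Matrix.mulVec_mulVec, ← hA,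
    ← Matrix.mulVec_mulVec, Matrix.mulVec_transpose]

lemma trace_minkOuter (x y : Mink n) : (minkOuter x y).trace = minkInner x y :=
  Matrix.trace_vecMulVec _ _

lemma minkOuter_add_sym (x y : Mink n) : IsMinkSym (minkOuter x y + minkOuter y x) := by
  unfold IsMinkSym minkOuter
  rw [Matrix.transpose_add, Matrix.transpose_vecMulVec, Matrix.transpose_vecMulVec,
    Matrix.add_mul, Matrix.mul_add, Matrix.vecMulVec_mul, Matrix.vecMulVec_mul,
    Matrix.mul_vecMulVec, Matrix.mul_vecMulVec, ← Matrix.mulVec_transpose,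
    ← Matrix.mulVec_transpose, lorentzForm_transpose, add_comm]

lemma minkOuter_self_sym (x : Mink n) : IsMinkSym (minkOuter x x) := by
  have := (minkOuter_add_sym x x).smul (1 / 2)
  rwa [← two_smul ℝ (minkOuter x x), smul_smul, one_div, inv_mul_cancel₀ two_ne_zero,
    one_smul] at this

lemma matrix_ext_mulVec {A B : Matrix (MinkIdx n) (MinkIdx n) ℝ} (h : ∀ x, A *ᵥ x = B *ᵥ x) :
    A = B := Matrix.mulVec_injective (funext h)

/-! ### The projection along a Lorentzian 4-plane -/

/-- The determinant of the Gram matrix of two vectors. -/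
def gramDet (a b : Mink n) : ℝ := minkInner a a * minkInner b b - minkInner a b ^ 2

/-- `Y`, `N` are null vectors with `⟨Y, N⟩ = 1`, orthogonal to the nondegenerate plane spanned by
`a` and `b`. -/
structure IsNullFrame (Y N a b : Mink n) : Prop where
  YY : minkInner Y Y = 0
  NN : minkInner N N = 0
  YN : minkInner Y N = 1
  Ya : minkInner Y a = 0
  Yb : minkInner Y b = 0
  Na : minkInner N a = 0
  Nb : minkInner N b = 0
  det : gramDet a b ≠ 0

/-- The orthogonal projection to the span of a null frame. -/
def frameProj (Y N a b : Mink n) : Matrix (MinkIdx n) (MinkIdx n) ℝ :=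
  (minkOuter Y N + minkOuter N Y) +
    (gramDet a b)⁻¹ • (minkInner b b • minkOuter a a
      - minkInner a b • (minkOuter a b + minkOuter b a) + minkInner a a • minkOuter b b)

/-- The orthogonal projection to the orthogonal complement of a null frame. -/
def coProj (Y N a b : Mink n) : Matrix (MinkIdx n) (MinkIdx n) ℝ := 1 - frameProj Y N a b

lemma frameProj_mulVec (Y N a b x : Mink n) : frameProj Y N a b *ᵥ x =
    minkInner N x • Y + minkInner Y x • N +
    (gramDet a b)⁻¹ • ((minkInner b b * minkInner a x - minkInner a b * minkInner b x) • a
      + (minkInner a a * minkInner b x - minkInner a b * minkInner a x) • b) := by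
  simp only [frameProj, Matrix.add_mulVec, Matrix.sub_mulVec, Matrix.smul_mulVec,
    minkOuter_mulVec]
  module

lemma coProj_mulVec (Y N a b x : Mink n) : coProj Y N a b *ᵥ x =
    x - frameProj Y N a b *ᵥ x := by
  rw [coProj, Matrix.sub_mulVec, Matrix.one_mulVec]

lemma frameProj_sym (Y N a b : Mink n) : IsMinkSym (frameProj Y N a b) :=
  (minkOuter_add_sym _ _).add (((((minkOuter_self_sym _).smul _).sub
    ((minkOuter_add_sym _ _).smul _)).add ((minkOuter_self_sym _).smul _)).smul _)

lemma coProj_sym (Y N a b : Mink n) : IsMinkSym (coProj Y N a b) :=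
  isMinkSym_one.sub (frameProj_sym _ _ _ _)

namespace IsNullFrame

variable {Y N a b : Mink n} (h : IsNullFrame Y N a b)
include h

lemma coProj_Y : coProj Y N a b *ᵥ Y = 0 := by
  rw [coProj_mulVec, frameProj_mulVec, minkInner_comm N Y, minkInner_comm a Y,
    minkInner_comm b Y, h.YY, h.YN, h.Ya, h.Yb]
  simp

lemma coProj_N : coProj Y N a b *ᵥ N = 0 := by
  rw [coProj_mulVec, frameProj_mulVec, minkInner_comm a N,
    minkInner_comm b N, h.NN, h.YN, h.Na, h.Nb]
  simp

lemma coProj_a : coProj Y N a b *ᵥ a = 0 := by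
  have h1 : minkInner b b * minkInner a a - minkInner a b * minkInner b a = gramDet a b := by
    rw [gramDet, minkInner_comm b a]; ring
  rw [coProj_mulVec, frameProj_mulVec, h.Ya, h.Na, h1, minkInner_comm b a, mul_comm, sub_self]
  simp [smul_smul, inv_mul_cancel₀ h.det]

lemma coProj_b : coProj Y N a b *ᵥ b = 0 := by
  have h1 : minkInner a a * minkInner b b - minkInner a b * minkInner a b = gramDet a b := by
    rw [gramDet]; ring
  rw [coProj_mulVec, frameProj_mulVec, h.Yb, h.Nb, h1, mul_comm, sub_self]
  simp [smul_smul, inv_mul_cancel₀ h.det]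

lemma coProj_mul_frameProj : coProj Y N a b * frameProj Y N a b = 0 :=
  matrix_ext_mulVec fun x => by
    rw [← Matrix.mulVec_mulVec, frameProj_mulVec]
    simp only [Matrix.mulVec_add, Matrix.mulVec_smul, h.coProj_Y, h.coProj_N, h.coProj_a,
      h.coProj_b, smul_zero, add_zero, Matrix.zero_mulVec]

lemma coProj_mul_self : coProj Y N a b * coProj Y N a b = coProj Y N a b := by
  nth_rewrite 2 [coProj]
  rw [Matrix.mul_sub, h.coProj_mul_frameProj, Matrix.mul_one, sub_zero]

/-- The trace of a projection is its rank. This count identifies `coProj` with the projection coming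
from a point of the symmetric space in `cartanMat_eq`. -/
lemma trace_coProj : (coProj Y N a b).trace = n := by
  have h1 : (frameProj Y N a b).trace = 4 := by
    have := h.det
    simp only [frameProj, Matrix.trace_add, Matrix.trace_sub, Matrix.trace_smul,
      trace_minkOuter, minkInner_comm N Y, minkInner_comm b a, h.YN, smul_eq_mul]
    rw [gramDet] at *
    field_simp
    ring
  rw [coProj, Matrix.trace_sub, h1, Matrix.trace_one]
  simp

/-- If `B` is tangent to the set of projections at `P`, then `tr(AB) = 2 tr(P A (1-P) B)`. -/
lemma trace_mul {A B : Matrix (MinkIdx n) (MinkIdx n) ℝ} (hA : IsMinkSym A) (hB : IsMinkSym B)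
    (hBP : B * coProj Y N a b + coProj Y N a b * B = B) :
    (A * B).trace = 2 * (minkInner (coProj Y N a b *ᵥ (A *ᵥ Y)) (B *ᵥ N)
      + minkInner (coProj Y N a b *ᵥ (A *ᵥ N)) (B *ᵥ Y) + (gramDet a b)⁻¹ *
      (minkInner b b * minkInner (coProj Y N a b *ᵥ (A *ᵥ a)) (B *ᵥ a)
      - minkInner a b * (minkInner (coProj Y N a b *ᵥ (A *ᵥ a)) (B *ᵥ b) +
        minkInner (coProj Y N a b *ᵥ (A *ᵥ b)) (B *ᵥ a))
      + minkInner a a * minkInner (coProj Y N a b *ᵥ (A *ᵥ b)) (B *ᵥ b))) := by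
  have hQ : frameProj Y N a b = 1 - coProj Y N a b := by rw [coProj]; abel
  have hPs := coProj_sym Y N a b
  have hPP := h.coProj_mul_self
  -- Writing $1-P$ as a sum of rank one operators $\langle y,\cdot\rangle x$ turns the trace into a
  -- sum of Lorentzian products of columns of $PA$ and $B$.
  have key : (coProj Y N a b * A * frameProj Y N a b * B).trace =
      minkInner (coProj Y N a b *ᵥ (A *ᵥ Y)) (B *ᵥ N)
      + minkInner (coProj Y N a b *ᵥ (A *ᵥ N)) (B *ᵥ Y) + (gramDet a b)⁻¹ *
      (minkInner b b * minkInner (coProj Y N a b *ᵥ (A *ᵥ a)) (B *ᵥ a)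
      - minkInner a b * (minkInner (coProj Y N a b *ᵥ (A *ᵥ a)) (B *ᵥ b) +
        minkInner (coProj Y N a b *ᵥ (A *ᵥ b)) (B *ᵥ a))
      + minkInner a a * minkInner (coProj Y N a b *ᵥ (A *ᵥ b)) (B *ᵥ b)) := by
    simp only [frameProj, Matrix.mul_add, Matrix.add_mul, Matrix.mul_sub, Matrix.sub_mul,
      Matrix.mul_smul, Matrix.smul_mul, mul_minkOuter, minkOuter_mul hB, Matrix.trace_add,
      Matrix.trace_sub, Matrix.trace_smul, trace_minkOuter, smul_eq_mul, Matrix.mulVec_mulVec]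
  rw [← key, hQ]
  generalize coProj Y N a b = P at *
  -- Multiplying $BP+PB=B$ by $P$ from the left shows that a tangent $B$ has no block from the range
  -- of $P$ to itself. So only the two off-diagonal blocks contribute to the trace, and by
  -- self-adjointness they contribute equally; this is the factor 2.
  have hPBP : P * B * P = 0 := by
    have h1 : P * (B * P + P * B) = P * B := by rw [hBP]
    rw [Matrix.mul_add, ← Matrix.mul_assoc, ← Matrix.mul_assoc, hPP] at h1
    simpa using h1
  have h1 : (A * B).trace = (A * B * P).trace + (A * P * B).trace := by
    rw [← Matrix.trace_add, Matrix.mul_assoc, Matrix.mul_assoc, ← Matrix.mul_add, hBP]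
  have h2 : (A * B * P).trace = (P * A * B).trace := by
    rw [Matrix.trace_mul_comm, Matrix.mul_assoc]
  have h3 : (A * P * B).trace = (P * A * B).trace := by
    rw [trace_mul_mul_of_isMinkSym hA hPs hB, Matrix.mul_assoc, Matrix.trace_mul_comm]
  have h4 : (P * A * P * B).trace = 0 := by
    rw [Matrix.mul_assoc, Matrix.mul_assoc, Matrix.trace_mul_comm, Matrix.mul_assoc, hPBP,
      Matrix.mul_zero, Matrix.trace_zero]
  rw [h1, h2, h3, Matrix.mul_sub, Matrix.sub_mul, Matrix.trace_sub, h4, Matrix.mul_one]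
  ring

end IsNullFrame

end MinkAlgebra

/-! ### Second order jets of surfaces in the sphere and their mean curvature spheres. -/

section SphereJets

variable {n : ℕ}

/-- The embedding of `ℝ^{n+3}` into Minkowski space as the spacelike hyperplane `x₀ = 0`. -/
def spaceEmb : Euc n →ₗ[ℝ] Mink n where
  toFun x := Sum.elim (Fin.cons 0 fun i => x (Sum.inl i)) fun j => x (Sum.inr j)
  map_add' x y := by
    funext i
    rcases i with i | j
    · refine Fin.cases ?_ (fun i => ?_) i <;> simp
    · simp
  map_smul' c x := by
    funext i
    rcases i with i | j
    · refine Fin.cases ?_ (fun i => ?_) i <;> simp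
    · simp

/-- The unit vector of the time axis. -/
def timeVec : Mink n := Pi.single (Sum.inl 0) 1

lemma coneLift_eq (x : Euc n) : coneLift x = timeVec + spaceEmb x := by
  funext i
  rcases i with i | j
  · refine Fin.cases ?_ (fun i => ?_) i <;> simp [coneLift, timeVec, spaceEmb]
  · simp [coneLift, timeVec, spaceEmb]

lemma minkInner_spaceEmb (x y : Euc n) : minkInner (spaceEmb x) (spaceEmb y) = inner ℝ x y := by
  simp only [minkInner, lorentzForm, Matrix.mulVec_diagonal, dotProduct, Fintype.sum_sum_type,
    Fin.sum_univ_succ, spaceEmb, PiLp.inner_apply]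
  simp [mul_comm]
  rfl

lemma minkInner_timeVec_spaceEmb (x : Euc n) : minkInner timeVec (spaceEmb x) = 0 := by
  simp [minkInner, timeVec, lorentzForm, Matrix.mulVec_diagonal, spaceEmb]

lemma minkInner_spaceEmb_timeVec (x : Euc n) : minkInner (spaceEmb x) timeVec = 0 := by
  rw [minkInner_comm, minkInner_timeVec_spaceEmb]

lemma minkInner_timeVec_self : minkInner (timeVec : Mink n) timeVec = -1 := by
  simp [minkInner, timeVec, lorentzForm]

/-- Every vector of Minkowski space is the sum of its time and space components. -/
lemma exists_eq_time_add_space (x : Mink n) : ∃ (c : ℝ) (ξ : Euc n),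
    x = c • timeVec + spaceEmb ξ := by
  refine ⟨x (Sum.inl 0), WithLp.toLp 2 (Sum.elim (fun i => x (Sum.inl i.succ))
    fun j => x (Sum.inr j)), ?_⟩
  funext i
  rcases i with i | j
  · refine Fin.cases ?_ (fun i => ?_) i <;> simp [timeVec, spaceEmb]
  · simp [timeVec, spaceEmb]

/-- `EG - F²` for the vectors `p`, `q`. -/
def eucGram (p q : Euc n) : ℝ := inner ℝ p p * inner ℝ q q - inner ℝ p q ^ 2

/-- The component of `ξ` orthogonal to `y`, `p`, `q`, where `y` is a unit vector orthogonal to the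
plane spanned by `p` and `q`. -/
def perpPart (y p q ξ : Euc n) : Euc n :=
  ξ - (inner ℝ y ξ : ℝ) • y - (eucGram p q)⁻¹ •
    ((inner ℝ q q * inner ℝ p ξ - inner ℝ p q * inner ℝ q ξ : ℝ) • p
      + (inner ℝ p p * inner ℝ q ξ - inner ℝ p q * inner ℝ p ξ : ℝ) • q)

/-- The mean curvature vector computed from the second order jet of a surface in the sphere. -/
def jetMean (y p q r s t : Euc n) : Euc n :=
  (2 * eucGram p q)⁻¹ • (inner ℝ q q • perpPart y p q r
    - (2 * inner ℝ p q) • perpPart y p q s + inner ℝ p p • perpPart y p q t)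

/-- The null vector which together with `(1, y)`, `p`, `q` spans the mean curvature sphere. -/
def jetN (y p q r s t : Euc n) : Mink n :=
  -timeVec + (1 / 2 : ℝ) • coneLift y - spaceEmb (jetMean y p q r s t) -
    (1 / 2 * inner ℝ (jetMean y p q r s t) (jetMean y p q r s t) : ℝ) • coneLift y

/-- The projection to the orthogonal complement of the mean curvature sphere. -/
def jetProj (y p q r s t : Euc n) : Matrix (MinkIdx n) (MinkIdx n) ℝ :=
  coProj (coneLift y) (jetN y p q r s t) (spaceEmb p) (spaceEmb q)

/-- The trace-free second fundamental form, where `g` is the coefficient of the metric that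
corresponds to the second derivative `ξ`. -/
def jetFree (y p q r s t ξ : Euc n) : Euc n :=
  perpPart y p q ξ + (inner ℝ y ξ : ℝ) • jetMean y p q r s t

/-- `y` is the value, `p`, `q` are the first and `r`, `s`, `t` the second derivatives of an
immersion of a surface into the unit sphere. -/
structure IsSphereJet (y p q r s t : Euc n) : Prop where
  yy : inner ℝ y y = 1
  yp : inner ℝ y p = 0
  yq : inner ℝ y q = 0
  yr : inner ℝ y r = -inner ℝ p p
  ys : inner ℝ y s = -inner ℝ p q
  yt : inner ℝ y t = -inner ℝ q q
  det : 0 < eucGram p q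

namespace IsSphereJet

variable {y p q r s t : Euc n} (h : IsSphereJet y p q r s t)
include h

lemma inner_y_perpPart (ξ : Euc n) : inner ℝ y (perpPart y p q ξ) = 0 := by
  simp only [perpPart, inner_sub_right, inner_add_right, inner_smul_right, h.yy, h.yp, h.yq]
  ring

lemma inner_p_perpPart (ξ : Euc n) : inner ℝ p (perpPart y p q ξ) = 0 := by
  have hd := h.det.ne'
  simp only [perpPart, inner_sub_right, inner_add_right, inner_smul_right,
    real_inner_comm y p, h.yp]
  rw [eucGram] at *
  field_simp
  ring

lemma inner_q_perpPart (ξ : Euc n) : inner ℝ q (perpPart y p q ξ) = 0 := by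
  have hd := h.det.ne'
  simp only [perpPart, inner_sub_right, inner_add_right, inner_smul_right,
    real_inner_comm y q, h.yq, real_inner_comm p q]
  rw [eucGram] at *
  field_simp
  ring

lemma inner_y_mean : inner ℝ y (jetMean y p q r s t) = 0 := by
  simp only [jetMean, inner_sub_right, inner_add_right, inner_smul_right, h.inner_y_perpPart]
  ring

lemma inner_p_mean : inner ℝ p (jetMean y p q r s t) = 0 := by
  simp only [jetMean, inner_sub_right, inner_add_right, inner_smul_right, h.inner_p_perpPart]
  ring

lemma inner_q_mean : inner ℝ q (jetMean y p q r s t) = 0 := by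
  simp only [jetMean, inner_sub_right, inner_add_right, inner_smul_right, h.inner_q_perpPart]
  ring

/-- $H$ is orthogonal to $y$, $p$, $q$. The coefficients $\frac12$ and $-\frac12|H|^2$ of $(1,y)$ in
`jetN` are those that make it null. The sign is normalized to $\langle Y,N\rangle=+1$, which does
not affect the span. -/
lemma isNullFrame :
    IsNullFrame (coneLift y) (jetN y p q r s t) (spaceEmb p) (spaceEmb q) := by
  have h1 := h.inner_y_mean
  have h1' := real_inner_comm y (jetMean y p q r s t) ▸ h1
  have h2' := real_inner_comm p (jetMean y p q r s t) ▸ h.inner_p_mean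
  have h3' := real_inner_comm q (jetMean y p q r s t) ▸ h.inner_q_mean
  have h4 := h.det.ne'
  constructor
  all_goals first
    | simp only [gramDet, minkInner_spaceEmb]; exact h4
    | simp only [jetN, coneLift_eq, minkInner_add_left, minkInner_add_right, minkInner_sub_left,
        minkInner_sub_right, minkInner_smul_left, minkInner_smul_right, minkInner_neg_left,
        minkInner_neg_right, minkInner_spaceEmb, minkInner_timeVec_spaceEmb,
        minkInner_spaceEmb_timeVec, minkInner_timeVec_self, h1, h1', h2', h3', h.yy, h.yp,
        h.yq]
      ring

/-- Subtracting the multiple $\langle y,\xi\rangle$ of $N$ adds $\langle y,\xi\rangle H$ to the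
normal part of $\xi$. For a second derivative $\langle y,\xi\rangle$ is minus a metric coefficient,
so $P$ applied to second derivatives is the trace-free second fundamental form up to a multiple of
$Y$. -/
lemma jetProj_spaceEmb (ξ : Euc n) : jetProj y p q r s t *ᵥ spaceEmb ξ =
    spaceEmb (jetFree y p q r s t ξ) +
      (inner ℝ (jetMean y p q r s t) (jetFree y p q r s t ξ) : ℝ) • coneLift y := by
  have e1 : inner ℝ (jetMean y p q r s t) (jetFree y p q r s t ξ) =
      inner ℝ (jetMean y p q r s t) ξ +
      inner ℝ y ξ * inner ℝ (jetMean y p q r s t) (jetMean y p q r s t) := by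
    have h1 := real_inner_comm y (jetMean y p q r s t) ▸ h.inner_y_mean
    have h2 := real_inner_comm p (jetMean y p q r s t) ▸ h.inner_p_mean
    have h3 := real_inner_comm q (jetMean y p q r s t) ▸ h.inner_q_mean
    simp only [jetFree, perpPart, inner_add_right, inner_sub_right, inner_smul_right, h1, h2, h3]
    ring
  have e2 : minkInner (jetN y p q r s t) (spaceEmb ξ) = 1 / 2 * inner ℝ y ξ
      - inner ℝ (jetMean y p q r s t) ξ
      - 1 / 2 * inner ℝ (jetMean y p q r s t) (jetMean y p q r s t) * inner ℝ y ξ := by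
    simp only [jetN, coneLift_eq, minkInner_add_left, minkInner_sub_left,
        minkInner_smul_left, minkInner_neg_left, minkInner_spaceEmb, minkInner_timeVec_spaceEmb]
    ring
  have e3 : minkInner (coneLift y) (spaceEmb ξ) = inner ℝ y ξ := by
    simp only [coneLift_eq, minkInner_add_left, minkInner_spaceEmb, minkInner_timeVec_spaceEmb]
    ring
  have e4 : gramDet (spaceEmb p) (spaceEmb q) = eucGram p q := by
    simp only [gramDet, eucGram, minkInner_spaceEmb]
  rw [e1, jetProj, coProj_mulVec, frameProj_mulVec, e2, e3, e4]
  simp only [minkInner_spaceEmb, jetFree, perpPart, map_add, map_sub, map_smul, jetN, coneLift_eq]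
  module

/-- The multiple of $Y$ in `jetProj_spaceEmb` is invisible: $Y$ is null and orthogonal to the
vectors $k$. -/
lemma minkInner_jetProj (ξ ζ : Euc n) :
    minkInner (jetProj y p q r s t *ᵥ spaceEmb ξ) (jetProj y p q r s t *ᵥ spaceEmb ζ) =
      inner ℝ (jetFree y p q r s t ξ) (jetFree y p q r s t ζ) := by
  have h1 : ∀ ξ, inner ℝ y (jetFree y p q r s t ξ) = 0 := fun ξ => by
    simp only [jetFree, inner_add_right, inner_smul_right, h.inner_y_perpPart, h.inner_y_mean]
    ring
  have h2 : ∀ ξ, inner ℝ (jetFree y p q r s t ξ) y = 0 := fun ξ => by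
    rw [real_inner_comm, h1]
  simp only [h.jetProj_spaceEmb, coneLift_eq, minkInner_add_left, minkInner_add_right,
    minkInner_smul_left, minkInner_smul_right, minkInner_spaceEmb, minkInner_timeVec_spaceEmb,
    minkInner_spaceEmb_timeVec, minkInner_timeVec_self, h1, h2, h.yy]
  ring

/-- The trace-free second fundamental form has vanishing trace. -/
lemma jetFree_trace : (inner ℝ q q : ℝ) • jetFree y p q r s t r
    - (2 * inner ℝ p q : ℝ) • jetFree y p q r s t s
    + (inner ℝ p p : ℝ) • jetFree y p q r s t t = 0 := by
  have hd := h.det.ne'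
  simp only [jetFree, h.yr, h.ys, h.yt]
  have : (inner ℝ q q : ℝ) • perpPart y p q r - (2 * inner ℝ p q : ℝ) • perpPart y p q s
      + (inner ℝ p p : ℝ) • perpPart y p q t = (2 * eucGram p q) • jetMean y p q r s t := by
    rw [jetMean, smul_smul, mul_inv_cancel₀ (by positivity), one_smul]
  calc _ = ((inner ℝ q q : ℝ) • perpPart y p q r - (2 * inner ℝ p q : ℝ) • perpPart y p q s
      + (inner ℝ p p : ℝ) • perpPart y p q t) - (2 * eucGram p q) • jetMean y p q r s t := by
        rw [eucGram]; module
    _ = 0 := by rw [this, sub_self]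

end IsSphereJet

/-- `|k₁₂|² - ⟨k₁₁, k₂₂⟩` for the trace-free second fundamental form `k`. -/
def jetEnergy (y p q r s t : Euc n) : ℝ :=
  inner ℝ (jetFree y p q r s t s) (jetFree y p q r s t s)
    - inner ℝ (jetFree y p q r s t r) (jetFree y p q r s t t)

/-- The integrand of the Willmore functional, computed from the second order jet. -/
def jetWillmore (y p q r s t : Euc n) : ℝ :=
  (‖jetMean y p q r s t‖ ^ 2 - (1 + (inner ℝ (perpPart y p q r) (perpPart y p q t)
    - inner ℝ (perpPart y p q s) (perpPart y p q s)) / eucGram p q) + 1)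
    * Real.sqrt (eucGram p q)

namespace IsSphereJet

variable {y p q r s t : Euc n} (h : IsSphereJet y p q r s t)
include h

lemma inner_jetFree_trace (v : Euc n) :
    inner ℝ q q * inner ℝ (jetFree y p q r s t r) v
    - 2 * inner ℝ p q * inner ℝ (jetFree y p q r s t s) v
    + inner ℝ p p * inner ℝ (jetFree y p q r s t t) v = 0 := by
  have := congrArg (fun w => inner ℝ w v) h.jetFree_trace
  simpa only [inner_add_left, inner_sub_left, inner_smul_left, inner_zero_left,
    RCLike.conj_to_real] using this

/-- Substitute $II = k + gH$ in the Gauss equation. The terms linear in $H$ form the trace of $k$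
paired with $H$ and vanish, and $(EG-F^2)|H|^2$ cancels against the squared mean curvature. What
remains is $|H|^2-K+1 = (|k_{12}|^2-\langle k_{11},k_{22}\rangle)/(EG-F^2)$. -/
lemma jetWillmore_eq : jetWillmore y p q r s t =
    jetEnergy y p q r s t / Real.sqrt (eucGram p q) := by
  have hd := h.det
  have hs := Real.sqrt_pos.2 hd
  have hs2 := Real.sq_sqrt hd.le
  have e1 := h.inner_jetFree_trace (jetMean y p q r s t)
  have p1 : perpPart y p q r = jetFree y p q r s t r + (inner ℝ p p : ℝ) • jetMean y p q r s t := by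
    rw [jetFree, h.yr]; module
  have p2 : perpPart y p q s = jetFree y p q r s t s + (inner ℝ p q : ℝ) • jetMean y p q r s t := by
    rw [jetFree, h.ys]; module
  have p3 : perpPart y p q t = jetFree y p q r s t t + (inner ℝ q q : ℝ) • jetMean y p q r s t := by
    rw [jetFree, h.yt]; module
  have key : inner ℝ (perpPart y p q r) (perpPart y p q t)
      - inner ℝ (perpPart y p q s) (perpPart y p q s) =
      -jetEnergy y p q r s t + eucGram p q * ‖jetMean y p q r s t‖ ^ 2 := by
    rw [p1, p2, p3, jetEnergy, ← real_inner_self_eq_norm_sq, eucGram]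
    simp only [inner_add_left, inner_add_right, inner_smul_left, inner_smul_right,
      RCLike.conj_to_real, real_inner_comm _ (jetMean y p q r s t)] at e1 ⊢
    linear_combination e1
  rw [jetWillmore, key, eq_div_iff hs.ne']
  field_simp
  rw [hs2]
  field_simp
  ring

lemma inner_p_pos : 0 < inner ℝ p p := by
  have hd := h.det
  rcases (real_inner_self_nonneg (x := p)).lt_or_eq with h1 | h1
  · exact h1
  · rw [eucGram, ← h1] at hd
    nlinarith [sq_nonneg (inner ℝ p q)]

/-- After multiplication by $E^2$, the trace relation eliminates $k_{22}$ and the expression becomes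
$|E k_{12}-F k_{11}|^2 + (EG-F^2)|k_{11}|^2$. -/
lemma jetEnergy_nonneg : 0 ≤ jetEnergy y p q r s t := by
  have hE := h.inner_p_pos
  have e1 := h.inner_jetFree_trace (jetFree y p q r s t r)
  have h1 : inner ℝ p p * (inner ℝ p p * jetEnergy y p q r s t) =
      ‖(inner ℝ p p : ℝ) • jetFree y p q r s t s - (inner ℝ p q : ℝ) • jetFree y p q r s t r‖ ^ 2
      + eucGram p q * ‖jetFree y p q r s t r‖ ^ 2 := by
    rw [← real_inner_self_eq_norm_sq, ← real_inner_self_eq_norm_sq, eucGram, jetEnergy]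
    simp only [inner_sub_left, inner_sub_right, inner_smul_left, inner_smul_right,
      RCLike.conj_to_real]
    rw [real_inner_comm (jetFree y p q r s t r) (jetFree y p q r s t t)] at e1
    rw [real_inner_comm (jetFree y p q r s t r) (jetFree y p q r s t s)] at *
    linear_combination (-inner ℝ p p) * e1
  have h2 : 0 ≤ inner ℝ p p * (inner ℝ p p * jetEnergy y p q r s t) := by
    rw [h1]; have := h.det; positivity
  by_contra hneg
  push Not at hneg
  have := mul_neg_of_pos_of_neg hE (mul_neg_of_pos_of_neg hE hneg)
  linarith

lemma jetWillmore_nonneg : 0 ≤ jetWillmore y p q r s t := by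
  rw [h.jetWillmore_eq]
  exact div_nonneg h.jetEnergy_nonneg (Real.sqrt_nonneg _)

/-- This is $\sqrt{EG-F^2}\le\frac12(E+G)$, the inequality between area and energy. The right-hand
side is the Dirichlet density of the Gauss map by `dirichlet_eq`. -/
lemma jetWillmore_le : jetWillmore y p q r s t ≤
    (inner ℝ p p + inner ℝ q q) / (2 * eucGram p q) * jetEnergy y p q r s t := by
  have hd := h.det
  have hs := Real.sqrt_pos.2 hd
  have hs2 := Real.sq_sqrt hd.le
  have hq : 0 ≤ inner ℝ q q := real_inner_self_nonneg
  have h1 : Real.sqrt (eucGram p q) ≤ (inner ℝ p p + inner ℝ q q) / 2 := by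
    refine Real.sqrt_le_iff.2 ⟨by have := h.inner_p_pos; positivity, ?_⟩
    rw [eucGram]
    nlinarith [sq_nonneg (inner ℝ p p - inner ℝ q q), sq_nonneg (inner ℝ p q)]
  rw [h.jetWillmore_eq, div_eq_inv_mul]
  refine mul_le_mul_of_nonneg_right ?_ h.jetEnergy_nonneg
  rw [inv_le_iff_one_le_mul₀ hs, div_mul_eq_mul_div, le_div_iff₀ (by positivity)]
  nlinarith

/-- The equality case $E=G$, $F=0$ of the inequality between area and energy. -/
lemma jetWillmore_eq_of_conformal (h1 : inner ℝ p p = inner ℝ q q) (h2 : inner ℝ p q = 0) :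
    jetWillmore y p q r s t =
    (inner ℝ p p + inner ℝ q q) / (2 * eucGram p q) * jetEnergy y p q r s t := by
  have hE := h.inner_p_pos
  have h3 : eucGram p q = inner ℝ p p ^ 2 := by rw [eucGram, h2, ← h1]; ring
  rw [h.jetWillmore_eq, h3, Real.sqrt_sq hE.le, ← h1]
  field_simp
  ring

/-- The Dirichlet density of the conformal Gauss map in terms of the trace-free second fundamental
form. -/
lemma dirichlet_eq : (2 * eucGram p q)⁻¹ * (
    inner ℝ q q * inner ℝ (jetFree y p q r s t r) (jetFree y p q r s t r)
    - 2 * inner ℝ p q * inner ℝ (jetFree y p q r s t r) (jetFree y p q r s t s)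
    + inner ℝ p p * inner ℝ (jetFree y p q r s t s) (jetFree y p q r s t s)
    + inner ℝ q q * inner ℝ (jetFree y p q r s t s) (jetFree y p q r s t s)
    - 2 * inner ℝ p q * inner ℝ (jetFree y p q r s t s) (jetFree y p q r s t t)
    + inner ℝ p p * inner ℝ (jetFree y p q r s t t) (jetFree y p q r s t t)) =
    (inner ℝ p p + inner ℝ q q) / (2 * eucGram p q) * jetEnergy y p q r s t := by
  have hd := h.det.ne'
  have e1 := h.inner_jetFree_trace (jetFree y p q r s t r)
  have e2 := h.inner_jetFree_trace (jetFree y p q r s t t)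
  rw [real_inner_comm (jetFree y p q r s t r) (jetFree y p q r s t s),
    real_inner_comm (jetFree y p q r s t r) (jetFree y p q r s t t)] at e1
  rw [jetEnergy, div_eq_inv_mul, mul_assoc (2 * eucGram p q)⁻¹]
  refine congrArg _ ?_
  -- The trace relations paired with $k_{11}$ and with $k_{22}$ replace all terms in $|k_{11}|^2$,
  -- $|k_{22}|^2$ and $F$ by $-(E+G)\langle k_{11},k_{22}\rangle$.
  linear_combination e1 + e2

end IsSphereJet

end SphereJets

open scoped Matrix.Norms.Elementwise Topology

/-! ### Calculus of directional derivatives. -/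

section DirectionalDerivatives

variable {X : Type*} [NormedAddCommGroup X] [NormedSpace ℝ X]
  {E : Type*} [NormedAddCommGroup E] [NormedSpace ℝ E]
  {F : Type*} [NormedAddCommGroup F] [NormedSpace ℝ F]
  {G : Type*} [NormedAddCommGroup G] [NormedSpace ℝ G]

/-- The directional derivative `∂f/∂d`. -/
def dirD (d : X) (f : X → E) (x : X) : E := fderiv ℝ f x d

lemma dU_eq_dirD (f : ℂ → E) : dU f = dirD 1 f := rfl

lemma dV_eq_dirD (f : ℂ → E) : dV f = dirD Complex.I f := rfl

lemma dirD_congr {f f' : X → E} {x : X} (h : f =ᶠ[𝓝 x] f') (d : X) :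
    dirD d f x = dirD d f' x := by rw [dirD, dirD, h.fderiv_eq]

lemma dirD_eventuallyEq {f f' : X → E} {x : X} (h : f =ᶠ[𝓝 x] f') (d : X) :
    dirD d f =ᶠ[𝓝 x] dirD d f' :=
  h.fderiv.mono fun y hy => by rw [dirD, dirD, hy]

lemma dirD_congr_of_isOpen {f f' : X → E} {s : Set X} (hs : IsOpen s) (h : Set.EqOn f f' s)
    (d : X) : Set.EqOn (dirD d f) (dirD d f') s :=
  fun _ hx => dirD_congr (h.eventuallyEq_of_mem (hs.mem_nhds hx)) d

lemma dirD_const (c : E) (d x : X) : dirD d (fun _ => c) x = 0 := by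
  simp [dirD]

lemma dirD_add {f g : X → E} {x : X} (hf : DifferentiableAt ℝ f x) (hg : DifferentiableAt ℝ g x)
    (d : X) : dirD d (fun y => f y + g y) x = dirD d f x + dirD d g x := by
  simp [dirD, fderiv_fun_add hf hg]

lemma dirD_sub {f g : X → E} {x : X} (hf : DifferentiableAt ℝ f x) (hg : DifferentiableAt ℝ g x)
    (d : X) : dirD d (fun y => f y - g y) x = dirD d f x - dirD d g x := by
  simp [dirD, fderiv_fun_sub hf hg]

lemma dirD_smul {c : X → ℝ} {f : X → E} {x : X} (hc : DifferentiableAt ℝ c x)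
    (hf : DifferentiableAt ℝ f x) (d : X) :
    dirD d (fun y => c y • f y) x = dirD d c x • f x + c x • dirD d f x := by
  simp [dirD, fderiv_fun_smul hc hf, add_comm]

lemma dirD_inner {n : ℕ} {f g : X → Euc n} {x : X} (hf : DifferentiableAt ℝ f x)
    (hg : DifferentiableAt ℝ g x) (d : X) :
    dirD d (fun y => (inner ℝ (f y) (g y) : ℝ)) x =
      inner ℝ (dirD d f x) (g x) + inner ℝ (f x) (dirD d g x) := by
  rw [dirD, fderiv_inner_apply ℝ hf hg, add_comm]; rfl

section Bilinear

variable [FiniteDimensional ℝ E] [FiniteDimensional ℝ F]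

lemma contDiffOn_linear (B : E →ₗ[ℝ] G) {f : X → E} {s : Set X} {k : ℕ∞ω}
    (hf : ContDiffOn ℝ k f s) : ContDiffOn ℝ k (fun y => B (f y)) s :=
  B.toContinuousLinearMap.contDiff.comp_contDiffOn hf

lemma dirD_linear (B : E →ₗ[ℝ] G) {f : X → E} {x : X} (hf : DifferentiableAt ℝ f x) (d : X) :
    dirD d (fun y => B (f y)) x = B (dirD d f x) := by
  have := (B.toContinuousLinearMap.hasFDerivAt.comp x hf.hasFDerivAt).fderiv
  exact congrArg (fun L => L d) this

lemma contDiffOn_bilinear (B : E →ₗ[ℝ] F →ₗ[ℝ] G) {f : X → E} {g : X → F} {s : Set X}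
    {k : ℕ∞ω} (hf : ContDiffOn ℝ k f s) (hg : ContDiffOn ℝ k g s) :
    ContDiffOn ℝ k (fun y => B (f y) (g y)) s :=
  (B.toContinuousBilinearMap.isBoundedBilinearMap.contDiff).comp_contDiffOn (hf.prodMk hg)

lemma dirD_bilinear (B : E →ₗ[ℝ] F →ₗ[ℝ] G) {f : X → E} {g : X → F} {x : X}
    (hf : DifferentiableAt ℝ f x) (hg : DifferentiableAt ℝ g x) (d : X) :
    dirD d (fun y => B (f y) (g y)) x = B (dirD d f x) (g x) + B (f x) (dirD d g x) := by
  have := (B.toContinuousBilinearMap.hasFDerivAt_of_bilinear hf.hasFDerivAt hg.hasFDerivAt).fderiv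
  rw [add_comm]
  exact congrArg (fun L => L d) this

end Bilinear

lemma ContDiffOn.dirD {f : X → E} {s : Set X} (hf : ContDiffOn ℝ ∞ f s) (hs : IsOpen s) (d : X) :
    ContDiffOn ℝ ∞ (_root_.dirD d f) s :=
  (hf.fderiv_of_isOpen hs (m := ∞) (by simp)).clm_apply contDiffOn_const

lemma ContDiffOn.differentiableAt_of_isOpen {f : X → E} {s : Set X} (hf : ContDiffOn ℝ ∞ f s)
    (hs : IsOpen s) {x : X} (hx : x ∈ s) : DifferentiableAt ℝ f x :=
  (hf.contDiffAt (hs.mem_nhds hx)).differentiableAt (by simp)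

lemma dirD_comm {f : X → E} {s : Set X} (hf : ContDiffOn ℝ ∞ f s) (hs : IsOpen s) {x : X}
    (hx : x ∈ s) (c d : X) : dirD c (dirD d f) x = dirD d (dirD c f) x := by
  have h1 : ContDiffAt ℝ ∞ f x := hf.contDiffAt (hs.mem_nhds hx)
  have h2 : DifferentiableAt ℝ (fderiv ℝ f) x :=
    (hf.fderiv_of_isOpen hs (m := ∞) (by simp)).differentiableAt_of_isOpen hs hx
  have h3 : ∀ c d, dirD c (dirD d f) x = fderiv ℝ (fderiv ℝ f) x c d := fun c d => by
    unfold dirD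
    rw [fderiv_clm_apply h2 (differentiableAt_const _)]
    simp
  rw [h3, h3]
  exact (h1.isSymmSndFDerivAt (by simpa using ENat.LEInfty.out)) c d

/-- Derivatives of a map along a slice `t = const`. -/
lemma dirD_slice {f : ℝ × X → E} {t : ℝ} {z : X} (hf : DifferentiableAt ℝ f (t, z)) (d : X) :
    dirD d (fun w => f (t, w)) z = dirD ((0, d) : ℝ × X) f (t, z) := by
  have h1 : HasFDerivAt (fun w : X => (t, w)) (ContinuousLinearMap.inr ℝ ℝ X) z :=
    hasFDerivAt_prodMk_right t z
  have := (HasFDerivAt.comp z (f := fun w : X => (t, w)) hf.hasFDerivAt h1).fderiv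
  exact congrArg (fun L => L d) this

lemma dirD_slice_time {f : ℝ × X → E} {t : ℝ} {z : X} (hf : DifferentiableAt ℝ f (t, z)) :
    HasDerivAt (fun t' => f (t', z)) (dirD ((1, 0) : ℝ × X) f (t, z)) t := by
  have h1 : HasFDerivAt (fun t' : ℝ => (t', z)) (ContinuousLinearMap.inl ℝ ℝ X) t :=
    hasFDerivAt_prodMk_left t z
  have := (HasFDerivAt.comp t (f := fun t' : ℝ => (t', z)) hf.hasFDerivAt h1).hasDerivAt
  simpa [dirD, Function.comp_def] using this

end DirectionalDerivatives

/-! ### Derivatives of matrix valued maps. -/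

section MatrixCalculus

variable {X : Type*} [NormedAddCommGroup X] [NormedSpace ℝ X] {n : ℕ}
  {A B : X → Matrix (MinkIdx n) (MinkIdx n) ℝ} {v w : X → Mink n} {s : Set X} {x : X}

/-- The Lorentzian product as a bilinear map. -/
def minkBilin (n : ℕ) : Mink n →ₗ[ℝ] Mink n →ₗ[ℝ] ℝ :=
  LinearMap.mk₂ ℝ minkInner minkInner_add_left minkInner_smul_left minkInner_add_right
    minkInner_smul_right

/-- The rank one operators as a bilinear map. -/
def minkOuterBilin (n : ℕ) : Mink n →ₗ[ℝ] Mink n →ₗ[ℝ] Matrix (MinkIdx n) (MinkIdx n) ℝ :=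
  LinearMap.mk₂ ℝ minkOuter (by simp [minkOuter, Matrix.add_vecMulVec])
    (by simp [minkOuter, Matrix.smul_vecMulVec])
    (by simp [minkOuter, Matrix.mulVec_add, Matrix.vecMulVec_add])
    (by simp [minkOuter, Matrix.mulVec_smul, Matrix.vecMulVec_smul])

lemma dirD_mulVec (hA : DifferentiableAt ℝ A x) (hv : DifferentiableAt ℝ v x) (d : X) :
    dirD d (fun y => A y *ᵥ v y) x = dirD d A x *ᵥ v x + A x *ᵥ dirD d v x :=
  dirD_bilinear (Matrix.mulVecBilin ℝ ℝ) hA hv d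

lemma dirD_mul (hA : DifferentiableAt ℝ A x) (hB : DifferentiableAt ℝ B x) (d : X) :
    dirD d (fun y => A y * B y) x = dirD d A x * B x + A x * dirD d B x :=
  dirD_bilinear (LinearMap.mul ℝ (Matrix (MinkIdx n) (MinkIdx n) ℝ)) hA hB d

/-- The trace pairing of matrices. -/
def tracePairing (n : ℕ) : Matrix (MinkIdx n) (MinkIdx n) ℝ →ₗ[ℝ]
    Matrix (MinkIdx n) (MinkIdx n) ℝ →ₗ[ℝ] ℝ :=
  (LinearMap.mul ℝ (Matrix (MinkIdx n) (MinkIdx n) ℝ)).compr₂ (Matrix.traceLinearMap _ ℝ ℝ)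

lemma tracePairing_apply (A B : Matrix (MinkIdx n) (MinkIdx n) ℝ) :
    tracePairing n A B = (A * B).trace := rfl

lemma dirD_isMinkSym (hs : IsOpen s) (hA : ∀ y ∈ s, IsMinkSym (A y)) (hd : DifferentiableAt ℝ A x)
    (hx : x ∈ s) (d : X) : IsMinkSym (dirD d A x) := by
  let L1 : Matrix (MinkIdx n) (MinkIdx n) ℝ →ₗ[ℝ] Matrix (MinkIdx n) (MinkIdx n) ℝ :=
    (LinearMap.mulRight ℝ (lorentzForm (Sum.inl 0))) ∘ₗ
      (Matrix.transposeLinearEquiv _ _ ℝ ℝ).toLinearMap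
  let L2 : Matrix (MinkIdx n) (MinkIdx n) ℝ →ₗ[ℝ] Matrix (MinkIdx n) (MinkIdx n) ℝ :=
    LinearMap.mulLeft ℝ (lorentzForm (Sum.inl 0))
  have h1 : dirD d (fun y => L1 (A y)) x = dirD d (fun y => L2 (A y)) x :=
    dirD_congr_of_isOpen hs (fun y hy => hA y hy) d hx
  rw [dirD_linear L1 hd, dirD_linear L2 hd] at h1
  exact h1

end MatrixCalculus

/-! ### The projection field of an immersed surface and its first derivatives. -/

section Immersions

variable {X : Type*} [NormedAddCommGroup X] [NormedSpace ℝ X] {n : ℕ}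

/-- The projection to the orthogonal complement of the mean curvature sphere of the surface `g`,
parametrized in the directions `a`, `b`. -/
def surfProj (g : X → Euc n) (a b x : X) : Matrix (MinkIdx n) (MinkIdx n) ℝ :=
  jetProj (g x) (dirD a g x) (dirD b g x) (dirD a (dirD a g) x) (dirD a (dirD b g) x)
    (dirD b (dirD b g) x)

/-- The null normal of the mean curvature sphere of a surface. -/
def surfN (g : X → Euc n) (a b x : X) : Mink n :=
  jetN (g x) (dirD a g x) (dirD b g x) (dirD a (dirD a g) x) (dirD a (dirD b g) x)
    (dirD b (dirD b g) x)

/-- The coordinate Laplacian in the directions `a`, `b`. -/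
def dirLap {E : Type*} [NormedAddCommGroup E] [NormedSpace ℝ E] (a b : X) (f : X → E) (x : X) :
    E := dirD a (dirD a f) x + dirD b (dirD b f) x

/-- On the open set `s`, the map `g` is a smooth immersion into the unit sphere in the directions
`a`, `b`. -/
structure IsSphereImmersion (g : X → Euc n) (a b : X) (s : Set X) : Prop where
  isOpen : IsOpen s
  smooth : ContDiffOn ℝ ∞ g s
  unit : ∀ x ∈ s, (inner ℝ (g x) (g x) : ℝ) = 1
  det : ∀ x ∈ s, 0 < eucGram (dirD a g x) (dirD b g x)

namespace IsSphereImmersion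

variable {g : X → Euc n} {a b : X} {s : Set X} (h : IsSphereImmersion g a b s) {x : X}
include h

lemma differentiableAt (hx : x ∈ s) : DifferentiableAt ℝ g x :=
  h.smooth.differentiableAt_of_isOpen h.isOpen hx

lemma smooth_dirD (c : X) : ContDiffOn ℝ ∞ (dirD c g) s := h.smooth.dirD h.isOpen c

lemma inner_dirD (hx : x ∈ s) (c : X) : (inner ℝ (g x) (dirD c g x) : ℝ) = 0 := by
  have h1 : dirD c (fun y => (inner ℝ (g y) (g y) : ℝ)) x = dirD c (fun _ => (1 : ℝ)) x :=
    dirD_congr_of_isOpen h.isOpen (fun y hy => h.unit y hy) c hx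
  rw [dirD_inner (h.differentiableAt hx) (h.differentiableAt hx), dirD_const,
    real_inner_comm] at h1
  linarith

lemma inner_dirD_dirD (hx : x ∈ s) (c d : X) :
    (inner ℝ (g x) (dirD c (dirD d g) x) : ℝ) = -inner ℝ (dirD c g x) (dirD d g x) := by
  have h1 : dirD c (fun y => (inner ℝ (g y) (dirD d g y) : ℝ)) x = dirD c (fun _ => (0 : ℝ)) x :=
    dirD_congr_of_isOpen h.isOpen (fun y hy => h.inner_dirD hy d) c hx
  rw [dirD_inner (h.differentiableAt hx)
    ((h.smooth_dirD d).differentiableAt_of_isOpen h.isOpen hx), dirD_const] at h1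
  linarith

lemma isSphereJet (hx : x ∈ s) : IsSphereJet (g x) (dirD a g x) (dirD b g x)
    (dirD a (dirD a g) x) (dirD a (dirD b g) x) (dirD b (dirD b g) x) :=
  ⟨h.unit x hx, h.inner_dirD hx a, h.inner_dirD hx b, h.inner_dirD_dirD hx a a,
    h.inner_dirD_dirD hx a b, h.inner_dirD_dirD hx b b, h.det x hx⟩

lemma isNullFrame (hx : x ∈ s) : IsNullFrame (coneLift (g x)) (surfN g a b x)
    (spaceEmb (dirD a g x)) (spaceEmb (dirD b g x)) := (h.isSphereJet hx).isNullFrame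

omit h in
lemma surfProj_eq : surfProj g a b x = coProj (coneLift (g x)) (surfN g a b x)
    (spaceEmb (dirD a g x)) (spaceEmb (dirD b g x)) := rfl

lemma smooth_inv_eucGram :
    ContDiffOn ℝ ∞ (fun x => (eucGram (dirD a g x) (dirD b g x))⁻¹) s := by
  have ha := h.smooth_dirD a
  have hb := h.smooth_dirD b
  exact (((ha.inner ℝ ha).mul (hb.inner ℝ hb)).sub ((ha.inner ℝ hb).pow 2)).inv
    fun x hx => (h.det x hx).ne'

lemma smooth_perpPart {ξ : X → Euc n} (hξ : ContDiffOn ℝ ∞ ξ s) :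
    ContDiffOn ℝ ∞ (fun x => perpPart (g x) (dirD a g x) (dirD b g x) (ξ x)) s := by
  have h0 := h.smooth
  have ha := h.smooth_dirD a
  have hb := h.smooth_dirD b
  have hg := h.smooth_inv_eucGram
  have haa := ha.inner ℝ ha
  have hab := ha.inner ℝ hb
  have hbb := hb.inner ℝ hb
  have haξ := ha.inner ℝ hξ
  have hbξ := hb.inner ℝ hξ
  have h0ξ := h0.inner ℝ hξ
  unfold perpPart
  fun_prop

lemma smooth_coneLift : ContDiffOn ℝ ∞ (fun x => coneLift (g x)) s := by
  simp only [coneLift_eq]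
  exact contDiffOn_const.add (contDiffOn_linear spaceEmb h.smooth)

lemma smooth_jetMean : ContDiffOn ℝ ∞ (fun x => jetMean (g x) (dirD a g x) (dirD b g x)
    (dirD a (dirD a g) x) (dirD a (dirD b g) x) (dirD b (dirD b g) x)) s := by
  have ha := h.smooth_dirD a
  have hb := h.smooth_dirD b
  have h1 := h.smooth_perpPart (ha.dirD h.isOpen a)
  have h2 := h.smooth_perpPart (hb.dirD h.isOpen a)
  have h3 := h.smooth_perpPart (hb.dirD h.isOpen b)
  have hg := h.smooth_inv_eucGram
  have haa := ha.inner ℝ ha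
  have hab := ha.inner ℝ hb
  have hbb := hb.inner ℝ hb
  unfold jetMean
  simp only [mul_inv]
  fun_prop

lemma smooth_surfN : ContDiffOn ℝ ∞ (surfN g a b) s := by
  have h1 := h.smooth_coneLift
  have h2 := h.smooth_jetMean
  have h3 := contDiffOn_linear spaceEmb h2
  have h4 := h2.inner ℝ h2
  unfold surfN jetN
  fun_prop

lemma smooth_surfProj : ContDiffOn ℝ ∞ (surfProj g a b) s := by
  have hY := h.smooth_coneLift
  have hN := h.smooth_surfN
  have ha := contDiffOn_linear spaceEmb (h.smooth_dirD a)
  have hb := contDiffOn_linear spaceEmb (h.smooth_dirD b)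
  have hd : ∀ x ∈ s, gramDet (spaceEmb (dirD a g x)) (spaceEmb (dirD b g x)) ≠ 0 :=
    fun x hx => (h.isNullFrame hx).det
  have h1 := contDiffOn_bilinear (minkBilin n) ha ha
  have h2 := contDiffOn_bilinear (minkBilin n) ha hb
  have h3 := contDiffOn_bilinear (minkBilin n) hb hb
  have h4 := contDiffOn_bilinear (minkOuterBilin n) ha ha
  have h5 := contDiffOn_bilinear (minkOuterBilin n) ha hb
  have h6 := contDiffOn_bilinear (minkOuterBilin n) hb ha
  have h7 := contDiffOn_bilinear (minkOuterBilin n) hb hb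
  have h8 := contDiffOn_bilinear (minkOuterBilin n) hY hN
  have h9 := contDiffOn_bilinear (minkOuterBilin n) hN hY
  have hg : ContDiffOn ℝ ∞ (fun x => (gramDet (spaceEmb (dirD a g x))
      (spaceEmb (dirD b g x)))⁻¹) s :=
    ((h1.mul h3).sub (h2.pow 2)).inv hd
  exact contDiffOn_const.sub ((h8.add h9).add
    (hg.smul (((h3.smul h4).sub (h2.smul (h5.add h6))).add (h1.smul h7))))

lemma differentiableAt_surfProj (hx : x ∈ s) : DifferentiableAt ℝ (surfProj g a b) x :=
  h.smooth_surfProj.differentiableAt_of_isOpen h.isOpen hx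

lemma differentiableAt_dirD_surfProj (hx : x ∈ s) (c : X) :
    DifferentiableAt ℝ (dirD c (surfProj g a b)) x :=
  (h.smooth_surfProj.dirD h.isOpen c).differentiableAt_of_isOpen h.isOpen hx

lemma differentiableAt_dirD (hx : x ∈ s) (c : X) : DifferentiableAt ℝ (dirD c g) x :=
  (h.smooth_dirD c).differentiableAt_of_isOpen h.isOpen hx

lemma dirD_coneLift (hx : x ∈ s) (c : X) :
    dirD c (fun y => coneLift (g y)) x = spaceEmb (dirD c g x) := by
  simp only [coneLift_eq]
  rw [dirD_add (differentiableAt_const _)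
    ((contDiffOn_linear spaceEmb h.smooth).differentiableAt_of_isOpen h.isOpen hx), dirD_const,
    zero_add, dirD_linear _ (h.differentiableAt hx)]

lemma surfProj_coneLift (hx : x ∈ s) : surfProj g a b x *ᵥ coneLift (g x) = 0 :=
  (h.isNullFrame hx).coProj_Y

lemma surfProj_N (hx : x ∈ s) : surfProj g a b x *ᵥ surfN g a b x = 0 :=
  (h.isNullFrame hx).coProj_N

lemma surfProj_a (hx : x ∈ s) : surfProj g a b x *ᵥ spaceEmb (dirD a g x) = 0 :=
  (h.isNullFrame hx).coProj_a

lemma surfProj_b (hx : x ∈ s) : surfProj g a b x *ᵥ spaceEmb (dirD b g x) = 0 :=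
  (h.isNullFrame hx).coProj_b

lemma surfProj_mul_self (hx : x ∈ s) :
    surfProj g a b x * surfProj g a b x = surfProj g a b x := (h.isNullFrame hx).coProj_mul_self

omit h in
lemma surfProj_sym : IsMinkSym (surfProj g a b x) := coProj_sym _ _ _ _

lemma dirD_surfProj_sym (hx : x ∈ s) (c : X) : IsMinkSym (dirD c (surfProj g a b) x) :=
  dirD_isMinkSym h.isOpen (fun _ _ => surfProj_sym) (h.differentiableAt_surfProj hx) hx c

lemma dirLap_surfProj_sym (hx : x ∈ s) : IsMinkSym (dirLap a b (surfProj g a b) x) :=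
  (dirD_isMinkSym h.isOpen (fun _ hy => h.dirD_surfProj_sym hy a)
    (h.differentiableAt_dirD_surfProj hx a) hx a).add
  (dirD_isMinkSym h.isOpen (fun _ hy => h.dirD_surfProj_sym hy b)
    (h.differentiableAt_dirD_surfProj hx b) hx b)

/-- The derivative of $P^2=P$: it places $P_c$ in the tangent space of the set of projections, as
`IsNullFrame.trace_mul` requires. -/
lemma dirD_surfProj_mul (hx : x ∈ s) (c : X) :
    dirD c (surfProj g a b) x * surfProj g a b x + surfProj g a b x * dirD c (surfProj g a b) x =
      dirD c (surfProj g a b) x := by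
  have hd := h.differentiableAt_surfProj hx
  rw [← dirD_mul hd hd]
  exact dirD_congr_of_isOpen h.isOpen (fun y hy => h.surfProj_mul_self hy) c hx

/-- If the projection annihilates the vector field `v`, then `P_c v = -P v_c`. -/
lemma dirD_surfProj_mulVec {v : X → Mink n} (hv : ∀ y ∈ s, surfProj g a b y *ᵥ v y = 0)
    (hd : DifferentiableAt ℝ v x) (hx : x ∈ s) (c : X) :
    dirD c (surfProj g a b) x *ᵥ v x = -(surfProj g a b x *ᵥ dirD c v x) := by
  have h1 : dirD c (fun y => surfProj g a b y *ᵥ v y) x = dirD c (fun _ => (0 : Mink n)) x :=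
    dirD_congr_of_isOpen h.isOpen hv c hx
  rw [dirD_mulVec (h.differentiableAt_surfProj hx) hd, dirD_const] at h1
  exact eq_neg_of_add_eq_zero_left h1

/-- For $c$ tangential to the surface the right side vanishes, so $P_cY=0$. For a time direction $c$
of a variation it recovers the normal part of the variation field. -/
lemma dirD_surfProj_coneLift (hx : x ∈ s) (c : X) :
    dirD c (surfProj g a b) x *ᵥ coneLift (g x) =
      -(surfProj g a b x *ᵥ spaceEmb (dirD c g x)) := by
  rw [← h.dirD_coneLift hx]
  exact h.dirD_surfProj_mulVec (fun y hy => h.surfProj_coneLift hy)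
    (h.smooth_coneLift.differentiableAt_of_isOpen h.isOpen hx) hx c

lemma dirD_surfProj_spaceEmb (hx : x ∈ s) {ξ : X → Euc n}
    (hξ : ∀ y ∈ s, surfProj g a b y *ᵥ spaceEmb (ξ y) = 0) (hd : DifferentiableAt ℝ ξ x) (c : X) :
    dirD c (surfProj g a b) x *ᵥ spaceEmb (ξ x) =
      -(surfProj g a b x *ᵥ spaceEmb (dirD c ξ x)) := by
  rw [← dirD_linear spaceEmb hd]
  exact h.dirD_surfProj_mulVec hξ
    (spaceEmb.toContinuousLinearMap.differentiableAt.comp x hd) hx c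

lemma dirD_surfProj_a (hx : x ∈ s) (c : X) :
    dirD c (surfProj g a b) x *ᵥ spaceEmb (dirD a g x) =
      -(surfProj g a b x *ᵥ spaceEmb (dirD c (dirD a g) x)) :=
  h.dirD_surfProj_spaceEmb hx (fun _ hy => h.surfProj_a hy) (h.differentiableAt_dirD hx a) c

lemma dirD_surfProj_b (hx : x ∈ s) (c : X) :
    dirD c (surfProj g a b) x *ᵥ spaceEmb (dirD b g x) =
      -(surfProj g a b x *ᵥ spaceEmb (dirD c (dirD b g) x)) :=
  h.dirD_surfProj_spaceEmb hx (fun _ hy => h.surfProj_b hy) (h.differentiableAt_dirD hx b) c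

/-- The assumption on $c$ says that $y_c$ is tangential, so $P_cY=0$ and the mixed terms of $Y$ and
$N$ drop out of `IsNullFrame.trace_mul`. The derivatives of $N$, hence third derivatives of $g$,
never enter. -/
lemma trace_dirD_sq (hx : x ∈ s) {c : X} (hc : surfProj g a b x *ᵥ spaceEmb (dirD c g x) = 0) :
    (dirD c (surfProj g a b) x * dirD c (surfProj g a b) x).trace =
    2 * ((eucGram (dirD a g x) (dirD b g x))⁻¹ *
      (inner ℝ (dirD b g x) (dirD b g x) *
        minkInner (surfProj g a b x *ᵥ spaceEmb (dirD c (dirD a g) x))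
          (surfProj g a b x *ᵥ spaceEmb (dirD c (dirD a g) x))
      - 2 * inner ℝ (dirD a g x) (dirD b g x) *
        minkInner (surfProj g a b x *ᵥ spaceEmb (dirD c (dirD a g) x))
          (surfProj g a b x *ᵥ spaceEmb (dirD c (dirD b g) x))
      + inner ℝ (dirD a g x) (dirD a g x) *
        minkInner (surfProj g a b x *ᵥ spaceEmb (dirD c (dirD b g) x))
          (surfProj g a b x *ᵥ spaceEmb (dirD c (dirD b g) x)))) := by
  have hs := h.dirD_surfProj_sym hx c
  have e := (h.isNullFrame hx).trace_mul hs hs (h.dirD_surfProj_mul hx c)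
  rw [← surfProj_eq, h.dirD_surfProj_coneLift hx, hc, h.dirD_surfProj_a hx,
    h.dirD_surfProj_b hx] at e
  rw [e]
  simp only [gramDet, eucGram, minkInner_spaceEmb, Matrix.mulVec_neg, Matrix.mulVec_zero, neg_zero,
    minkInner_zero_left, minkInner_zero_right, minkInner_neg_left, minkInner_neg_right, neg_neg,
    Matrix.mulVec_mulVec, h.surfProj_mul_self hx]
  rw [minkInner_comm ((surfProj g a b x) *ᵥ spaceEmb (dirD c (dirD b g) x))
    ((surfProj g a b x) *ᵥ spaceEmb (dirD c (dirD a g) x))]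
  ring

/-- The Dirichlet density of the mean curvature sphere congruence. -/
lemma dirichlet_density (hx : x ∈ s) :
    1 / 4 * ((dirD a (surfProj g a b) x * dirD a (surfProj g a b) x).trace +
      (dirD b (surfProj g a b) x * dirD b (surfProj g a b) x).trace) =
    (inner ℝ (dirD a g x) (dirD a g x) + inner ℝ (dirD b g x) (dirD b g x)) /
      (2 * eucGram (dirD a g x) (dirD b g x)) *
      jetEnergy (g x) (dirD a g x) (dirD b g x) (dirD a (dirD a g) x) (dirD a (dirD b g) x)
        (dirD b (dirD b g) x) := by
  have hj := h.isSphereJet hx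
  rw [h.trace_dirD_sq hx (h.surfProj_a hx), h.trace_dirD_sq hx (h.surfProj_b hx),
    dirD_comm h.smooth h.isOpen hx b a, ← hj.dirichlet_eq]
  simp only [surfProj, hj.minkInner_jetProj]
  rw [mul_inv]
  ring

end IsSphereImmersion

end Immersions

/-! ### Conformal immersions: the tension and strong conformality. -/

section Conformal

variable {X : Type*} [NormedAddCommGroup X] [NormedSpace ℝ X] {n : ℕ}

lemma minkOuter_neg_left (u v : Mink n) : minkOuter (-u) v = -minkOuter u v :=
  (minkOuterBilin n).map_neg₂ u v

lemma minkOuter_neg_right (u v : Mink n) : minkOuter u (-v) = -minkOuter u v :=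
  ((minkOuterBilin n) u).map_neg v

/-- A conformal immersion into the unit sphere. -/
structure IsConformalSphereImmersion (g : X → Euc n) (a b : X) (s : Set X) : Prop
    extends IsSphereImmersion g a b s where
  metE_eq : ∀ x ∈ s, (inner ℝ (dirD a g x) (dirD a g x) : ℝ) = inner ℝ (dirD b g x) (dirD b g x)
  metF_eq : ∀ x ∈ s, (inner ℝ (dirD a g x) (dirD b g x) : ℝ) = 0

/-- The only component of the tension field of the conformal Gauss map which may differ from
zero. -/
def surfTension (g : X → Euc n) (a b x : X) : Mink n :=
  surfProj g a b x *ᵥ (dirLap a b (surfProj g a b) x *ᵥ surfN g a b x)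

namespace IsConformalSphereImmersion

variable {g : X → Euc n} {a b : X} {s : Set X} (h : IsConformalSphereImmersion g a b s) {x : X}
include h

lemma metE_pos (hx : x ∈ s) : 0 < (inner ℝ (dirD a g x) (dirD a g x) : ℝ) :=
  (h.isSphereJet hx).inner_p_pos

lemma det_eq (hx : x ∈ s) : eucGram (dirD a g x) (dirD b g x) =
    inner ℝ (dirD a g x) (dirD a g x) * inner ℝ (dirD a g x) (dirD a g x) := by
  rw [eucGram, ← h.metE_eq x hx, h.metF_eq x hx]; ring

/-- With $E=G$ and $F=0$ the vanishing trace of $k$ reads $k_{11}+k_{22}=0$. -/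
lemma surfProj_second (hx : x ∈ s) : surfProj g a b x *ᵥ spaceEmb (dirD b (dirD b g) x) =
    -(surfProj g a b x *ᵥ spaceEmb (dirD a (dirD a g) x)) := by
  have hj := h.isSphereJet hx
  have ht := hj.jetFree_trace
  rw [h.metF_eq x hx, ← h.metE_eq x hx, mul_zero, zero_smul, sub_zero, ← smul_add,
    smul_eq_zero_iff_right (h.metE_pos hx).ne'] at ht
  rw [surfProj, hj.jetProj_spaceEmb, hj.jetProj_spaceEmb, eq_neg_of_add_eq_zero_right ht, map_neg,
    inner_neg_right, neg_smul]
  abel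

lemma surfProj_dirLap (hx : x ∈ s) : surfProj g a b x *ᵥ spaceEmb (dirLap a b g x) = 0 := by
  rw [dirLap, map_add, Matrix.mulVec_add, h.surfProj_second hx, add_neg_cancel]

/-- Differentiating $P_cY=0$ once more gives $P_{cc}Y=-P_cY_c=P\,y_{cc}$, and the sum over both
directions is $P\,\Delta y=0$. -/
lemma dirLap_surfProj_coneLift (hx : x ∈ s) :
    dirLap a b (surfProj g a b) x *ᵥ coneLift (g x) = 0 := by
  have key : ∀ c, (∀ y ∈ s, surfProj g a b y *ᵥ spaceEmb (dirD c g y) = 0) →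
      dirD c (dirD c (surfProj g a b)) x *ᵥ coneLift (g x) =
        surfProj g a b x *ᵥ spaceEmb (dirD c (dirD c g) x) := by
    intro c hc
    have h1 : dirD c (fun y => dirD c (surfProj g a b) y *ᵥ coneLift (g y)) x =
        dirD c (fun _ => (0 : Mink n)) x :=
      dirD_congr_of_isOpen h.isOpen (fun y hy => by
        rw [h.dirD_surfProj_coneLift hy, hc y hy, neg_zero]) c hx
    rw [dirD_mulVec (h.differentiableAt_dirD_surfProj hx c)
      (h.smooth_coneLift.differentiableAt_of_isOpen h.isOpen hx), dirD_const,
      h.dirD_coneLift hx, h.dirD_surfProj_spaceEmb hx hc (h.differentiableAt_dirD hx c)] at h1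
    rw [eq_neg_of_add_eq_zero_left h1, neg_neg]
  rw [dirLap, Matrix.add_mulVec, key a (fun y hy => h.surfProj_a hy),
    key b (fun y hy => h.surfProj_b hy), h.surfProj_second hx, add_neg_cancel]

/-- The second derivative of the projection applied to a tangent vector field. -/
lemma dirD_dirD_surfProj_spaceEmb (hx : x ∈ s) {ξ : X → Euc n} (hξ : ContDiffOn ℝ ∞ ξ s)
    (h0 : ∀ y ∈ s, surfProj g a b y *ᵥ spaceEmb (ξ y) = 0) (c : X) :
    dirD c (dirD c (surfProj g a b)) x *ᵥ spaceEmb (ξ x) =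
      -(dirD c (surfProj g a b) x *ᵥ spaceEmb (dirD c ξ x))
      - dirD c (surfProj g a b) x *ᵥ spaceEmb (dirD c ξ x)
      - surfProj g a b x *ᵥ spaceEmb (dirD c (dirD c ξ) x) := by
  have hd := hξ.differentiableAt_of_isOpen h.isOpen hx
  have hd' := (hξ.dirD h.isOpen c).differentiableAt_of_isOpen h.isOpen hx
  have hs := (contDiffOn_linear spaceEmb hξ).differentiableAt_of_isOpen h.isOpen hx
  have hs' := (contDiffOn_linear spaceEmb (hξ.dirD h.isOpen c)).differentiableAt_of_isOpen
    h.isOpen hx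
  have h1 : dirD c (fun y => dirD c (surfProj g a b) y *ᵥ spaceEmb (ξ y)
      + surfProj g a b y *ᵥ spaceEmb (dirD c ξ y)) x = dirD c (fun _ => (0 : Mink n)) x :=
    dirD_congr_of_isOpen h.isOpen (fun y hy => by
      rw [h.dirD_surfProj_spaceEmb hy h0 (hξ.differentiableAt_of_isOpen h.isOpen hy),
        neg_add_cancel]) c hx
  rw [dirD_add, dirD_mulVec (h.differentiableAt_dirD_surfProj hx c) hs,
    dirD_mulVec (h.differentiableAt_surfProj hx) hs', dirD_const, dirD_linear _ hd,
    dirD_linear _ hd'] at h1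
  · rw [← sub_eq_zero, ← h1]
    abel
  · exact (contDiffOn_bilinear (Matrix.mulVecBilin ℝ ℝ) (h.smooth_surfProj.dirD h.isOpen c)
      (contDiffOn_linear spaceEmb hξ)).differentiableAt_of_isOpen h.isOpen hx
  · exact (contDiffOn_bilinear (Matrix.mulVecBilin ℝ ℝ) h.smooth_surfProj
      (contDiffOn_linear spaceEmb (hξ.dirD h.isOpen c))).differentiableAt_of_isOpen h.isOpen hx

/-- Differentiating $P y_d=0$ twice produces the third order term $-P\,\Delta y_d$. The derivative
of $P\,\Delta y=0$ along $d$ replaces it by $P_d\,\Delta y$, so only second derivatives of the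
surface are left. -/
lemma dirLap_surfProj_spaceEmb (hx : x ∈ s) {d : X}
    (h0 : ∀ y ∈ s, surfProj g a b y *ᵥ spaceEmb (dirD d g y) = 0) :
    dirLap a b (surfProj g a b) x *ᵥ spaceEmb (dirD d g x) =
      dirD d (surfProj g a b) x *ᵥ spaceEmb (dirLap a b g x)
      - (2 : ℝ) • (dirD a (surfProj g a b) x *ᵥ spaceEmb (dirD a (dirD d g) x)
        + dirD b (surfProj g a b) x *ᵥ spaceEmb (dirD b (dirD d g) x)) := by
  have hξ := h.smooth_dirD d
  have hcomm : dirD d (dirLap a b g) x =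
      dirD a (dirD a (dirD d g)) x + dirD b (dirD b (dirD d g)) x := by
    have e : ∀ c, dirD d (dirD c (dirD c g)) x = dirD c (dirD c (dirD d g)) x := fun c => by
      rw [dirD_comm (h.smooth_dirD c) h.isOpen hx]
      exact dirD_congr_of_isOpen h.isOpen (fun y hy => dirD_comm h.smooth h.isOpen hy d c) c hx
    rw [← e, ← e]
    exact dirD_add (((h.smooth_dirD a).dirD h.isOpen a).differentiableAt_of_isOpen h.isOpen hx)
      (((h.smooth_dirD b).dirD h.isOpen b).differentiableAt_of_isOpen h.isOpen hx) d
  have h2 : dirD d (surfProj g a b) x *ᵥ spaceEmb (dirLap a b g x) =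
      -(surfProj g a b x *ᵥ spaceEmb (dirD d (dirLap a b g) x)) :=
    h.dirD_surfProj_spaceEmb hx (fun y hy => h.surfProj_dirLap hy)
      ((((h.smooth_dirD a).dirD h.isOpen a).add
        ((h.smooth_dirD b).dirD h.isOpen b)).differentiableAt_of_isOpen h.isOpen hx) d
  rw [dirLap, Matrix.add_mulVec, h.dirD_dirD_surfProj_spaceEmb hx hξ h0,
    h.dirD_dirD_surfProj_spaceEmb hx hξ h0, h2, hcomm, map_add, Matrix.mulVec_add]
  module

lemma surfProj_dirD_surfProj (hx : x ∈ s) {c : X} :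
    surfProj g a b x * dirD c (surfProj g a b) x * surfProj g a b x = 0 := by
  have h1 := congrArg (surfProj g a b x * ·) (h.dirD_surfProj_mul hx c)
  simp only [Matrix.mul_add, ← Matrix.mul_assoc, h.surfProj_mul_self hx] at h1
  simpa using h1

/-- Split $\zeta$ along $V^\perp\oplus V$. The first part is killed by $PP_cP=0$. In the second the
coefficient of $N$ is $\langle Y,\zeta\rangle=0$, and $P_cY=0$ removes the coefficient of $Y$; only
the tangential components survive. -/
lemma surfProj_dirD_spaceEmb (hx : x ∈ s) {c : X}
    (hc : surfProj g a b x *ᵥ spaceEmb (dirD c g x) = 0) {ζ : Euc n}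
    (hζ : (inner ℝ (g x) ζ : ℝ) = 0) :
    surfProj g a b x *ᵥ (dirD c (surfProj g a b) x *ᵥ spaceEmb ζ) =
      -(inner ℝ (dirD a g x) (dirD a g x) : ℝ)⁻¹ •
      ((inner ℝ (dirD a g x) ζ : ℝ) • surfProj g a b x *ᵥ spaceEmb (dirD c (dirD a g) x)
      + (inner ℝ (dirD b g x) ζ : ℝ) • surfProj g a b x *ᵥ spaceEmb (dirD c (dirD b g) x)) := by
  have hE := (h.metE_pos hx).ne'
  have h1 : spaceEmb ζ = surfProj g a b x *ᵥ spaceEmb ζ + frameProj (coneLift (g x))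
      (surfN g a b x) (spaceEmb (dirD a g x)) (spaceEmb (dirD b g x)) *ᵥ spaceEmb ζ := by
    rw [IsSphereImmersion.surfProj_eq, coProj_mulVec]; abel
  have h2 : minkInner (coneLift (g x)) (spaceEmb ζ) = 0 := by
    rw [coneLift_eq, minkInner_add_left, minkInner_timeVec_spaceEmb, minkInner_spaceEmb, hζ,
      add_zero]
  have h3 : gramDet (spaceEmb (dirD a g x)) (spaceEmb (dirD b g x)) =
      inner ℝ (dirD a g x) (dirD a g x) * inner ℝ (dirD a g x) (dirD a g x) := by
    rw [← h.det_eq hx]; simp only [gramDet, eucGram, minkInner_spaceEmb]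
  have h4 := congrArg (· *ᵥ spaceEmb ζ) (h.surfProj_dirD_surfProj hx (c := c))
  simp only [← Matrix.mulVec_mulVec, Matrix.zero_mulVec] at h4
  rw [h1, Matrix.mulVec_add, Matrix.mulVec_add, h4, zero_add, frameProj_mulVec, h2, h3]
  simp only [minkInner_spaceEmb, h.metF_eq x hx, ← h.metE_eq x hx, zero_smul, zero_mul, sub_zero,
    add_zero, Matrix.mulVec_add, Matrix.mulVec_smul, h.dirD_surfProj_coneLift hx, hc, neg_zero,
    smul_zero, zero_add, h.dirD_surfProj_a hx, h.dirD_surfProj_b hx,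
    Matrix.mulVec_neg, Matrix.mulVec_mulVec, h.surfProj_mul_self hx, smul_add, smul_smul]
  rw [show ∀ u : ℝ, (inner ℝ (dirD a g x) (dirD a g x) * inner ℝ (dirD a g x) (dirD a g x))⁻¹ *
    (inner ℝ (dirD a g x) (dirD a g x) * u) = (inner ℝ (dirD a g x) (dirD a g x))⁻¹ * u from
    fun u => by field_simp]
  rw [show ∀ u : ℝ, (inner ℝ (dirD a g x) (dirD a g x) * inner ℝ (dirD a g x) (dirD a g x))⁻¹ *
    (inner ℝ (dirD a g x) (dirD a g x) * u) = (inner ℝ (dirD a g x) (dirD a g x))⁻¹ * u from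
    fun u => by field_simp]
  module

/-- The derivatives of the conformality relations. -/
lemma christoffel (hx : x ∈ s) (c : X) :
    (inner ℝ (dirD a g x) (dirD c (dirD a g) x) : ℝ) = inner ℝ (dirD b g x) (dirD c (dirD b g) x) ∧
    (inner ℝ (dirD b g x) (dirD c (dirD a g) x) : ℝ) =
      -inner ℝ (dirD a g x) (dirD c (dirD b g) x) := by
  have ha := h.differentiableAt_dirD hx a
  have hb := h.differentiableAt_dirD hx b
  have h1 := dirD_congr_of_isOpen h.isOpen (fun y hy => h.metE_eq y hy) c hx
  have h2 := dirD_congr_of_isOpen h.isOpen (fun y hy => h.metF_eq y hy) c hx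
  rw [dirD_inner ha ha, dirD_inner hb hb, real_inner_comm, real_inner_comm (dirD b g x)] at h1
  rw [dirD_inner ha hb, dirD_const, real_inner_comm] at h2
  constructor <;> linarith

/-- Everything is a combination of $P y_{uu}=-P y_{vv}$ and $P y_{uv}$, with Christoffel symbols as
coefficients. These cancel by the differentiated conformality relations. -/
lemma surfProj_dirLap_surfProj_a (hx : x ∈ s) :
    surfProj g a b x *ᵥ (dirLap a b (surfProj g a b) x *ᵥ spaceEmb (dirD a g x)) = 0 := by
  have e1 : dirLap a b (surfProj g a b) x *ᵥ spaceEmb (dirD a g x) =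
      -- This grouping is chosen because $y_{vv}-y_{uu}$ and $y_{uv}$ are orthogonal to $y$ by
      -- conformality, as `surfProj_dirD_spaceEmb` requires; $\Delta y$ and $y_{uu}$ separately are
      -- not.
      dirD a (surfProj g a b) x *ᵥ spaceEmb (dirD b (dirD b g) x - dirD a (dirD a g) x)
      - (2 : ℝ) • (dirD b (surfProj g a b) x *ᵥ spaceEmb (dirD a (dirD b g) x)) := by
    rw [h.dirLap_surfProj_spaceEmb hx (fun y hy => h.surfProj_a hy), dirLap,
      dirD_comm h.smooth h.isOpen hx b a]
    simp only [map_add, map_sub, Matrix.mulVec_add, Matrix.mulVec_sub]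
    module
  have e2 : (inner ℝ (g x) (dirD b (dirD b g) x - dirD a (dirD a g) x) : ℝ) = 0 := by
    rw [inner_sub_right, h.inner_dirD_dirD hx, h.inner_dirD_dirD hx, h.metE_eq x hx, sub_self]
  have e3 : (inner ℝ (g x) (dirD a (dirD b g) x) : ℝ) = 0 := by
    rw [h.inner_dirD_dirD hx, h.metF_eq x hx, neg_zero]
  have ca := h.christoffel hx a
  have cb := h.christoffel hx b
  rw [dirD_comm h.smooth h.isOpen hx b a] at cb
  rw [e1, Matrix.mulVec_sub, Matrix.mulVec_smul, h.surfProj_dirD_spaceEmb hx (h.surfProj_a hx) e2,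
    h.surfProj_dirD_spaceEmb hx (h.surfProj_b hx) e3, h.surfProj_second hx,
    dirD_comm h.smooth h.isOpen hx b a, inner_sub_right, inner_sub_right, ca.1, ca.2, ← cb.1]
  rw [show (inner ℝ (dirD a g x) (dirD b (dirD b g) x) : ℝ) =
    -inner ℝ (dirD b g x) (dirD a (dirD b g) x) by linarith [cb.2]]
  module

lemma surfProj_dirLap_surfProj_b (hx : x ∈ s) :
    surfProj g a b x *ᵥ (dirLap a b (surfProj g a b) x *ᵥ spaceEmb (dirD b g x)) = 0 := by
  have e1 : dirLap a b (surfProj g a b) x *ᵥ spaceEmb (dirD b g x) =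
      dirD b (surfProj g a b) x *ᵥ spaceEmb (dirD a (dirD a g) x - dirD b (dirD b g) x)
      - (2 : ℝ) • (dirD a (surfProj g a b) x *ᵥ spaceEmb (dirD a (dirD b g) x)) := by
    rw [h.dirLap_surfProj_spaceEmb hx (fun y hy => h.surfProj_b hy), dirLap]
    simp only [map_add, map_sub, Matrix.mulVec_add, Matrix.mulVec_sub]
    module
  have e2 : (inner ℝ (g x) (dirD a (dirD a g) x - dirD b (dirD b g) x) : ℝ) = 0 := by
    rw [inner_sub_right, h.inner_dirD_dirD hx, h.inner_dirD_dirD hx, h.metE_eq x hx, sub_self]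
  have e3 : (inner ℝ (g x) (dirD a (dirD b g) x) : ℝ) = 0 := by
    rw [h.inner_dirD_dirD hx, h.metF_eq x hx, neg_zero]
  have ca := h.christoffel hx a
  have cb := h.christoffel hx b
  rw [dirD_comm h.smooth h.isOpen hx b a] at cb
  rw [e1, Matrix.mulVec_sub, Matrix.mulVec_smul, h.surfProj_dirD_spaceEmb hx (h.surfProj_b hx) e2,
    h.surfProj_dirD_spaceEmb hx (h.surfProj_a hx) e3, h.surfProj_second hx,
    dirD_comm h.smooth h.isOpen hx b a, inner_sub_right, inner_sub_right, ca.1, ca.2, ← cb.1]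
  rw [show (inner ℝ (dirD a g x) (dirD b (dirD b g) x) : ℝ) =
    -inner ℝ (dirD b g x) (dirD a (dirD b g) x) by linarith [cb.2]]
  module

/-- The trace pairing of the Laplacian of the projection with a tangent matrix `B`. -/
lemma trace_dirLap_mul (hx : x ∈ s) {B : Matrix (MinkIdx n) (MinkIdx n) ℝ} (hB : IsMinkSym B)
    (hBP : B * surfProj g a b x + surfProj g a b x * B = B) {ζ : Euc n}
    (hζ : B *ᵥ coneLift (g x) = -(surfProj g a b x *ᵥ spaceEmb ζ)) :
    (dirLap a b (surfProj g a b) x * B).trace =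
      -(2 * minkInner (surfTension g a b x) (spaceEmb ζ)) := by
  have e := (h.isNullFrame hx).trace_mul (h.dirLap_surfProj_sym hx) hB hBP
  -- The columns of $P\,\Delta P$ at $Y$, $y_u$, $y_v$ vanish, so the one surviving product pairs
  -- the column at $N$ with $BY$.
  rw [← IsSphereImmersion.surfProj_eq, h.dirLap_surfProj_coneLift hx,
    h.surfProj_dirLap_surfProj_a hx, h.surfProj_dirLap_surfProj_b hx, hζ] at e
  rw [e, surfTension]
  simp only [Matrix.mulVec_zero, minkInner_zero_left, minkInner_neg_right]
  rw [← IsSphereImmersion.surfProj_sym.minkInner_mulVec, Matrix.mulVec_mulVec,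
    h.surfProj_mul_self hx]
  ring

/-- The tension vanishes if it is orthogonal to all normal variations. -/
lemma surfTension_eq_zero (hx : x ∈ s) (h0 : ∀ c : Euc n,
    minkInner (surfTension g a b x) (spaceEmb (c - (inner ℝ (g x) c : ℝ) • g x)) = 0) :
    surfTension g a b x = 0 := by
  have hY : minkInner (surfTension g a b x) (coneLift (g x)) = 0 := by
    rw [surfTension, IsSphereImmersion.surfProj_sym.minkInner_mulVec, h.surfProj_coneLift hx,
      minkInner_zero_right]
  have hN : minkInner (surfTension g a b x) (surfN g a b x) = 0 := by
    rw [surfTension, IsSphereImmersion.surfProj_sym.minkInner_mulVec, h.surfProj_N hx,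
      minkInner_zero_right]
  -- $T$ lies in $V^\perp$, so it is orthogonal to $Y$ and $N$. Testing with the mean curvature
  -- vector removes the term in $H$ from $\langle T,N\rangle=0$, which leaves orthogonality to the
  -- time axis and then to $y$.
  have hH := h0 (jetMean (g x) (dirD a g x) (dirD b g x) (dirD a (dirD a g) x)
    (dirD a (dirD b g) x) (dirD b (dirD b g) x))
  rw [(h.isSphereJet hx).inner_y_mean, zero_smul, sub_zero] at hH
  have hT : minkInner (surfTension g a b x) timeVec = 0 := by
    simp only [surfN, jetN, minkInner_sub_right, minkInner_add_right, minkInner_neg_right,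
      minkInner_smul_right, hY, hH] at hN
    linarith
  have hy : minkInner (surfTension g a b x) (spaceEmb (g x)) = 0 := by
    rw [coneLift_eq, minkInner_add_right, hT, zero_add] at hY
    exact hY
  refine eq_zero_of_minkInner_left fun v => ?_
  obtain ⟨c, ξ, rfl⟩ := exists_eq_time_add_space v
  have h1 := h0 ξ
  rw [map_sub, map_smul, minkInner_sub_right, minkInner_smul_right, hy, mul_zero, sub_zero] at h1
  rw [minkInner_comm, minkInner_add_right, minkInner_smul_right, hT, h1, mul_zero, add_zero]

/-- If the tension vanishes, then the projection commutes with its Laplacian. -/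
lemma surfProj_comm_dirLap (hx : x ∈ s) (h0 : surfTension g a b x = 0) :
    surfProj g a b x * dirLap a b (surfProj g a b) x =
      dirLap a b (surfProj g a b) x * surfProj g a b x := by
  have hL := h.dirLap_surfProj_sym hx
  have hP : IsMinkSym (surfProj g a b x) := IsSphereImmersion.surfProj_sym
  have hQ : frameProj (coneLift (g x)) (surfN g a b x) (spaceEmb (dirD a g x))
      (spaceEmb (dirD b g x)) = 1 - surfProj g a b x := by
    rw [IsSphereImmersion.surfProj_eq, coProj]; abel
  have h1 : ∀ v, surfProj g a b x *ᵥ (dirLap a b (surfProj g a b) x *ᵥ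
      ((1 - surfProj g a b x) *ᵥ v)) = 0 := fun v => by
    rw [← hQ, frameProj_mulVec]
    rw [surfTension] at h0
    simp only [Matrix.mulVec_add, Matrix.mulVec_smul, h.dirLap_surfProj_coneLift hx, h0,
      h.surfProj_dirLap_surfProj_a hx, h.surfProj_dirLap_surfProj_b hx, Matrix.mulVec_zero,
      smul_zero, add_zero]
  have h2 : surfProj g a b x * dirLap a b (surfProj g a b) x * (1 - surfProj g a b x) = 0 :=
    matrix_ext_mulVec fun v => by
      rw [← Matrix.mulVec_mulVec, ← Matrix.mulVec_mulVec, h1, Matrix.zero_mulVec]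
  -- The other off-diagonal block of $\Delta P$ is the Lorentzian adjoint of the one in `h2`.
  have h3 : (1 - surfProj g a b x) * dirLap a b (surfProj g a b) x * surfProj g a b x = 0 :=
    matrix_ext_mulVec fun v => by
      rw [← Matrix.mulVec_mulVec, ← Matrix.mulVec_mulVec, Matrix.zero_mulVec]
      refine eq_zero_of_minkInner_left fun w => ?_
      rw [← (isMinkSym_one.sub hP).minkInner_mulVec, ← hL.minkInner_mulVec,
        ← hP.minkInner_mulVec, h1, minkInner_zero_left]
  rw [Matrix.mul_sub, Matrix.mul_one, sub_eq_zero] at h2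
  rw [Matrix.sub_mul, Matrix.sub_mul, Matrix.one_mul, sub_eq_zero] at h3
  rw [h2, h3]

/-- Since $PP_cP=0$, the factor $1-P$ can be inserted in the middle and expanded into rank one
operators. As $P_cY=P_dY=0$ for tangential $c$ and $d$, only the operators of $y_u$ and $y_v$
remain, which $P_c$ and $P_d$ map to second derivatives. -/
lemma surfProj_dirD_dirD_surfProj (hx : x ∈ s) {c d : X}
    (hc : surfProj g a b x *ᵥ spaceEmb (dirD c g x) = 0)
    (hd : surfProj g a b x *ᵥ spaceEmb (dirD d g x) = 0) :
    surfProj g a b x * dirD c (surfProj g a b) x * dirD d (surfProj g a b) x * surfProj g a b x =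
    (inner ℝ (dirD a g x) (dirD a g x) : ℝ)⁻¹ •
      (minkOuter (surfProj g a b x *ᵥ spaceEmb (dirD c (dirD a g) x))
        (surfProj g a b x *ᵥ spaceEmb (dirD d (dirD a g) x)) +
      minkOuter (surfProj g a b x *ᵥ spaceEmb (dirD c (dirD b g) x))
        (surfProj g a b x *ᵥ spaceEmb (dirD d (dirD b g) x))) := by
  have hE := (h.metE_pos hx).ne'
  have hQ : frameProj (coneLift (g x)) (surfN g a b x) (spaceEmb (dirD a g x))
      (spaceEmb (dirD b g x)) = 1 - surfProj g a b x := by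
    rw [IsSphereImmersion.surfProj_eq, coProj]; abel
  have h3 : gramDet (spaceEmb (dirD a g x)) (spaceEmb (dirD b g x)) =
      inner ℝ (dirD a g x) (dirD a g x) * inner ℝ (dirD a g x) (dirD a g x) := by
    rw [← h.det_eq hx]; simp only [gramDet, eucGram, minkInner_spaceEmb]
  have hP : IsMinkSym (surfProj g a b x) := IsSphereImmersion.surfProj_sym
  have h1 : surfProj g a b x * dirD c (surfProj g a b) x * dirD d (surfProj g a b) x *
      surfProj g a b x = surfProj g a b x * dirD c (surfProj g a b) x *
      (1 - surfProj g a b x) * dirD d (surfProj g a b) x * surfProj g a b x := by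
    rw [Matrix.mul_sub, h.surfProj_dirD_surfProj hx, Matrix.mul_one, sub_zero]
  have hout : ∀ u v, minkOuter u v * dirD d (surfProj g a b) x * surfProj g a b x =
      minkOuter u (surfProj g a b x *ᵥ (dirD d (surfProj g a b) x *ᵥ v)) := fun u v => by
    rw [minkOuter_mul (h.dirD_surfProj_sym hx d), minkOuter_mul hP]
  have hz : ∀ u : Mink n, minkOuter 0 u = 0 := fun u => (minkOuterBilin n).map_zero₂ u
  have hz' : ∀ u : Mink n, minkOuter u 0 = 0 := fun u => ((minkOuterBilin n) u).map_zero
  have hn : ∀ u v : Mink n, minkOuter (-u) (-v) = minkOuter u v := fun u v => by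
    rw [minkOuter_neg_left, minkOuter_neg_right, neg_neg]
  rw [h1, ← hQ, frameProj, h3]
  simp only [Matrix.mul_add, Matrix.add_mul, Matrix.mul_smul,
    Matrix.smul_mul, mul_minkOuter, hout, ← Matrix.mulVec_mulVec, h.dirD_surfProj_coneLift hx, hc,
    hd, neg_zero, Matrix.mulVec_zero, hz, hz', zero_add, minkInner_spaceEmb, h.metF_eq x hx,
    zero_smul, sub_zero, ← h.metE_eq x hx, h.dirD_surfProj_a hx, h.dirD_surfProj_b hx,
    Matrix.mulVec_neg, hn]
  simp only [Matrix.mulVec_mulVec, h.surfProj_mul_self hx, ← smul_add, smul_smul]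
  congr 1
  field_simp

/-- The conformal Gauss map is strongly conformal. -/
lemma strongly_conformal (hx : x ∈ s) :
    surfProj g a b x * dirD a (surfProj g a b) x * dirD a (surfProj g a b) x * surfProj g a b x =
    surfProj g a b x * dirD b (surfProj g a b) x * dirD b (surfProj g a b) x * surfProj g a b x ∧
    surfProj g a b x * dirD a (surfProj g a b) x * dirD b (surfProj g a b) x * surfProj g a b x =
    -(surfProj g a b x * dirD b (surfProj g a b) x * dirD a (surfProj g a b) x *
      surfProj g a b x) := by
  have ha := h.surfProj_a hx
  have hb := h.surfProj_b hx
  rw [h.surfProj_dirD_dirD_surfProj hx ha ha, h.surfProj_dirD_dirD_surfProj hx hb hb,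
    h.surfProj_dirD_dirD_surfProj hx ha hb, h.surfProj_dirD_dirD_surfProj hx hb ha,
    dirD_comm h.smooth h.isOpen hx b a, h.surfProj_second hx]
  constructor
  · rw [minkOuter_neg_left, minkOuter_neg_right, neg_neg, add_comm]
  · rw [minkOuter_neg_left, minkOuter_neg_right, ← smul_neg]
    congr 1
    abel

end IsConformalSphereImmersion

end Conformal

/-! ### The Willmore density as a function of the second order jet. -/

section WillmoreDensity

variable {n : ℕ}

/-- Replaces the abstract orthogonal projection by the Gram formula, which is algebraic in the jet.
-/
lemma normalPart_eq_perpPart {g : ℂ → Euc n} {z : ℂ} {r s t : Euc n}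
    (h : IsSphereJet (g z) (dU g z) (dV g z) r s t) (ξ : Euc n) :
    normalPart g z ξ = perpPart (g z) (dU g z) (dV g z) ξ := by
  have hm : ∀ v ∈ ({g z, dU g z, dV g z} : Set (Euc n)),
      v ∈ Submodule.span ℝ ({g z, dU g z, dV g z} : Set (Euc n)) :=
    fun v hv => Submodule.subset_span hv
  have hy := hm (g z) (by simp)
  have hp := hm (dU g z) (by simp)
  have hq := hm (dV g z) (by simp)
  have hproj : (Submodule.span ℝ {g z, dU g z, dV g z}).starProjection ξ =
      ξ - perpPart (g z) (dU g z) (dV g z) ξ := by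
    refine Submodule.eq_starProjection_of_mem_orthogonal ?_ ?_
    · rw [perpPart, sub_sub, sub_sub_cancel]
      exact add_mem (Submodule.smul_mem _ _ hy) (Submodule.smul_mem _ _
        (add_mem (Submodule.smul_mem _ _ hp) (Submodule.smul_mem _ _ hq)))
    · rw [sub_sub_cancel, Submodule.mem_orthogonal]
      intro u hu
      induction hu using Submodule.span_induction with
      | mem x hx =>
        rcases hx with rfl | rfl | rfl
        · exact h.inner_y_perpPart ξ
        · exact h.inner_p_perpPart ξ
        · exact h.inner_q_perpPart ξ
      | zero => exact inner_zero_left _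
      | add x y _ _ hx hy => rw [inner_add_left, hx, hy, add_zero]
      | smul c x _ hx => rw [inner_smul_left, hx, mul_zero]
  rw [normalPart, Submodule.starProjection_orthogonal_val, hproj, sub_sub_cancel]

lemma willmoreDensity_eq_jetWillmore {g : ℂ → Euc n} {z : ℂ}
    (h : IsSphereJet (g z) (dU g z) (dV g z) (dU (dU g) z) (dU (dV g) z) (dV (dV g) z)) :
    willmoreDensity g z =
      jetWillmore (g z) (dU g z) (dV g z) (dU (dU g) z) (dU (dV g) z) (dV (dV g) z) := by
  have hd : metDet g z = eucGram (dU g z) (dV g z) := rfl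
  have hm : meanCurvatureVec g z =
      jetMean (g z) (dU g z) (dV g z) (dU (dU g) z) (dU (dV g) z) (dV (dV g) z) := by
    simp only [meanCurvatureVec, secondUU, secondUV, secondVV, normalPart_eq_perpPart h, hd]
    rfl
  rw [willmoreDensity, hm, jetWillmore, gaussCurvature, hd]
  simp only [secondUU, secondUV, secondVV, normalPart_eq_perpPart h]

lemma willmoreDensity_congr {g g' : ℂ → Euc n} {z : ℂ} (h : g =ᶠ[𝓝 z] g') :
    willmoreDensity g z = willmoreDensity g' z := by
  have h0 := h.self_of_nhds
  have hU : dU g z = dU g' z := dirD_congr h _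
  have hV : dV g z = dV g' z := dirD_congr h _
  have hUU : dU (dU g) z = dU (dU g') z := dirD_congr (dirD_eventuallyEq h _) _
  have hUV : dU (dV g) z = dU (dV g') z := dirD_congr (dirD_eventuallyEq h _) _
  have hVV : dV (dV g) z = dV (dV g') z := dirD_congr (dirD_eventuallyEq h _) _
  simp only [willmoreDensity, meanCurvatureVec, gaussCurvature, secondUU, secondUV, secondVV,
    normalPart, metDet, metE, metF, metG, h0, hU, hV, hUU, hUV, hVV]

end WillmoreDensity

/-! ### Time slices of a family of surfaces. -/

section Slices

variable {X : Type*} [NormedAddCommGroup X] [NormedSpace ℝ X]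
  {E : Type*} [NormedAddCommGroup E] [NormedSpace ℝ E] {n : ℕ}

lemma dirD_slice_eventuallyEq {f : ℝ × X → E} {s : Set (ℝ × X)} (hs : IsOpen s)
    (hf : ContDiffOn ℝ ∞ f s) {t : ℝ} {z : X} (hz : (t, z) ∈ s) (d : X) :
    dirD d (fun w => f (t, w)) =ᶠ[𝓝 z] fun w => dirD ((0, d) : ℝ × X) f (t, w) := by
  have hc : ContinuousAt (fun w : X => (t, w)) z := by fun_prop
  filter_upwards [hc.preimage_mem_nhds (hs.mem_nhds hz)] with w hw
  exact dirD_slice (hf.differentiableAt_of_isOpen hs hw) d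

lemma dirD_dirD_slice {f : ℝ × X → E} {s : Set (ℝ × X)} (hs : IsOpen s)
    (hf : ContDiffOn ℝ ∞ f s) {t : ℝ} {z : X} (hz : (t, z) ∈ s) (c d : X) :
    dirD c (dirD d (fun w => f (t, w))) z =
      dirD ((0, c) : ℝ × X) (dirD ((0, d) : ℝ × X) f) (t, z) := by
  rw [dirD_congr (dirD_slice_eventuallyEq hs hf hz d)]
  exact dirD_slice ((hf.dirD hs _).differentiableAt_of_isOpen hs hz) c

lemma surfProj_slice {f : ℝ × X → Euc n} {s : Set (ℝ × X)} (hs : IsOpen s)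
    (hf : ContDiffOn ℝ ∞ f s) {t : ℝ} {z : X} (hz : (t, z) ∈ s) (a b : X) :
    surfProj (fun w => f (t, w)) a b z = surfProj f ((0, a) : ℝ × X) (0, b) (t, z) := by
  have hd := hf.differentiableAt_of_isOpen hs hz
  rw [surfProj, surfProj, dirD_dirD_slice hs hf hz, dirD_dirD_slice hs hf hz,
    dirD_dirD_slice hs hf hz, dirD_slice hd, dirD_slice hd]

lemma surfProj_congr {g g' : X → Euc n} {x : X} (h : g =ᶠ[𝓝 x] g') (a b : X) :
    surfProj g a b x = surfProj g' a b x := by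
  rw [surfProj, surfProj, h.self_of_nhds, dirD_congr h, dirD_congr h,
    dirD_congr (dirD_eventuallyEq h _), dirD_congr (dirD_eventuallyEq h _),
    dirD_congr (dirD_eventuallyEq h _)]

end Slices

/-! ### Differentiation under the integral sign and integrability. -/

section Integrals

open MeasureTheory

/-- Differentiation under the integral over a compact set. -/
lemma hasDerivAt_setIntegral_of_contDiffOn {e : ℝ × ℂ → ℝ} {s : Set (ℝ × ℂ)} (hs : IsOpen s)
    (he : ContDiffOn ℝ ∞ e s) {K : Set ℂ} (hK : IsCompact K) (h0 : ∀ z ∈ K, ((0 : ℝ), z) ∈ s) :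
    HasDerivAt (fun t => ∫ z in K, e (t, z)) (∫ z in K, dirD ((1, 0) : ℝ × ℂ) e (0, z)) 0 ∧
      ∀ᶠ t in 𝓝 (0 : ℝ), (∀ z ∈ K, (t, z) ∈ s) ∧ IntegrableOn (fun z => e (t, z)) K := by
  -- Compactness of $K$ gives a time interval that works for all $z\in K$ at once; the time
  -- derivative is bounded on its product with $K$, and this constant is the dominating function.
  obtain ⟨u, v, hu, -, h0u, hKv, huv⟩ := generalized_tube_lemma (isCompact_singleton (x := (0 : ℝ)))
    hK hs (by rintro ⟨t, z⟩ ⟨ht, hz⟩; obtain rfl : t = 0 := ht; exact h0 z hz)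
  obtain ⟨ε, hε, hεu⟩ := Metric.isOpen_iff.1 hu 0 (h0u rfl)
  have hT : Metric.closedBall (0 : ℝ) (ε / 2) ×ˢ K ⊆ s := by
    rintro ⟨t, z⟩ ⟨ht, hz⟩
    exact huv ⟨hεu (Metric.closedBall_subset_ball (half_lt_self hε) ht), hKv hz⟩
  have hmem : Metric.closedBall (0 : ℝ) (ε / 2) ∈ 𝓝 (0 : ℝ) :=
    Metric.closedBall_mem_nhds _ (half_pos hε)
  have hd := he.dirD hs ((1, 0) : ℝ × ℂ)
  have hcont : ∀ f : ℝ × ℂ → ℝ, ContDiffOn ℝ ∞ f s → ∀ t ∈ Metric.closedBall (0 : ℝ) (ε / 2),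
      ContinuousOn (fun z => f (t, z)) K := fun f hf t ht =>
    hf.continuousOn.comp (by fun_prop) fun z hz => hT ⟨ht, hz⟩
  have hint : ∀ f : ℝ × ℂ → ℝ, ContDiffOn ℝ ∞ f s → ∀ t ∈ Metric.closedBall (0 : ℝ) (ε / 2),
      IntegrableOn (fun z => f (t, z)) K := fun f hf t ht =>
    (hcont f hf t ht).integrableOn_compact hK
  obtain ⟨C, hC⟩ := ((isCompact_closedBall (0 : ℝ) (ε / 2)).prod hK).exists_bound_of_continuousOn
    (hd.continuousOn.mono hT)
  refine ⟨(hasDerivAt_integral_of_dominated_loc_of_deriv_le (bound := fun _ => C)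
    (F' := fun t z => dirD ((1, 0) : ℝ × ℂ) e (t, z)) hmem ?_ ?_ ?_ ?_ ?_ ?_).2, ?_⟩
  · filter_upwards [hmem] with t ht using (hint e he t ht).aestronglyMeasurable
  · exact hint e he 0 (mem_of_mem_nhds hmem)
  · exact (hint _ hd 0 (mem_of_mem_nhds hmem)).aestronglyMeasurable
  · exact ae_restrict_of_forall_mem hK.measurableSet fun z hz t ht => hC (t, z) ⟨ht, hz⟩
  · exact integrableOn_const hK.measure_lt_top.ne
  · exact ae_restrict_of_forall_mem hK.measurableSet fun z hz t ht =>
      dirD_slice_time (he.differentiableAt_of_isOpen hs (hT ⟨ht, hz⟩))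
  · filter_upwards [hmem] with t ht using ⟨fun z hz => hT ⟨ht, hz⟩, hint e he t ht⟩

lemma integrable_of_continuousOn_of_eq_zero {f : ℂ → ℝ} {s K : Set ℂ} (hs : IsOpen s)
    (hK : IsCompact K) (hKs : K ⊆ s) (hf : ContinuousOn f s) (h0 : ∀ z ∉ K, f z = 0) :
    Integrable f := by
  refine Continuous.integrable_of_hasCompactSupport ?_ (HasCompactSupport.intro hK h0)
  rw [continuous_iff_continuousAt]
  intro z
  by_cases hz : z ∈ K
  · exact hf.continuousAt (hs.mem_nhds (hKs hz))
  · refine (continuousAt_const (y := (0 : ℝ))).congr ?_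
    filter_upwards [hK.isClosed.isOpen_compl.mem_nhds hz] with w hw using (h0 w hw).symm

end Integrals

/-! ### Variations inside the sphere and the Dirichlet density of the Gauss map. -/

section Variation

open MeasureTheory

variable {n : ℕ}

/-- Normalization of a vector to length one. -/
def normalizeVec (x : Euc n) : Euc n := ‖x‖⁻¹ • x

lemma norm_normalizeVec {x : Euc n} (hx : x ≠ 0) : ‖normalizeVec x‖ = 1 := by
  rw [normalizeVec, norm_smul, norm_inv, norm_norm, inv_mul_cancel₀ (norm_ne_zero_iff.2 hx)]

lemma normalizeVec_of_norm {x : Euc n} (hx : ‖x‖ = 1) : normalizeVec x = x := by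
  rw [normalizeVec, hx, inv_one, one_smul]

/-- The displacement of the point `y` of the sphere by `r` times the tangential part of `c`. -/
def displace (c : Euc n) (r : ℝ) (y : Euc n) : Euc n :=
  y + r • (c - (inner ℝ y c : ℝ) • y)

/-- The displacement is tangent to the sphere at $y$ and leaves the radial component equal to 1.
Hence the displaced point is never zero and can be normalized for all times, not only small ones. -/
lemma inner_displace {c y : Euc n} {r : ℝ} (hy : ‖y‖ = 1) : inner ℝ y (displace c r y) = (1 : ℝ) := by
  rw [displace, inner_add_right, inner_smul_right, inner_sub_right, inner_smul_right,
    real_inner_self_eq_norm_sq, hy]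
  ring

lemma displace_ne_zero {c y : Euc n} {r : ℝ} (hy : ‖y‖ = 1) : displace c r y ≠ 0 := fun h0 => by
  have := inner_displace (c := c) (r := r) hy
  rw [h0, inner_zero_right] at this
  exact zero_ne_one this

/-- The variation of the map `g` into the sphere in the direction of `η` times the tangential part
of the constant vector `c`. -/
def bumpVariation (g : ℂ → Euc n) (η : ℂ → ℝ) (c : Euc n) (q : ℝ × ℂ) : Euc n :=
  normalizeVec (displace c (q.1 * η q.2) (g q.2))

variable {g : ℂ → Euc n} {η : ℂ → ℝ} {c : Euc n}

lemma norm_bumpVariation (hg : ∀ z, ‖g z‖ = 1) (q : ℝ × ℂ) : ‖bumpVariation g η c q‖ = 1 :=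
  norm_normalizeVec (displace_ne_zero (hg _))

lemma bumpVariation_of_mul_eq_zero (hg : ∀ z, ‖g z‖ = 1) {q : ℝ × ℂ} (h : q.1 * η q.2 = 0) :
    bumpVariation g η c q = g q.2 := by
  rw [bumpVariation, h, displace, zero_smul, add_zero, normalizeVec_of_norm (hg _)]

lemma contDiffOn_displace {s : Set ℂ} (hs : ContDiffOn ℝ ∞ g s) (hη : ContDiff ℝ ∞ η) :
    ContDiffOn ℝ ∞ (fun q : ℝ × ℂ => displace c (q.1 * η q.2) (g q.2)) (Set.univ ×ˢ s) := by
  have h1 : ContDiffOn ℝ ∞ (fun q : ℝ × ℂ => g q.2) (Set.univ ×ˢ s) :=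
    hs.comp contDiff_snd.contDiffOn fun q hq => hq.2
  have h2 : ContDiffOn ℝ ∞ (fun q : ℝ × ℂ => (inner ℝ (g q.2) c : ℝ)) (Set.univ ×ˢ s) :=
    h1.inner ℝ contDiffOn_const
  have h3 : ContDiffOn ℝ ∞ (fun q : ℝ × ℂ => η q.2) (Set.univ ×ˢ s) :=
    (hη.comp contDiff_snd).contDiffOn
  exact h1.add ((contDiff_fst.contDiffOn.mul h3).smul (contDiffOn_const.sub (h2.smul h1)))

lemma contDiffOn_bumpVariation (hg : ∀ z, ‖g z‖ = 1) {s : Set ℂ} (hs : ContDiffOn ℝ ∞ g s)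
    (hη : ContDiff ℝ ∞ η) : ContDiffOn ℝ ∞ (bumpVariation g η c) (Set.univ ×ˢ s) := by
  have h1 := contDiffOn_displace (c := c) hs hη
  exact ((h1.norm ℝ fun q _ => displace_ne_zero (hg _)).inv fun q _ =>
    norm_ne_zero_iff.2 (displace_ne_zero (hg _))).smul h1

/-- The displacement $u$ is orthogonal to $g$, so the length of $g+tu$ is stationary at $t=0$ and
the normalization contributes nothing to first order. -/
lemma dirD_time_bumpVariation (hg : ∀ z, ‖g z‖ = 1) {s : Set ℂ} (ho : IsOpen s)
    (hs : ContDiffOn ℝ ∞ g s) (hη : ContDiff ℝ ∞ η) {z : ℂ} (hz : z ∈ s) :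
    dirD ((1, 0) : ℝ × ℂ) (bumpVariation g η c) (0, z) =
      η z • (c - (inner ℝ (g z) c : ℝ) • g z) := by
  set u : Euc n := η z • (c - (inner ℝ (g z) c : ℝ) • g z) with hu
  have h1 : HasDerivAt (fun t => bumpVariation g η c (t, z))
      (dirD ((1, 0) : ℝ × ℂ) (bumpVariation g η c) (0, z)) 0 :=
    dirD_slice_time ((contDiffOn_bumpVariation hg hs hη).differentiableAt_of_isOpen
      (isOpen_univ.prod ho) ⟨trivial, hz⟩)
  have e0 : ∀ t : ℝ, displace c (t * η z) (g z) = g z + t • u := fun t => by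
    rw [displace, hu, smul_smul]
  have h2 : HasDerivAt (fun t : ℝ => g z + t • u) u 0 := by
    simpa using ((hasDerivAt_id (0 : ℝ)).smul_const u).const_add (g z)
  have hgu : inner ℝ (g z) u = (0 : ℝ) := by
    rw [hu, inner_smul_right, inner_sub_right, inner_smul_right, real_inner_self_eq_norm_sq, hg]
    ring
  have h3 : HasDerivAt (fun t : ℝ => ‖g z + t • u‖ ^ 2) (2 * inner ℝ (g z) u) 0 := by
    simpa using h2.norm_sq
  -- The norm is differentiated as the square root of its square, whose derivative $2\langle
  -- g,u\rangle$ is zero.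
  have h4 : HasDerivAt (fun t : ℝ => (‖g z + t • u‖)⁻¹) 0 0 := by
    have h5 : HasDerivAt (fun t : ℝ => (Real.sqrt (‖g z + t • u‖ ^ 2))⁻¹) 0 0 := by
      have := (h3.sqrt (by simp [hg])).fun_inv (by simp [hg])
      simpa [hgu] using this
    simpa using h5
  have h6 := h4.smul h2
  have h7 : (fun t => bumpVariation g η c (t, z)) =
      (fun t : ℝ => (‖g z + t • u‖)⁻¹ • (g z + t • u)) := by
    funext t
    rw [bumpVariation, e0, normalizeVec]
  rw [h7] at h1
  have h8 := h1.unique h6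
  rw [h8]
  simp [hg]

/-- The part of the space of parameters on which the variation is an immersion. -/
def immersedSet (Γ : ℝ × ℂ → Euc n) (s : Set ℂ) : Set (ℝ × ℂ) :=
  {q ∈ Set.univ ×ˢ s |
    0 < eucGram (dirD ((0, 1) : ℝ × ℂ) Γ q) (dirD ((0, Complex.I) : ℝ × ℂ) Γ q)}

/-- The Gram determinant is continuous, so the immersed parameters form an open set of $\mathbb
R\times\mathbb C$. The whole variation is treated there as one immersion in the two space
directions, with time as an additional variable. -/
lemma isSphereImmersion_immersedSet {Γ : ℝ × ℂ → Euc n} {s : Set ℂ} (ho : IsOpen s)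
    (hΓ : ContDiffOn ℝ ∞ Γ (Set.univ ×ˢ s)) (hn : ∀ q, ‖Γ q‖ = 1) :
    IsSphereImmersion Γ ((0, 1) : ℝ × ℂ) (0, Complex.I) (immersedSet Γ s) := by
  have ho' : IsOpen ((Set.univ : Set ℝ) ×ˢ s) := isOpen_univ.prod ho
  have ha := hΓ.dirD ho' ((0, 1) : ℝ × ℂ)
  have hb := hΓ.dirD ho' ((0, Complex.I) : ℝ × ℂ)
  have hc : ContinuousOn (fun q => eucGram (dirD ((0, 1) : ℝ × ℂ) Γ q)
      (dirD ((0, Complex.I) : ℝ × ℂ) Γ q)) (Set.univ ×ˢ s) :=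
    (((ha.inner ℝ ha).mul (hb.inner ℝ hb)).sub ((ha.inner ℝ hb).pow 2)).continuousOn
  exact ⟨hc.isOpen_inter_preimage ho' isOpen_Ioi, hΓ.mono fun q hq => hq.1,
    fun q _ => by rw [real_inner_self_eq_norm_sq, hn, one_pow], fun q hq => hq.2⟩

/-- The Dirichlet density of the congruence of mean curvature spheres. -/
def gaussDirichlet (Γ : ℝ × ℂ → Euc n) (q : ℝ × ℂ) : ℝ :=
  1 / 4 * (tracePairing n
      (dirD ((0, 1) : ℝ × ℂ) (surfProj Γ ((0, 1) : ℝ × ℂ) (0, Complex.I)) q)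
      (dirD ((0, 1) : ℝ × ℂ) (surfProj Γ ((0, 1) : ℝ × ℂ) (0, Complex.I)) q) +
    tracePairing n
      (dirD ((0, Complex.I) : ℝ × ℂ) (surfProj Γ ((0, 1) : ℝ × ℂ) (0, Complex.I)) q)
      (dirD ((0, Complex.I) : ℝ × ℂ) (surfProj Γ ((0, 1) : ℝ × ℂ) (0, Complex.I)) q))

section DirichletDensity

variable {Γ : ℝ × ℂ → Euc n} {s : Set (ℝ × ℂ)}
  (h : IsSphereImmersion Γ ((0, 1) : ℝ × ℂ) (0, Complex.I) s)
include h

lemma contDiffOn_gaussDirichlet : ContDiffOn ℝ ∞ (gaussDirichlet Γ) s :=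
  contDiffOn_const.mul
    ((contDiffOn_bilinear (tracePairing n) (h.smooth_surfProj.dirD h.isOpen _)
      (h.smooth_surfProj.dirD h.isOpen _)).add
    (contDiffOn_bilinear (tracePairing n) (h.smooth_surfProj.dirD h.isOpen _)
      (h.smooth_surfProj.dirD h.isOpen _)))

lemma willmoreDensity_slice {t : ℝ} {z : ℂ} (hq : (t, z) ∈ s) :
    willmoreDensity (fun w => Γ (t, w)) z =
      jetWillmore (Γ (t, z)) (dirD ((0, 1) : ℝ × ℂ) Γ (t, z))
        (dirD ((0, Complex.I) : ℝ × ℂ) Γ (t, z))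
        (dirD ((0, 1) : ℝ × ℂ) (dirD ((0, 1) : ℝ × ℂ) Γ) (t, z))
        (dirD ((0, 1) : ℝ × ℂ) (dirD ((0, Complex.I) : ℝ × ℂ) Γ) (t, z))
        (dirD ((0, Complex.I) : ℝ × ℂ) (dirD ((0, Complex.I) : ℝ × ℂ) Γ) (t, z)) := by
  have hj := h.isSphereJet hq
  have hd := h.differentiableAt hq
  have e := willmoreDensity_eq_jetWillmore (g := fun w => Γ (t, w)) (z := z)
  simp only [dU_eq_dirD, dV_eq_dirD, dirD_dirD_slice h.isOpen h.smooth hq, dirD_slice hd] at e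
  exact e hj

lemma willmoreDensity_nonneg {t : ℝ} {z : ℂ} (hq : (t, z) ∈ s) :
    0 ≤ willmoreDensity (fun w => Γ (t, w)) z := by
  rw [willmoreDensity_slice h hq]
  exact (h.isSphereJet hq).jetWillmore_nonneg

lemma willmoreDensity_le_gaussDirichlet {t : ℝ} {z : ℂ} (hq : (t, z) ∈ s) :
    willmoreDensity (fun w => Γ (t, w)) z ≤ gaussDirichlet Γ (t, z) := by
  rw [willmoreDensity_slice h hq, gaussDirichlet, tracePairing_apply, tracePairing_apply,
    h.dirichlet_density hq]
  exact (h.isSphereJet hq).jetWillmore_le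

lemma willmoreDensity_eq_gaussDirichlet {t : ℝ} {z : ℂ} (hq : (t, z) ∈ s)
    (hE : (inner ℝ (dirD ((0, 1) : ℝ × ℂ) Γ (t, z)) (dirD ((0, 1) : ℝ × ℂ) Γ (t, z)) : ℝ) =
      inner ℝ (dirD ((0, Complex.I) : ℝ × ℂ) Γ (t, z)) (dirD ((0, Complex.I) : ℝ × ℂ) Γ (t, z)))
    (hF : (inner ℝ (dirD ((0, 1) : ℝ × ℂ) Γ (t, z))
      (dirD ((0, Complex.I) : ℝ × ℂ) Γ (t, z)) : ℝ) = 0) :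
    willmoreDensity (fun w => Γ (t, w)) z = gaussDirichlet Γ (t, z) := by
  rw [willmoreDensity_slice h hq, gaussDirichlet, tracePairing_apply, tracePairing_apply,
    h.dirichlet_density hq]
  exact (h.isSphereJet hq).jetWillmore_eq_of_conformal hE hF

/-- Symmetry of the trace pairing doubles $\frac14$ to $\frac12$. Exchanging the order of
derivatives leaves $\tau$ innermost, which prepares the integration by parts. -/
lemma dirD_time_gaussDirichlet {q : ℝ × ℂ} (hq : q ∈ s) (τ : ℝ × ℂ) :
    dirD τ (gaussDirichlet Γ) q = 1 / 2 * (tracePairing n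
      (dirD ((0, 1) : ℝ × ℂ) (surfProj Γ ((0, 1) : ℝ × ℂ) (0, Complex.I)) q)
      (dirD ((0, 1) : ℝ × ℂ) (dirD τ (surfProj Γ ((0, 1) : ℝ × ℂ) (0, Complex.I))) q) +
    tracePairing n
      (dirD ((0, Complex.I) : ℝ × ℂ) (surfProj Γ ((0, 1) : ℝ × ℂ) (0, Complex.I)) q)
      (dirD ((0, Complex.I) : ℝ × ℂ) (dirD τ
        (surfProj Γ ((0, 1) : ℝ × ℂ) (0, Complex.I))) q)) := by
  have hd := fun c => h.differentiableAt_dirD_surfProj hq c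
  have hb : ∀ c, DifferentiableAt ℝ (fun q => tracePairing n
      (dirD c (surfProj Γ ((0, 1) : ℝ × ℂ) (0, Complex.I)) q)
      (dirD c (surfProj Γ ((0, 1) : ℝ × ℂ) (0, Complex.I)) q)) q := fun c =>
    (contDiffOn_bilinear (tracePairing n) (h.smooth_surfProj.dirD h.isOpen c)
      (h.smooth_surfProj.dirD h.isOpen c)).differentiableAt_of_isOpen h.isOpen hq
  have hs : ∀ A B, tracePairing n A B = tracePairing n B A := fun A B => Matrix.trace_mul_comm A B
  have e : dirD τ (gaussDirichlet Γ) q = 1 / 4 * dirD τ (fun q => tracePairing n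
      (dirD ((0, 1) : ℝ × ℂ) (surfProj Γ ((0, 1) : ℝ × ℂ) (0, Complex.I)) q)
      (dirD ((0, 1) : ℝ × ℂ) (surfProj Γ ((0, 1) : ℝ × ℂ) (0, Complex.I)) q) +
    tracePairing n
      (dirD ((0, Complex.I) : ℝ × ℂ) (surfProj Γ ((0, 1) : ℝ × ℂ) (0, Complex.I)) q)
      (dirD ((0, Complex.I) : ℝ × ℂ) (surfProj Γ ((0, 1) : ℝ × ℂ) (0, Complex.I)) q)) q := by
    unfold gaussDirichlet
    simp only [← smul_eq_mul (1 / 4 : ℝ)]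
    refine (dirD_smul (differentiableAt_const _) ((hb _).fun_add (hb _)) τ).trans ?_
    rw [dirD_const, zero_smul, zero_add]
  rw [e, dirD_add (hb _) (hb _), dirD_bilinear _ (hd _) (hd _), dirD_bilinear _ (hd _) (hd _),
    dirD_comm h.smooth_surfProj h.isOpen hq τ, dirD_comm h.smooth_surfProj h.isOpen hq τ,
    hs (dirD _ (dirD τ _) q), hs (dirD _ (dirD τ _) q)]
  ring

end DirichletDensity

end Variation

/-! ### First variation: criticality forces the tension to vanish. -/

section FirstVariation

open MeasureTheory

variable {n : ℕ} {g : ℂ → Euc n} {η : ℂ → ℝ} {c : Euc n} {s : Set ℂ}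

lemma bumpVariation_zero (hg : ∀ z, ‖g z‖ = 1) :
    (fun w => bumpVariation g η c (0, w)) = g := by
  funext w
  exact bumpVariation_of_mul_eq_zero hg (by simp)

lemma zero_mem_immersedSet (hg : ∀ z, ‖g z‖ = 1)
    (h : IsConformalSphereImmersion g 1 Complex.I s) (hη : ContDiff ℝ ∞ η) {z : ℂ} (hz : z ∈ s) :
    ((0 : ℝ), z) ∈ immersedSet (bumpVariation g η c) s := by
  have hd := (contDiffOn_bumpVariation (c := c) hg h.smooth hη).differentiableAt_of_isOpen
    (isOpen_univ.prod h.isOpen) (x := ((0 : ℝ), z)) ⟨trivial, hz⟩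
  refine ⟨⟨trivial, hz⟩, ?_⟩
  rw [← dirD_slice hd, ← dirD_slice hd, bumpVariation_zero hg]
  exact h.det z hz

/-- A compactly supported variation with vanishing first derivative of the Dirichlet integral. -/
lemma setIntegral_dirD_gaussDirichlet_eq_zero (hg : ∀ z, ‖g z‖ = 1)
    (h : IsConformalSphereImmersion g 1 Complex.I s) (hη : ContDiff ℝ ∞ η) {K : Set ℂ}
    (hK : IsCompact K) (hKs : K ⊆ s)
    (hW : HasDerivAt (fun t => ∫ z in K, willmoreDensity
      (fun w => bumpVariation g η c (t, w)) z) 0 0) :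
    ∫ z in K, dirD ((1, 0) : ℝ × ℂ) (gaussDirichlet (bumpVariation g η c)) (0, z) = 0 := by
  have hΓ := contDiffOn_bumpVariation (c := c) hg h.smooth hη
  have hI := isSphereImmersion_immersedSet h.isOpen hΓ (norm_bumpVariation hg)
  obtain ⟨hd, hev⟩ := hasDerivAt_setIntegral_of_contDiffOn hI.isOpen
    (contDiffOn_gaussDirichlet hI) hK fun z hz => zero_mem_immersedSet hg h hη (hKs hz)
  have hsub := hd.sub hW
  rw [sub_zero] at hsub
  -- The Dirichlet integral minus the Willmore integral is nonnegative near $t=0$ and zero at $t=0$,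
  -- where the surface is conformal. Its derivative, which equals that of the Dirichlet integral,
  -- vanishes at this minimum.
  refine IsLocalMin.hasDerivAt_eq_zero ?_ hsub
  have h0 : ∫ z in K, gaussDirichlet (bumpVariation g η c) (0, z) =
      ∫ z in K, willmoreDensity (fun w => bumpVariation g η c (0, w)) z := by
    refine setIntegral_congr_fun hK.measurableSet fun z hz => ?_
    have hz' := zero_mem_immersedSet (c := c) hg h hη (hKs hz)
    have hdz := hI.differentiableAt hz'
    refine (willmoreDensity_eq_gaussDirichlet hI hz' ?_ ?_).symm
    · rw [← dirD_slice hdz, ← dirD_slice hdz, bumpVariation_zero hg]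
      exact h.metE_eq z (hKs hz)
    · rw [← dirD_slice hdz, ← dirD_slice hdz, bumpVariation_zero hg]
      exact h.metF_eq z (hKs hz)
  filter_upwards [hev] with t ht
  simp only [Pi.sub_apply]
  rw [h0, sub_self, sub_nonneg]
  -- Nonnegativity of the Willmore density makes the integrability of the larger Dirichlet density
  -- sufficient here.
  exact integral_mono_of_nonneg
    (ae_restrict_of_forall_mem hK.measurableSet fun z hz => willmoreDensity_nonneg hI (ht.1 z hz))
    ht.2
    (ae_restrict_of_forall_mem hK.measurableSet fun z hz =>
      willmoreDensity_le_gaussDirichlet hI (ht.1 z hz))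

/-- Integration by parts for the trace pairing with a compactly supported field. -/
lemma integral_tracePairing_dirD {A B : ℂ → Matrix (MinkIdx n) (MinkIdx n) ℝ} {K : Set ℂ}
    (hs : IsOpen s) (hK : IsCompact K) (hKs : K ⊆ s) (hA : ContDiffOn ℝ ∞ A s)
    (hB : ContDiffOn ℝ ∞ B s) (h0 : ∀ z ∉ K, B z = 0) (d : ℂ) :
    Integrable (fun z => tracePairing n (A z) (dirD d B z)) ∧
    Integrable (fun z => tracePairing n (dirD d A z) (B z)) ∧
    ∫ z, tracePairing n (A z) (dirD d B z) = -∫ z, tracePairing n (dirD d A z) (B z) := by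
  have hB0 : ∀ z ∉ K, B =ᶠ[𝓝 z] fun _ => 0 := fun z hz => by
    filter_upwards [hK.isClosed.isOpen_compl.mem_nhds hz] with w hw using h0 w hw
  have hdB0 : ∀ z ∉ K, dirD d B z = 0 := fun z hz => by
    rw [dirD_congr (hB0 z hz), dirD_const]
  have i1 : Integrable (fun z => tracePairing n (A z) (dirD d B z)) :=
    integrable_of_continuousOn_of_eq_zero hs hK hKs
      (contDiffOn_bilinear (tracePairing n) hA (hB.dirD hs d)).continuousOn
      fun z hz => by rw [hdB0 z hz, map_zero]
  have i2 : Integrable (fun z => tracePairing n (dirD d A z) (B z)) :=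
    integrable_of_continuousOn_of_eq_zero hs hK hKs
      (contDiffOn_bilinear (tracePairing n) (hA.dirD hs d) hB).continuousOn
      fun z hz => by rw [h0 z hz, map_zero]
  have i3 : Integrable (fun z => tracePairing n (A z) (B z)) :=
    integrable_of_continuousOn_of_eq_zero hs hK hKs
      (contDiffOn_bilinear (tracePairing n) hA hB).continuousOn
      fun z hz => by rw [h0 z hz, map_zero]
  refine ⟨i1, i2, ?_⟩
  refine integral_bilinear_fderiv_right_eq_neg_left_of_integrable
    (B := (tracePairing n).toContinuousBilinearMap) i2 i1 i3 ?_ ?_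
  · intro z hz
    have hzK : z ∈ K := closure_minimal (fun w hw => by
      by_contra hwK
      exact hw (h0 w hwK)) hK.isClosed hz
    exact hA.differentiableAt_of_isOpen hs (hKs hzK)
  · intro z _
    by_cases hz : z ∈ K
    · exact hB.differentiableAt_of_isOpen hs (hKs hz)
    · exact (hB0 z hz).differentiableAt_iff.2 (differentiableAt_const _)

/-- The first variation formula: for a critical immersion the tension is orthogonal to all
compactly supported variations. -/
theorem integral_surfTension_eq_zero (hg : ∀ z, ‖g z‖ = 1)
    (h : IsConformalSphereImmersion g 1 Complex.I s) (hη : ContDiff ℝ ∞ η)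
    (hc : HasCompactSupport η) (hs : tsupport η ⊆ s)
    (hW : HasDerivAt (fun t => ∫ z in tsupport η, willmoreDensity
      (fun w => bumpVariation g η c (t, w)) z) 0 0) :
    ∫ z, η z • minkInner (surfTension g 1 Complex.I z)
      (spaceEmb (c - (inner ℝ (g z) c : ℝ) • g z)) = 0 := by
  classical
  have hK : IsCompact (tsupport η) := hc
  have hΓ := contDiffOn_bumpVariation (c := c) hg h.smooth hη
  have hI := isSphereImmersion_immersedSet h.isOpen hΓ (norm_bumpVariation hg)
  set Γ := bumpVariation g η c with hΓdef
  set P := surfProj Γ ((0, 1) : ℝ × ℂ) (0, Complex.I) with hP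
  have h0mem : ∀ z ∈ s, ((0 : ℝ), z) ∈ immersedSet Γ s := fun z hz =>
    zero_mem_immersedSet hg h hη hz
  have hτ := hI.smooth_surfProj.dirD hI.isOpen ((1, 0) : ℝ × ℂ)
  have hslice : Set.MapsTo (fun w : ℂ => ((0 : ℝ), w)) s (immersedSet Γ s) := h0mem
  have hP0 : ∀ z ∈ s, P (0, z) = surfProj g 1 Complex.I z := fun z hz => by
    rw [hP, ← surfProj_slice hI.isOpen hI.smooth (h0mem z hz), hΓdef, bumpVariation_zero hg]
  -- the variation of the projection, extended by zero
  set B : ℂ → Matrix (MinkIdx n) (MinkIdx n) ℝ := fun z =>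
    if z ∈ tsupport η then dirD ((1, 0) : ℝ × ℂ) P (0, z) else 0 with hBdef
  have hB0 : ∀ z ∉ tsupport η, B z = 0 := fun z hz => if_neg hz
  have hBs : ∀ z ∈ s, B z = dirD ((1, 0) : ℝ × ℂ) P (0, z) := by
    intro z hz
    by_cases hzK : z ∈ tsupport η
    · exact if_pos hzK
    rw [hB0 z hzK]
    have hd := dirD_slice_time (hI.differentiableAt_surfProj (h0mem z hz))
    -- Near a point off the support the surface does not depend on $t$, so $\delta P$ is zero there.
    -- Hence $B$ agrees with $\delta P$ on all of $s$ and is smooth.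
    refine ((hasDerivAt_const (0 : ℝ) (surfProj g 1 Complex.I z)).congr_of_eventuallyEq
      ?_).unique hd
    have hc0 : ContinuousAt (fun t : ℝ => (t, z)) 0 := by fun_prop
    filter_upwards [hc0.preimage_mem_nhds (hI.isOpen.mem_nhds (h0mem z hz))] with t ht
    rw [← surfProj_slice hI.isOpen hI.smooth ht]
    refine surfProj_congr ?_ _ _
    filter_upwards [(isClosed_tsupport η).isOpen_compl.mem_nhds hzK] with w hw
    exact bumpVariation_of_mul_eq_zero hg (by rw [image_eq_zero_of_notMem_tsupport hw, mul_zero])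
  have hBsm : ContDiffOn ℝ ∞ B s :=
    (hτ.comp (f := fun w : ℂ => ((0 : ℝ), w)) (by fun_prop) hslice).congr hBs
  have hAd := fun d : ℂ => h.smooth_surfProj.dirD h.isOpen d
  obtain ⟨i1, j1, e1⟩ := integral_tracePairing_dirD h.isOpen hK hs (hAd 1) hBsm hB0 1
  obtain ⟨i2, j2, e2⟩ := integral_tracePairing_dirD h.isOpen hK hs (hAd Complex.I) hBsm hB0
    Complex.I
  have hPd : ∀ z ∈ s, ∀ d : ℂ, dirD ((0, d) : ℝ × ℂ) P (0, z) =
      dirD d (surfProj g 1 Complex.I) z := fun z hz d => by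
    rw [← dirD_slice (hI.differentiableAt_surfProj (h0mem z hz))]
    exact dirD_congr_of_isOpen h.isOpen hP0 d hz
  have hBd : ∀ z ∈ s, ∀ d : ℂ, dirD ((0, d) : ℝ × ℂ) (dirD ((1, 0) : ℝ × ℂ) P) (0, z) =
      dirD d B z := fun z hz d => by
    rw [← dirD_slice (hI.differentiableAt_dirD_surfProj (h0mem z hz) _)]
    exact dirD_congr_of_isOpen h.isOpen (fun w hw => (hBs w hw).symm) d hz
  have key := setIntegral_dirD_gaussDirichlet_eq_zero hg h hη hK hs hW
  have hcongr : ∫ z in tsupport η, dirD ((1, 0) : ℝ × ℂ) (gaussDirichlet Γ) (0, z) =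
      ∫ z, 1 / 2 * (tracePairing n (dirD 1 (surfProj g 1 Complex.I) z) (dirD 1 B z) +
        tracePairing n (dirD Complex.I (surfProj g 1 Complex.I) z) (dirD Complex.I B z)) := by
    refine Eq.trans ?_ (setIntegral_eq_integral_of_forall_compl_eq_zero (s := tsupport η) ?_)
    · refine setIntegral_congr_fun hK.measurableSet fun z hz => ?_
      rw [dirD_time_gaussDirichlet hI (h0mem z (hs hz)), ← hP, hPd z (hs hz), hPd z (hs hz),
        hBd z (hs hz), hBd z (hs hz)]
    · intro z hz
      have : B =ᶠ[𝓝 z] fun _ => 0 := by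
        filter_upwards [(isClosed_tsupport η).isOpen_compl.mem_nhds hz] with w hw using hB0 w hw
      rw [dirD_congr this, dirD_congr this, dirD_const, dirD_const, map_zero, map_zero]
      ring
  rw [hcongr, integral_const_mul, integral_add i1 i2, e1, e2, ← neg_add, ← integral_add j1 j2]
    at key
  -- On the support, $\delta P\,Y=-P\,\delta y$ with $\delta y=\eta\,(c-\langle g,c\rangle g)$, so
  -- `trace_dirLap_mul` applies and gives the factor $-2$. Off the support both sides vanish.
  have hfin : ∀ z, tracePairing n (dirD 1 (dirD 1 (surfProj g 1 Complex.I)) z) (B z) +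
      tracePairing n (dirD Complex.I (dirD Complex.I (surfProj g 1 Complex.I)) z) (B z) =
      (-2) * (η z • minkInner (surfTension g 1 Complex.I z)
        (spaceEmb (c - (inner ℝ (g z) c : ℝ) • g z))) := by
    intro z
    by_cases hz : z ∈ tsupport η
    · have hzs := hs hz
      have hm := h0mem z hzs
      have hBz := hBs z hzs
      have hGz : Γ (0, z) = g z := congrFun (bumpVariation_zero hg) z
      have e : (dirLap 1 Complex.I (surfProj g 1 Complex.I) z * B z).trace =
          -(2 * minkInner (surfTension g 1 Complex.I z)
            (spaceEmb (η z • (c - (inner ℝ (g z) c : ℝ) • g z)))) := by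
        refine h.trace_dirLap_mul hzs ?_ ?_ ?_
        · rw [hBz]; exact hI.dirD_surfProj_sym hm _
        · rw [hBz, ← hP0 z hzs]; exact hI.dirD_surfProj_mul hm _
        · have := hI.dirD_surfProj_coneLift hm ((1, 0) : ℝ × ℂ)
          rw [← hP, hGz, hP0 z hzs, hΓdef, dirD_time_bumpVariation hg h.isOpen h.smooth hη hzs]
            at this
          rw [hBz, this]
      rw [map_smul, minkInner_smul_right] at e
      rw [tracePairing_apply, tracePairing_apply, ← Matrix.trace_add, ← Matrix.add_mul]
      refine e.trans ?_
      rw [smul_eq_mul]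
      ring
    · rw [hB0 z hz, map_zero, map_zero, image_eq_zero_of_notMem_tsupport hz, zero_smul]
      ring
  simp only [hfin] at key
  rw [integral_const_mul] at key
  linarith

/-- A conformal immersion which is critical for all normal variations has vanishing tension. -/
theorem surfTension_eq_zero_of_critical (hg : ∀ z, ‖g z‖ = 1)
    (h : IsConformalSphereImmersion g 1 Complex.I s)
    (hW : ∀ (η : ℂ → ℝ) (c : Euc n), ContDiff ℝ ∞ η → HasCompactSupport η → tsupport η ⊆ s →
      HasDerivAt (fun t => ∫ z in tsupport η, willmoreDensity
        (fun w => bumpVariation g η c (t, w)) z) 0 0) {z : ℂ} (hz : z ∈ s) :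
    surfTension g 1 Complex.I z = 0 := by
  refine h.surfTension_eq_zero hz fun c => ?_
  set f : ℂ → ℝ := fun z => minkInner (surfTension g 1 Complex.I z)
      (spaceEmb (c - (inner ℝ (g z) c : ℝ) • g z)) with hf
  have hP := h.smooth_surfProj
  have hL : ContDiffOn ℝ ∞ (dirLap 1 Complex.I (surfProj g 1 Complex.I)) s :=
    ((hP.dirD h.isOpen _).dirD h.isOpen _).add ((hP.dirD h.isOpen _).dirD h.isOpen _)
  have hT : ContDiffOn ℝ ∞ (surfTension g 1 Complex.I) s :=
    contDiffOn_bilinear (Matrix.mulVecBilin ℝ ℝ) hP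
      (contDiffOn_bilinear (Matrix.mulVecBilin ℝ ℝ) hL h.smooth_surfN)
  have hc : ContinuousOn f s :=
    (contDiffOn_bilinear (minkBilin n) hT (contDiffOn_linear spaceEmb
      (contDiffOn_const.sub ((h.smooth.inner ℝ contDiffOn_const).smul h.smooth)))).continuousOn
  -- The fundamental lemma of the calculus of variations gives vanishing almost everywhere on $s$;
  -- continuity upgrades this to every point.
  have hae := h.isOpen.ae_eq_zero_of_integral_contDiff_smul_eq_zero (μ := volume)
    (hc.locallyIntegrableOn h.isOpen.measurableSet) fun η hη hcs hts =>
      integral_surfTension_eq_zero hg h hη hcs hts (hW η c hη hcs hts)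
  exact Measure.eqOn_open_of_ae_eq ((ae_restrict_iff' h.isOpen.measurableSet).2 hae) h.isOpen hc
    continuousOn_const hz

end FirstVariation

/-! ### Holomorphic coordinates as real smooth coordinates. -/

section RealStructure

variable {M : Type*} [TopologicalSpace M] [ChartedSpace ℂ M] {n : ℕ}

/-- Complex analytic coordinate changes are real smooth after restriction of scalars. -/
lemma mem_real_contDiffGroupoid {e : OpenPartialHomeomorph ℂ ℂ}
    (h : e ∈ contDiffGroupoid ω 𝓘(ℂ)) : e ∈ contDiffGroupoid ∞ 𝓘(ℝ, ℂ) := by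
  rw [contDiffGroupoid, mem_groupoid_of_pregroupoid] at h ⊢
  simp only [contDiffPregroupoid, modelWithCornersSelf_coe, modelWithCornersSelf_coe_symm,
    Function.comp_id, Function.id_comp, Set.preimage_id, Set.range_id, Set.inter_univ] at h ⊢
  exact ⟨(h.1.restrict_scalars ℝ).of_le le_top, (h.2.restrict_scalars ℝ).of_le le_top⟩

lemma IsCoordinate.mem_real_maximalAtlas {φ : OpenPartialHomeomorph M ℂ} (h : IsCoordinate φ) :
    φ ∈ IsManifold.maximalAtlas 𝓘(ℝ, ℂ) ∞ M := fun e he =>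
  ⟨mem_real_contDiffGroupoid (h e he).1, mem_real_contDiffGroupoid (h e he).2⟩

/-- Smooth maps read in a coordinate. -/
lemma IsCoordinate.contDiffOn {φ : OpenPartialHomeomorph M ℂ} (h : IsCoordinate φ)
    {E : Type*} [NormedAddCommGroup E] [NormedSpace ℝ E] {f : M → E} {W : Set M}
    (hf : ContMDiffOn 𝓘(ℝ, ℂ) 𝓘(ℝ, E) ∞ f W) :
    ContDiffOn ℝ ∞ (fun z => f (φ.symm z)) (φ.target ∩ φ.symm ⁻¹' W) := by
  rw [← contMDiffOn_iff_contDiffOn]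
  exact hf.comp ((contMDiffOn_symm_of_mem_maximalAtlas h.mem_real_maximalAtlas).mono
    Set.inter_subset_left) fun z hz => hz.2

omit [ChartedSpace ℂ M] in
lemma norm_inCoord (y : M → Sph n) (φ : OpenPartialHomeomorph M ℂ) (z : ℂ) :
    ‖inCoord y φ z‖ = 1 := by
  have := (y (φ.symm z)).2
  rwa [mem_sphere_zero_iff_norm] at this

lemma isConformalSphereImmersion_inCoord {y : M → Sph n} (hy : IsSmoothSphereMap y) {W : Set M}
    (hW : IsOpen W) (hc : IsConformalImmersionOn y W) {φ : OpenPartialHomeomorph M ℂ}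
    (hφ : IsCoordinate φ) :
    IsConformalSphereImmersion (inCoord y φ) 1 Complex.I (φ.target ∩ φ.symm ⁻¹' W) := by
  have key : ∀ z ∈ φ.target ∩ φ.symm ⁻¹' W, metE (inCoord y φ) z = metG (inCoord y φ) z ∧
      metF (inCoord y φ) z = 0 ∧ 0 < metE (inCoord y φ) z := fun z hz => by
    have := hc φ hφ (φ.symm z) ⟨φ.map_target hz.1, hz.2⟩
    rwa [φ.right_inv hz.1] at this
  refine ⟨⟨φ.isOpen_inter_preimage_symm hW, hφ.contDiffOn hy.contMDiffOn, fun z _ => ?_,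
    fun z hz => ?_⟩, fun z hz => (key z hz).1, fun z hz => (key z hz).2.1⟩
  · rw [real_inner_self_eq_norm_sq, norm_inCoord, one_pow]
  · obtain ⟨h1, h2, h3⟩ := key z hz
    change 0 < metE (inCoord y φ) z * metG (inCoord y φ) z - metF (inCoord y φ) z ^ 2
    rw [← h1, h2]
    nlinarith

end RealStructure

/-! ### Transplanting variations from a coordinate domain to the surface. -/

section VariationOnSurface

open Classical in
/-- The variation of `y` supported in the domain of a coordinate. -/
def chartVariation {M : Type*} [TopologicalSpace M] [ChartedSpace ℂ M] {n : ℕ} (y : M → Sph n)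
    (φ : OpenPartialHomeomorph M ℂ) (η : ℂ → ℝ) (c : Euc n) (t : ℝ) (p : M) : Sph n :=
  if p ∈ φ.source then
    ⟨bumpVariation (inCoord y φ) η c (t, φ p), by
      rw [mem_sphere_zero_iff_norm]; exact norm_bumpVariation (norm_inCoord y φ) _⟩
  else y p

variable {M : Type*} [TopologicalSpace M] [ChartedSpace ℂ M] {n : ℕ} {y : M → Sph n} {φ : OpenPartialHomeomorph M ℂ} {η : ℂ → ℝ}
  {c : Euc n} {W : Set M}

lemma chartVariation_of_mem {p : M} (hp : p ∈ φ.source) (t : ℝ) :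
    (chartVariation y φ η c t p : Euc n) = bumpVariation (inCoord y φ) η c (t, φ p) := by
  rw [chartVariation, if_pos hp]

lemma chartVariation_of_mul_eq_zero {p : M} {t : ℝ} (h : p ∈ φ.source → t * η (φ p) = 0) :
    chartVariation y φ η c t p = y p := by
  by_cases hp : p ∈ φ.source
  · apply Subtype.ext
    rw [chartVariation_of_mem hp, bumpVariation_of_mul_eq_zero (norm_inCoord y φ) (h hp), inCoord,
      φ.left_inv hp]
  · rw [chartVariation, if_neg hp]

lemma chartVariation_of_notMem {p : M} (h : p ∉ φ.symm '' tsupport η) (t : ℝ) :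
    chartVariation y φ η c t p = y p :=
  chartVariation_of_mul_eq_zero fun hp => by
    rw [image_eq_zero_of_notMem_tsupport fun hη => h ⟨φ p, hη, φ.left_inv hp⟩, mul_zero]

omit [ChartedSpace ℂ M] in
lemma isCompact_symm_image_tsupport (hc : HasCompactSupport η) (hs : tsupport η ⊆ φ.target) :
    IsCompact (φ.symm '' tsupport η) :=
  IsCompact.image_of_continuousOn hc (φ.continuousOn_symm.mono hs)

omit [ChartedSpace ℂ M] in
lemma symm_image_image {K : Set ℂ} (hs : K ⊆ φ.target) : φ '' (φ.symm '' K) = K := by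
  rw [Set.image_image]
  exact (Set.image_congr fun z hz => φ.right_inv (hs hz)).trans (Set.image_id K)

variable [T2Space M]

/-- Smoothness is checked in two cases: in the coordinate domain by the explicit formula, and
elsewhere because the variation is locally equal to $y$. The second case needs the compact support
to be closed in $M$, which is where the Hausdorff property enters. -/
lemma isVariation_chartVariation (hy : IsSmoothSphereMap y) (hφ : IsCoordinate φ)
    (hη : ContDiff ℝ ∞ η) (hc : HasCompactSupport η)
    (hs : tsupport η ⊆ φ.target ∩ φ.symm ⁻¹' W) :
    IsVariation y W (φ.symm '' tsupport η) (chartVariation y φ η c) := by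
  have hK := isCompact_symm_image_tsupport (φ := φ) hc fun z hz => (hs hz).1
  refine ⟨hK, ?_, ?_, ?_, fun t p hp => chartVariation_of_notMem hp t⟩
  · rintro _ ⟨z, hz, rfl⟩
    exact (hs hz).2
  · rintro ⟨t, p⟩ -
    apply ContMDiffAt.contMDiffWithinAt
    have hsnd : ContMDiff (𝓘(ℝ, ℝ).prod 𝓘(ℝ, ℂ)) 𝓘(ℝ, ℂ) ∞ (Prod.snd : ℝ × M → M) :=
      contMDiff_snd
    by_cases hp : p ∈ φ.source
    · have hg : ContDiffOn ℝ ∞ (inCoord y φ) φ.target := by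
        have := hφ.contDiffOn (W := Set.univ) hy.contMDiffOn
        rwa [Set.preimage_univ, Set.inter_univ] at this
      have h1 : ContDiffAt ℝ ∞ (bumpVariation (inCoord y φ) η c) (t, φ p) :=
        (contDiffOn_bumpVariation (norm_inCoord y φ) hg hη).contDiffAt
          ((isOpen_univ.prod φ.open_target).mem_nhds ⟨trivial, φ.map_source hp⟩)
      have h2 : ContMDiffAt 𝓘(ℝ, ℂ) 𝓘(ℝ, ℂ) ∞ φ p :=
        contMDiffAt_of_mem_maximalAtlas hφ.mem_real_maximalAtlas hp
      have h3 : ContMDiffAt (𝓘(ℝ, ℝ).prod 𝓘(ℝ, ℂ)) 𝓘(ℝ, ℝ × ℂ) ∞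
          (fun q : ℝ × M => (q.1, φ q.2)) (t, p) :=
        ContMDiffAt.prodMk_space contMDiff_fst.contMDiffAt
          (ContMDiffAt.comp (t, p) (g := φ) h2 hsnd.contMDiffAt)
      have h4 := ContMDiffAt.comp (t, p) (g := bumpVariation (inCoord y φ) η c)
        h1.contMDiffAt h3
      refine h4.congr_of_eventuallyEq ?_
      filter_upwards [(isOpen_univ.prod φ.open_source).mem_nhds
        (show (t, p) ∈ (Set.univ : Set ℝ) ×ˢ φ.source from ⟨trivial, hp⟩)] with q hq
      exact chartVariation_of_mem hq.2 q.1
    · have hpK : p ∉ φ.symm '' tsupport η := by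
        rintro ⟨z, hz, rfl⟩
        exact hp (φ.map_target (hs hz).1)
      refine (ContMDiffAt.comp (t, p) (g := fun p => (y p : Euc n)) hy.contMDiffAt
        hsnd.contMDiffAt).congr_of_eventuallyEq ?_
      filter_upwards [(isOpen_univ.prod hK.isClosed.isOpen_compl).mem_nhds
        (show (t, p) ∈ (Set.univ : Set ℝ) ×ˢ (φ.symm '' tsupport η)ᶜ from ⟨trivial, hpK⟩)]
        with q hq
      simp only [Function.comp_apply]
      rw [chartVariation_of_notMem hq.2]
  · funext p
    exact chartVariation_of_mul_eq_zero fun _ => zero_mul _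

/-- The decomposition of a compact subset of a coordinate domain into a single piece. -/
def singleDecomposition (hφ : IsCoordinate φ) {K : Set ℂ} (hK : IsCompact K)
    (hs : K ⊆ φ.target) : CoordDecomposition (φ.symm '' K) where
  size := 1
  chart _ := φ
  piece _ := φ.symm '' K
  isCoordinate _ := hφ
  closure_subset _ := by
    rw [(hK.image_of_continuousOn (φ.continuousOn_symm.mono hs)).isClosed.closure_eq]
    rintro _ ⟨z, hz, rfl⟩
    exact φ.map_target (hs hz)
  measurable _ := by
    rw [symm_image_image hs]
    exact hK.measurableSet
  disjoint i j hij := absurd (Subsingleton.elim i j) hij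
  union := Set.iUnion_const _

lemma willmoreEnergy_singleDecomposition (hφ : IsCoordinate φ) {K : Set ℂ} (hK : IsCompact K)
    (hs : K ⊆ φ.target) (y : M → Sph n) :
    (singleDecomposition hφ hK hs).willmoreEnergy y =
      ∫ z in K, willmoreDensity (inCoord y φ) z := by
  refine (Fin.sum_univ_one (fun _ => ∫ z in φ '' (φ.symm '' K),
    willmoreDensity (inCoord y φ) z)).trans ?_
  rw [symm_image_image hs]

/-- Critical immersions have vanishing tension in every coordinate. -/
theorem surfTension_inCoord_eq_zero (hy : IsSmoothSphereMap y)
    (hW : IsConformalWillmoreImmersionOn y W) (hφ : IsCoordinate φ) {z : ℂ}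
    (hz : z ∈ φ.target ∩ φ.symm ⁻¹' W) : surfTension (inCoord y φ) 1 Complex.I z = 0 := by
  refine surfTension_eq_zero_of_critical (norm_inCoord y φ)
    (isConformalSphereImmersion_inCoord hy hW.1 hW.2.1 hφ) (fun η c hη hc hs => ?_) hz
  have hst : tsupport η ⊆ φ.target := fun z hz => (hs hz).1
  -- Criticality is available for every decomposition of the support; a single piece in the chart
  -- $\varphi$ turns the energy into one integral over $\mathbb C$.
  have key := hW.2.2 _ _ (isVariation_chartVariation (c := c) hy hφ hη hc hs)
    (singleDecomposition hφ hc hst)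
  refine key.congr_of_eventuallyEq (Filter.Eventually.of_forall fun t => ?_)
  refine Eq.trans ?_ (willmoreEnergy_singleDecomposition hφ hc hst _).symm
  refine MeasureTheory.setIntegral_congr_fun (IsCompact.measurableSet hc) fun z hz =>
    willmoreDensity_congr ?_
  filter_upwards [φ.open_target.mem_nhds (hst hz)] with w hw
  rw [inCoord, chartVariation_of_mem (φ.map_target hw), φ.right_inv hw]

end VariationOnSurface

/-! ### The Cartan realization as twice a projection minus the identity. -/

section CartanRealization

variable {n : ℕ}

lemma LorentzG.transpose_mul_form (g : LorentzG n) :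
    (LorentzG.mat g)ᵀ * lorentzForm (Sum.inl 0) * LorentzG.mat g = lorentzForm (Sum.inl 0) :=
  g.2.1

lemma LorentzG.mat_inv_mul (g : LorentzG n) : LorentzG.mat g⁻¹ * LorentzG.mat g = 1 := by
  have := LorentzG.mat_mul_inv g⁻¹
  rwa [inv_inv] at this

lemma LorentzG.form_mul_inv (g : LorentzG n) :
    lorentzForm (Sum.inl 0) * LorentzG.mat g⁻¹ = (LorentzG.mat g)ᵀ * lorentzForm (Sum.inl 0) := by
  have h := congrArg (· * LorentzG.mat g⁻¹) (LorentzG.transpose_mul_form g)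
  simp only [Matrix.mul_assoc, LorentzG.mat_mul_inv g, Matrix.mul_one] at h
  exact h.symm

lemma LorentzG.mat_inv (g : LorentzG n) : LorentzG.mat g⁻¹ =
    lorentzForm (Sum.inl 0) * ((LorentzG.mat g)ᵀ * lorentzForm (Sum.inl 0)) := by
  rw [← LorentzG.form_mul_inv g, ← Matrix.mul_assoc, lorentzForm_mul_self, Matrix.one_mul]

lemma involD_mul_self : involD n * involD n = 1 := by
  rw [involD, Matrix.fromBlocks_multiply]
  simp [Matrix.fromBlocks_one]

lemma involD_eq_diagonal : involD n = Matrix.diagonal (Sum.elim (fun _ => -1) fun _ => 1) := by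
  ext (i | i) (j | j) <;> simp [involD, Matrix.diagonal_apply, Matrix.one_apply]
  split_ifs <;> simp

lemma involD_sym : IsMinkSym (involD n) := by
  rw [IsMinkSym, involD_eq_diagonal, lorentzForm, Matrix.diagonal_transpose,
    Matrix.diagonal_mul_diagonal, Matrix.diagonal_mul_diagonal]
  congr 1
  funext i
  ring

/-- The Cartan realization of the class of `g`. -/
def cartanMat (g : LorentzG n) : Matrix (MinkIdx n) (MinkIdx n) ℝ :=
  LorentzG.mat g * involD n * LorentzG.mat g⁻¹

lemma cartan_mk (g : LorentzG n) :
    LorentzGr.cartan (QuotientGroup.mk g : LorentzGr n) = cartanMat g := rfl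

/-- Conjugation by a Lorentz matrix preserves self-adjointness, and $D$ is self-adjoint because it
is diagonal like the form. -/
lemma cartanMat_sym (g : LorentzG n) : IsMinkSym (cartanMat g) := by
  have h1 := LorentzG.form_mul_inv g
  have h2 := congrArg Matrix.transpose h1
  simp only [Matrix.transpose_mul, lorentzForm_transpose, Matrix.transpose_transpose] at h2
  have h3 : IsMinkSym (involD n) := involD_sym
  unfold IsMinkSym cartanMat at *
  rw [Matrix.transpose_mul, Matrix.transpose_mul]
  calc _ = (LorentzG.mat g⁻¹)ᵀ * ((involD n)ᵀ * ((LorentzG.mat g)ᵀ * lorentzForm (Sum.inl 0))) := by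
        simp only [Matrix.mul_assoc]
    _ = (LorentzG.mat g⁻¹)ᵀ * ((involD n)ᵀ * lorentzForm (Sum.inl 0)) * LorentzG.mat g⁻¹ := by
        rw [← h1]; simp only [Matrix.mul_assoc]
    _ = ((LorentzG.mat g⁻¹)ᵀ * lorentzForm (Sum.inl 0)) * involD n * LorentzG.mat g⁻¹ := by
        rw [h3]; simp only [Matrix.mul_assoc]
    _ = _ := by rw [h2]; simp only [Matrix.mul_assoc]

lemma cartanMat_mul_self (g : LorentzG n) : cartanMat g * cartanMat g = 1 := by
  calc _ = LorentzG.mat g * involD n * (LorentzG.mat g⁻¹ * LorentzG.mat g) * involD n *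
        LorentzG.mat g⁻¹ := by simp only [cartanMat, Matrix.mul_assoc]
    _ = LorentzG.mat g * (involD n * involD n) * LorentzG.mat g⁻¹ := by
        rw [LorentzG.mat_inv_mul g, Matrix.mul_one]; simp only [Matrix.mul_assoc]
    _ = 1 := by rw [involD_mul_self, Matrix.mul_one, LorentzG.mat_mul_inv g]

lemma trace_cartanMat (g : LorentzG n) : (cartanMat g).trace = n - 4 := by
  rw [cartanMat, Matrix.trace_mul_comm, ← Matrix.mul_assoc, LorentzG.mat_inv_mul g, Matrix.one_mul,
    involD_eq_diagonal, Matrix.trace_diagonal]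
  simp
  ring

/-- A projection onto an `n`-dimensional subspace which annihilates the first four columns of `g` is
determined by the class of `g`. -/
lemma cartanMat_eq {P : Matrix (MinkIdx n) (MinkIdx n) ℝ} (hPP : P * P = P) (hPs : IsMinkSym P)
    (htr : P.trace = n) (g : LorentzG n)
    (h : ∀ i : Fin 4, P *ᵥ (fun k => LorentzG.mat g k (Sum.inl i)) = 0) :
    cartanMat g = (2 : ℝ) • P - 1 := by
  have hD : 1 - involD n = Matrix.diagonal (Sum.elim (fun _ => 2) fun _ => 0) := by
    rw [involD_eq_diagonal, ← Matrix.diagonal_one, Matrix.diagonal_sub]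
    congr 1
    funext i
    rcases i with i | i
    · norm_num
    · simp
  -- $1-D$ is twice the coordinate projection to the first four axes, so this is the hypothesis on
  -- the columns of $g$.
  have h1 : P * LorentzG.mat g * (1 - involD n) = 0 := by
    ext k (j | j)
    · have e : (P * LorentzG.mat g) k (Sum.inl j) = 0 := congrFun (h j) k
      rw [hD, Matrix.mul_diagonal, e, zero_mul, Matrix.zero_apply]
    · rw [hD, Matrix.mul_diagonal, Sum.elim_inr, mul_zero, Matrix.zero_apply]
  have h2 : P * cartanMat g = P := by
    have h3 : P * (LorentzG.mat g * involD n) = P * LorentzG.mat g := by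
      rw [Matrix.mul_sub, Matrix.mul_one, sub_eq_zero, Matrix.mul_assoc] at h1
      exact h1.symm
    rw [cartanMat, ← Matrix.mul_assoc, h3, Matrix.mul_assoc, LorentzG.mat_mul_inv g, Matrix.mul_one]
  have h4 : cartanMat g * P = P := by
    refine matrix_ext_mulVec fun v => ?_
    rw [← sub_eq_zero]
    refine eq_zero_of_minkInner_left fun w => ?_
    rw [minkInner_sub_right, ← Matrix.mulVec_mulVec, ← (cartanMat_sym g).minkInner_mulVec,
      ← hPs.minkInner_mulVec, ← hPs.minkInner_mulVec, Matrix.mulVec_mulVec, h2, sub_self]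
  -- $\frac12(1+S)$ is the projection of rank $n$ belonging to $g$, and it absorbs $P$ on both
  -- sides. So $R$ is idempotent, of trace $n-n=0$; over $\mathbb R$ the trace of an idempotent is
  -- its rank, and $R$ vanishes.
  set R := (1 / 2 : ℝ) • (1 + cartanMat g) - P with hR
  have hRR : R * R = R := by
    rw [hR]
    simp only [Matrix.sub_mul, Matrix.mul_sub, Matrix.smul_mul, Matrix.mul_smul, Matrix.add_mul,
      Matrix.mul_add, Matrix.one_mul, Matrix.mul_one, cartanMat_mul_self, h2, h4, hPP]
    module
  have hRt : R.trace = 0 := by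
    rw [hR, Matrix.trace_sub, Matrix.trace_smul, Matrix.trace_add, trace_cartanMat, htr,
      Matrix.trace_one]
    simp
    ring
  have hR0 : R = 0 := by
    have hi : IsIdempotentElem (Matrix.toLin' R) := by
      change Matrix.toLin' R ∘ₗ Matrix.toLin' R = Matrix.toLin' R
      rw [← Matrix.toLin'_mul, hRR]
    have := (LinearMap.IsIdempotentElem.trace_eq_zero_iff hi).1 (by
      rw [Matrix.trace_toLin'_eq, hRt])
    simpa using this
  rw [sub_eq_zero] at hR0
  rw [← hR0, smul_smul]
  norm_num

end CartanRealization

/-! ### The conformal Gauss map in terms of the projection field. -/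

section GaussMap

variable {n : ℕ}

namespace IsConformalSphereImmersion

variable {g : ℂ → Euc n} {s : Set ℂ} (h : IsConformalSphereImmersion g 1 Complex.I s) {z : ℂ}
include h

lemma norm_dU_ne_zero (hz : z ∈ s) : ‖dU g z‖ ≠ 0 := fun h0 => by
  have := h.metE_pos hz
  rw [real_inner_self_eq_norm_sq, ← dU_eq_dirD, h0] at this
  simp at this

lemma smooth_inv_norm_dU : ContDiffOn ℝ ∞ (fun w => ‖dU g w‖⁻¹) s :=
  ((h.smooth_dirD 1).norm ℝ fun _ hw => norm_ne_zero_iff.1 (h.norm_dU_ne_zero hw)).inv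
    fun _ hw => h.norm_dU_ne_zero hw

lemma dirD_canonicalLift (hz : z ∈ s) (d : ℂ) : dirD d (canonicalLift g) z =
    dirD d (fun w => ‖dU g w‖⁻¹) z • coneLift (g z) + ‖dU g z‖⁻¹ • spaceEmb (dirD d g z) := by
  unfold canonicalLift
  rw [dirD_smul (h.smooth_inv_norm_dU.differentiableAt_of_isOpen h.isOpen hz)
    (h.smooth_coneLift.differentiableAt_of_isOpen h.isOpen hz), h.dirD_coneLift hz]

/-- Derivatives of the scaling factor only produce multiples of $Y$ and $y_d$, which $P$
annihilates. This is why the canonical lift and $(1,y)$ lead to the same plane. -/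
lemma surfProj_dirD_dirD_canonicalLift (hz : z ∈ s) {d : ℂ}
    (hd : surfProj g 1 Complex.I z *ᵥ spaceEmb (dirD d g z) = 0) :
    surfProj g 1 Complex.I z *ᵥ dirD d (dirD d (canonicalLift g)) z =
      ‖dU g z‖⁻¹ • surfProj g 1 Complex.I z *ᵥ spaceEmb (dirD d (dirD d g) z) := by
  have hρ := h.smooth_inv_norm_dU
  have hρd := hρ.dirD h.isOpen d
  have hgd := contDiffOn_linear spaceEmb (h.smooth_dirD d)
  have h1 : DifferentiableAt ℝ (fun w => dirD d (fun w => ‖dU g w‖⁻¹) w • coneLift (g w)) z :=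
    (hρd.smul h.smooth_coneLift).differentiableAt_of_isOpen h.isOpen hz
  have h2 : DifferentiableAt ℝ (fun w => ‖dU g w‖⁻¹ • spaceEmb (dirD d g w)) z :=
    (hρ.smul hgd).differentiableAt_of_isOpen h.isOpen hz
  rw [dirD_congr_of_isOpen h.isOpen (fun w hw => h.dirD_canonicalLift hw d) d hz, dirD_add h1 h2,
    dirD_smul (hρd.differentiableAt_of_isOpen h.isOpen hz)
      (h.smooth_coneLift.differentiableAt_of_isOpen h.isOpen hz),
    dirD_smul (hρ.differentiableAt_of_isOpen h.isOpen hz)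
      (hgd.differentiableAt_of_isOpen h.isOpen hz), h.dirD_coneLift hz,
    dirD_linear spaceEmb (h.differentiableAt_dirD hz d)]
  simp only [Matrix.mulVec_add, Matrix.mulVec_smul, h.surfProj_coneLift hz, hd, smul_zero,
    zero_add, add_zero]

/-- The projection annihilates the fibre of the conformal Gauss map. -/
lemma surfProj_gaussBasis (hz : z ∈ s) (j : Fin 4) :
    surfProj g 1 Complex.I z *ᵥ gaussBasis g z j = 0 := by
  have ha := h.surfProj_a hz
  have hb := h.surfProj_b hz
  have h0 : surfProj g 1 Complex.I z *ᵥ canonicalLift g z = 0 := by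
    rw [canonicalLift, Matrix.mulVec_smul, h.surfProj_coneLift hz, smul_zero]
  have h1 : ∀ d, surfProj g 1 Complex.I z *ᵥ spaceEmb (dirD d g z) = 0 →
      surfProj g 1 Complex.I z *ᵥ dirD d (canonicalLift g) z = 0 := fun d hd => by
    rw [h.dirD_canonicalLift hz, Matrix.mulVec_add, Matrix.mulVec_smul, Matrix.mulVec_smul,
      h.surfProj_coneLift hz, hd, smul_zero, smul_zero, add_zero]
  have h2 : surfProj g 1 Complex.I z *ᵥ flatLaplacian (canonicalLift g) z = 0 := by
    change surfProj g 1 Complex.I z *ᵥ (dirD 1 (dirD 1 (canonicalLift g)) z +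
      dirD Complex.I (dirD Complex.I (canonicalLift g)) z) = 0
    rw [Matrix.mulVec_add,
      h.surfProj_dirD_dirD_canonicalLift hz ha, h.surfProj_dirD_dirD_canonicalLift hz hb,
      h.surfProj_second hz, smul_neg, add_neg_cancel]
  fin_cases j
  · exact h0
  · change surfProj g 1 Complex.I z *ᵥ lightlikeN g z = 0
    rw [lightlikeN, Matrix.mulVec_add, Matrix.mulVec_smul, Matrix.mulVec_smul, h0, h2, smul_zero,
      smul_zero, add_zero]
  · exact h1 1 ha
  · exact h1 Complex.I hb

/-- The Cartan realization of the conformal Gauss map. -/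
lemma cartanMat_eq_surfProj (hz : z ∈ s) (k : LorentzG n)
    (hk : SameOrientedSpan (fun (i : Fin 4) l => LorentzG.mat k l (Sum.inl i)) (gaussBasis g z)) :
    cartanMat k = (2 : ℝ) • surfProj g 1 Complex.I z - 1 := by
  refine cartanMat_eq (h.surfProj_mul_self hz) IsSphereImmersion.surfProj_sym
    (h.isNullFrame hz).trace_coProj k fun m => ?_
  obtain ⟨C, hC, hb⟩ := hk
  have hC' : C * C⁻¹ = 1 := Matrix.mul_nonsing_inv C (isUnit_iff_ne_zero.2 hC.ne')
  -- Inverting $C$ expresses the columns of the frame in the basis $Y, N, Y_u, Y_v$, all of whose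
  -- members are annihilated by $P$.
  have e : (fun l => LorentzG.mat k l (Sum.inl m)) = ∑ j, C⁻¹ j m • gaussBasis g z j := by
    simp only [hb, Finset.smul_sum, smul_smul]
    rw [Finset.sum_comm]
    simp only [← Finset.sum_smul]
    have : ∀ i, ∑ j, C⁻¹ j m * C i j = (1 : Matrix (Fin 4) (Fin 4) ℝ) i m := fun i => by
      rw [← hC', Matrix.mul_apply]
      exact Finset.sum_congr rfl fun j _ => mul_comm _ _
    simp only [this, Matrix.one_apply, ite_smul, one_smul, zero_smul, Finset.sum_ite_eq',
      Finset.mem_univ, if_true]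
  rw [e, Matrix.mulVec_sum]
  exact Finset.sum_eq_zero fun j _ => by
    rw [Matrix.mulVec_smul, h.surfProj_gaussBasis hz, smul_zero]

end IsConformalSphereImmersion

end GaussMap

/-! ### Passage between matrix fields and their entries. -/

section MatrixFields

variable {X : Type*} [NormedAddCommGroup X] [NormedSpace ℝ X] {n : ℕ}
  {A : X → Matrix (MinkIdx n) (MinkIdx n) ℝ} {s : Set X} {x : X}

lemma dirD_entry (hA : DifferentiableAt ℝ A x) (d : X) (i j : MinkIdx n) :
    dirD d (fun y => A y i j) x = dirD d A x i j :=
  dirD_linear (Matrix.entryLinearMap ℝ ℝ i j) hA d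

lemma contDiffOn_of_entries (h : ∀ i j, ContDiffOn ℝ ∞ (fun y => A y i j) s) :
    ContDiffOn ℝ ∞ A s :=
  contDiffOn_pi.2 fun i => contDiffOn_pi.2 fun j => h i j

end MatrixFields

/-! ### Frames, smoothness of the Cartan realization, and blocks of the Maurer-Cartan form. -/

section GrassmannianMaps

variable {M : Type*} [TopologicalSpace M] [ChartedSpace ℂ M] {n : ℕ} {f : M → LorentzGr n}
  {F : M → LorentzG n} {U : Set M} {φ : OpenPartialHomeomorph M ℂ}

lemma IsFrameOn.contDiffOn_mat (hF : IsFrameOn f F U) (hφ : IsCoordinate φ) :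
    ContDiffOn ℝ ∞ (fun z => LorentzG.mat (F (φ.symm z))) (φ.target ∩ φ.symm ⁻¹' U) :=
  contDiffOn_of_entries fun i j => hφ.contDiffOn (hF.1 i j)

/-- For a Lorentz matrix the inverse $J F^t J$ is linear in $F$. -/
lemma IsFrameOn.contDiffOn_mat_inv (hF : IsFrameOn f F U) (hφ : IsCoordinate φ) :
    ContDiffOn ℝ ∞ (fun z => LorentzG.mat (F (φ.symm z))⁻¹) (φ.target ∩ φ.symm ⁻¹' U) := by
  simp only [LorentzG.mat_inv]
  exact contDiffOn_linear (LinearMap.mulLeft ℝ (lorentzForm (Sum.inl 0)) ∘ₗ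
    LinearMap.mulRight ℝ (lorentzForm (Sum.inl 0)) ∘ₗ
    (Matrix.transposeLinearEquiv (MinkIdx n) (MinkIdx n) ℝ ℝ).toLinearMap) (hF.contDiffOn_mat hφ)

lemma IsFrameOn.cartan_eq (hF : IsFrameOn f F U) {p : M} (hp : p ∈ U) :
    LorentzGr.cartan (f p) = cartanMat (F p) := by
  rw [← hF.2 p hp, cartan_mk]

/-- The Cartan realization of a smooth map is smooth. -/
lemma IsSmoothGrMap.contDiffOn_cartan (hf : IsSmoothGrMap f) (hφ : IsCoordinate φ) :
    ContDiffOn ℝ ∞ (fun z => LorentzGr.cartan (f (φ.symm z))) φ.target := by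
  intro z hz
  obtain ⟨U, hU, hzU, F, hF⟩ := hf (φ.symm z)
  have ho := φ.isOpen_inter_preimage_symm hU
  have hm := hF.contDiffOn_mat hφ
  have h1 : ContDiffOn ℝ ∞ (fun z => LorentzG.mat (F (φ.symm z)) * involD n *
      LorentzG.mat (F (φ.symm z))⁻¹) (φ.target ∩ φ.symm ⁻¹' U) :=
    contDiffOn_bilinear (LinearMap.mul ℝ (Matrix (MinkIdx n) (MinkIdx n) ℝ))
      (contDiffOn_linear (LinearMap.mulRight ℝ (involD n)) hm) (hF.contDiffOn_mat_inv hφ)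
  have h2 := h1.congr fun w hw => hF.cartan_eq hw.2
  exact (h2.contDiffAt (ho.mem_nhds ⟨hz, hzU⟩)).contDiffWithinAt

lemma cartanLaplacian_eq (hf : IsSmoothGrMap f) (hφ : IsCoordinate φ) {z : ℂ}
    (hz : z ∈ φ.target) : cartanLaplacian f φ z =
      dirLap 1 Complex.I (fun w => LorentzGr.cartan (f (φ.symm w))) z := by
  have hS := hf.contDiffOn_cartan hφ
  have key : ∀ (d : ℂ) i j, dirD d (dirD d fun w => LorentzGr.cartan (f (φ.symm w)) i j) z =
      dirD d (dirD d fun w => LorentzGr.cartan (f (φ.symm w))) z i j := fun d i j => by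
    rw [dirD_congr_of_isOpen φ.open_target (fun w hw =>
      dirD_entry (hS.differentiableAt_of_isOpen φ.open_target hw) d i j) d hz]
    exact dirD_entry ((hS.dirD φ.open_target d).differentiableAt_of_isOpen φ.open_target hz) d i j
  ext i j
  rw [cartanLaplacian, Matrix.of_apply, dirLap, Matrix.add_apply, ← key, ← key]
  rfl

omit [ChartedSpace ℂ M] in
/-- A continuous function on a coordinate domain vanishes if it does so on a dense set. -/
lemma eq_zero_of_dense {L : Set M} (hL : Dense L) {E : Type*} [TopologicalSpace E] [T1Space E]
    [Zero E] {u : ℂ → E} (hu : ContinuousOn u φ.target)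
    (h0 : ∀ z ∈ φ.target, φ.symm z ∈ L → u z = 0) {z : ℂ} (hz : z ∈ φ.target) : u z = 0 := by
  by_contra hne
  have h1 : IsOpen (φ.target ∩ u ⁻¹' {0}ᶜ) :=
    hu.isOpen_inter_preimage φ.open_target isOpen_compl_singleton
  have h2 := φ.isOpen_inter_preimage h1
  obtain ⟨p, hp, hpL⟩ := hL.inter_open_nonempty _ h2 ⟨φ.symm z, φ.map_target hz, by
    rw [Set.mem_preimage, φ.right_inv hz]; exact ⟨hz, hne⟩⟩
  exact hp.2.2 (h0 _ hp.2.1 (by rwa [φ.left_inv hp.1]))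

/-- The part of `F⁻¹ dF` which is recovered from the Cartan realization. -/
lemma conj_dirD_cartan {z : ℂ} {s : Set ℂ} (ho : IsOpen s) (hz : z ∈ s)
    {S A : ℂ → Matrix (MinkIdx n) (MinkIdx n) ℝ} {B : Matrix (MinkIdx n) (MinkIdx n) ℝ}
    (hS : DifferentiableAt ℝ S z) (hA : DifferentiableAt ℝ A z) (hBA : B * A z = 1)
    (h : ∀ w ∈ s, S w * A w = A w * involD n) (d : ℂ) :
    B * dirD d S z * A z = B * dirD d A z * involD n - involD n * (B * dirD d A z) := by
  have hAB : A z * B = 1 := mul_eq_one_comm.1 hBA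
  -- Differentiating $SA=AD$ gives $S_dA=A_dD-SA_d$. Multiplication by $B=A^{-1}$ with $BS=DB$ then
  -- yields the commutator of $A^{-1}A_d$ with $D$.
  have h1 : dirD d (fun w => S w * A w) z =
      dirD d (fun w => LinearMap.mulRight ℝ (involD n) (A w)) z :=
    dirD_congr_of_isOpen ho h d hz
  rw [dirD_mul hS hA, dirD_linear _ hA, LinearMap.mulRight_apply] at h1
  have h2 : B * S z = involD n * B := by
    calc B * S z = B * (S z * A z) * B := by rw [Matrix.mul_assoc, Matrix.mul_assoc, hAB,
          Matrix.mul_one]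
      _ = B * A z * involD n * B := by rw [h z hz]; simp only [Matrix.mul_assoc]
      _ = _ := by rw [hBA, Matrix.one_mul]
  rw [Matrix.mul_assoc, eq_sub_of_add_eq h1, Matrix.mul_sub, ← Matrix.mul_assoc,
    ← Matrix.mul_assoc B (S z), h2, Matrix.mul_assoc (involD n)]

/-- The off-diagonal blocks of a Lie algebra element determine each other. -/
lemma toBlocks₂₁_of_skew {A : Matrix (MinkIdx n) (MinkIdx n) ℝ}
    (hA : Aᵀ * lorentzForm (Sum.inl 0) + lorentzForm (Sum.inl 0) * A = 0) :
    A.toBlocks₂₁ = -(A.toBlocks₁₂ᵀ * lorentzForm (0 : Fin 4)) := by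
  ext i j
  have h := congrFun (congrFun hA (Sum.inr i)) (Sum.inl j)
  simp only [lorentzForm, Matrix.add_apply, Matrix.mul_diagonal, Matrix.diagonal_mul,
    Matrix.transpose_apply, Matrix.zero_apply, reduceCtorEq, if_false, one_mul, Sum.inl.injEq] at h
  simp only [lorentzForm, Matrix.neg_apply, Matrix.mul_diagonal, Matrix.transpose_apply,
    Matrix.toBlocks₂₁, Matrix.toBlocks₁₂, Matrix.of_apply]
  linarith

/-- The lower right block of the product of two conjugated derivatives. -/
lemma conj_block_product (A B : Matrix (MinkIdx n) (MinkIdx n) ℝ) :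
    (1 + involD n) * (A * involD n - involD n * A) * (B * involD n - involD n * B) *
      (1 + involD n) = Matrix.fromBlocks 0 0 0 (-(16 : ℝ) • (A.toBlocks₂₁ * B.toBlocks₁₂)) := by
  have h1 : (1 + involD n) = Matrix.fromBlocks 0 0 0 ((2 : ℝ) • 1) := by
    rw [involD, ← Matrix.fromBlocks_one, Matrix.fromBlocks_add]
    congr 1
    · simp
    · simp
    · simp
    · rw [two_smul]
  -- The commutator with $D$ keeps the off-diagonal blocks only, with factors $2$ and $-2$. Together
  -- with the factor 2 of each $1+D$ this accounts for $-16$.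
  have h2 : ∀ C : Matrix (MinkIdx n) (MinkIdx n) ℝ, C * involD n - involD n * C =
      Matrix.fromBlocks 0 ((2 : ℝ) • C.toBlocks₁₂) (-(2 : ℝ) • C.toBlocks₂₁) 0 := fun C => by
    conv_lhs => rw [← Matrix.fromBlocks_toBlocks C]
    rw [involD, Matrix.fromBlocks_multiply, Matrix.fromBlocks_multiply]
    ext (i | i) (j | j) <;> simp <;> ring
  rw [h1, h2, h2]
  simp only [Matrix.fromBlocks_multiply, Matrix.zero_mul, Matrix.mul_zero, add_zero, zero_add,
    Matrix.smul_mul, Matrix.mul_smul, Matrix.one_mul, Matrix.mul_one, smul_zero, smul_smul]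
  congr 1
  module

end GrassmannianMaps

/-! ### Harmonicity and strong conformality of the extended conformal Gauss map. -/

section ConformalGaussMap

variable {M : Type*} [TopologicalSpace M] [ChartedSpace ℂ M] {n : ℕ} {y : M → Sph n}
  {f : M → LorentzGr n} {F : M → LorentzG n} {U : Set M} {φ : OpenPartialHomeomorph M ℂ} {z : ℂ}

lemma dense_willmoreLocus (hy : IsWillmoreMap y) : Dense (willmoreLocus y) := by
  obtain ⟨-, W, hW, h⟩ := hy
  exact hW.mono (Set.subset_sUnion_of_mem h)

/-- Near an immersed point the Cartan realization of the conformal Gauss map is given by the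
projection field of the surface. -/
lemma exists_conformalSphereImmersion [T2Space M] (hy : IsSmoothSphereMap y)
    (hf : IsExtendedConformalGaussMap y f) (hφ : IsCoordinate φ) (hz : z ∈ φ.target)
    (hzL : φ.symm z ∈ willmoreLocus y) :
    ∃ s, z ∈ s ∧ IsConformalSphereImmersion (inCoord y φ) 1 Complex.I s ∧
      surfTension (inCoord y φ) 1 Complex.I z = 0 ∧ ∀ w ∈ s,
        LorentzGr.cartan (f (φ.symm w)) = (2 : ℝ) • surfProj (inCoord y φ) 1 Complex.I w - 1 := by
  obtain ⟨W, hW, hzW⟩ := hzL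
  have hc := isConformalSphereImmersion_inCoord hy hW.1 hW.2.1 hφ
  refine ⟨φ.target ∩ φ.symm ⁻¹' W, ⟨hz, hzW⟩, hc,
    surfTension_inCoord_eq_zero hy hW hφ ⟨hz, hzW⟩, fun w hw => ?_⟩
  obtain ⟨k, hk⟩ := QuotientGroup.mk_surjective (f (φ.symm w))
  rw [← hk, cartan_mk]
  refine hc.cartanMat_eq_surfProj hw k ?_
  have := hf.2 φ hφ (φ.symm w) ⟨φ.map_target hw.1, W, hW, hw.2⟩ k hk
  rwa [φ.right_inv hw.1] at this

lemma dirD_two_smul_sub_one {S P : ℂ → Matrix (MinkIdx n) (MinkIdx n) ℝ} {s : Set ℂ}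
    (hs : IsOpen s) (hP : ContDiffOn ℝ ∞ P s) (h : ∀ w ∈ s, S w = (2 : ℝ) • P w - 1) (d : ℂ)
    (hz : z ∈ s) : dirD d S z = (2 : ℝ) • dirD d P z := by
  have hd := hP.differentiableAt_of_isOpen hs hz
  rw [dirD_congr_of_isOpen hs h d hz, dirD_sub (f := fun w => (2 : ℝ) • P w)
    (hd.const_smul (2 : ℝ)) (differentiableAt_const _), dirD_const, sub_zero]
  exact dirD_linear (LinearMap.lsmul ℝ (Matrix (MinkIdx n) (MinkIdx n) ℝ) (2 : ℝ)) hd d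

lemma dirLap_two_smul_sub_one {S P : ℂ → Matrix (MinkIdx n) (MinkIdx n) ℝ} {s : Set ℂ}
    (hs : IsOpen s) (hP : ContDiffOn ℝ ∞ P s) (h : ∀ w ∈ s, S w = (2 : ℝ) • P w - 1) (a b : ℂ)
    (hz : z ∈ s) : dirLap a b S z = (2 : ℝ) • dirLap a b P z := by
  have key : ∀ d, dirD d (dirD d S) z = (2 : ℝ) • dirD d (dirD d P) z := fun d => by
    rw [dirD_congr_of_isOpen hs (fun w hw => dirD_two_smul_sub_one hs hP h d hw) d hz]
    exact dirD_linear (LinearMap.lsmul ℝ (Matrix (MinkIdx n) (MinkIdx n) ℝ) (2 : ℝ))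
      ((hP.dirD hs d).differentiableAt_of_isOpen hs hz) d
  rw [dirLap, key, key, ← smul_add]
  rfl

/-- The extended conformal Gauss map is harmonic. -/
lemma IsExtendedConformalGaussMap.isHarmonicGrMap [T2Space M] (hy : IsWillmoreMap y)
    (hf : IsExtendedConformalGaussMap y f) : IsHarmonicGrMap f := by
  refine ⟨hf.1, fun φ hφ z hz X _ => ?_⟩
  have hS := hf.1.contDiffOn_cartan hφ
  have hL : ContDiffOn ℝ ∞ (dirLap 1 Complex.I fun w => LorentzGr.cartan (f (φ.symm w))) φ.target :=
    ((hS.dirD φ.open_target 1).dirD φ.open_target 1).add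
      ((hS.dirD φ.open_target Complex.I).dirD φ.open_target Complex.I)
  have hu := contDiffOn_bilinear (tracePairing n)
    ((contDiffOn_linear (LinearMap.mulLeft ℝ X) hS).sub
      (contDiffOn_linear (LinearMap.mulRight ℝ X) hS)) hL
  rw [cartanLaplacian_eq hf.1 hφ hz]
  -- The trace is continuous on the whole coordinate domain, branch points included, because $S$ is
  -- smooth there. It suffices to treat immersed points.
  refine eq_zero_of_dense (dense_willmoreLocus hy) hu.continuousOn (fun w hw hwL => ?_) hz
  obtain ⟨s, hws, hc, h0, hSs⟩ := exists_conformalSphereImmersion hy.1 hf hφ hw hwL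
  have hcomm := hc.surfProj_comm_dirLap hws h0
  change ((X * LorentzGr.cartan (f (φ.symm w)) - LorentzGr.cartan (f (φ.symm w)) * X) *
    dirLap 1 Complex.I (fun w => LorentzGr.cartan (f (φ.symm w))) w).trace = 0
  rw [dirLap_two_smul_sub_one hc.isOpen hc.smooth_surfProj hSs 1 Complex.I hws, hSs w hws]
  generalize surfProj (inCoord y φ) 1 Complex.I w = P at *
  generalize dirLap 1 Complex.I (surfProj (inCoord y φ) 1 Complex.I) w = L at *
  -- With $S=2P-1$ and $\Delta S=2L$ the trace equals $4\,\mathrm{tr}(X[P,L])$, which vanishes since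
  -- $P$ commutes with its Laplacian.
  have e : (X * ((2 : ℝ) • P - 1) - ((2 : ℝ) • P - 1) * X) * ((2 : ℝ) • L) =
      (4 : ℝ) • (X * (P * L) - P * X * L) := by
    simp only [Matrix.mul_sub, Matrix.sub_mul, Matrix.mul_smul, Matrix.smul_mul, Matrix.mul_one,
      Matrix.one_mul, Matrix.mul_assoc]
    module
  rw [e, Matrix.trace_smul, Matrix.trace_sub, hcomm, Matrix.mul_assoc P X L, Matrix.trace_mul_comm P,
    Matrix.mul_assoc, sub_self, smul_zero]

/-- The second order relations which express strong conformality in terms of the Cartan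
realization. -/
lemma IsExtendedConformalGaussMap.cartan_relations [T2Space M] (hy : IsWillmoreMap y)
    (hf : IsExtendedConformalGaussMap y f) (hφ : IsCoordinate φ) (hz : z ∈ φ.target)
    {S : ℂ → Matrix (MinkIdx n) (MinkIdx n) ℝ}
    (hS : S = fun w => LorentzGr.cartan (f (φ.symm w))) :
    (1 + S z) * dirD 1 S z * dirD 1 S z * (1 + S z) -
      (1 + S z) * dirD Complex.I S z * dirD Complex.I S z * (1 + S z) = 0 ∧
    (1 + S z) * dirD 1 S z * dirD Complex.I S z * (1 + S z) +
      (1 + S z) * dirD Complex.I S z * dirD 1 S z * (1 + S z) = 0 := by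
  have hSs : ContDiffOn ℝ ∞ S φ.target := hS ▸ hf.1.contDiffOn_cartan hφ
  have hmul : ∀ {A B : ℂ → Matrix (MinkIdx n) (MinkIdx n) ℝ}, ContDiffOn ℝ ∞ A φ.target →
      ContDiffOn ℝ ∞ B φ.target → ContDiffOn ℝ ∞ (fun w => A w * B w) φ.target :=
    fun hA hB => contDiffOn_bilinear (LinearMap.mul ℝ (Matrix (MinkIdx n) (MinkIdx n) ℝ)) hA hB
  have h1 : ContDiffOn ℝ ∞ (fun w => 1 + S w) φ.target := contDiffOn_const.add hSs
  have hd := hSs.dirD φ.open_target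
  have hq : ∀ c d, ContDiffOn ℝ ∞ (fun w => (1 + S w) * dirD c S w * dirD d S w * (1 + S w))
      φ.target := fun c d => hmul (hmul (hmul h1 (hd c)) (hd d)) h1
  have hrel : ∀ w ∈ φ.target, φ.symm w ∈ willmoreLocus y →
      ∃ P A B : Matrix (MinkIdx n) (MinkIdx n) ℝ, 1 + S w = (2 : ℝ) • P ∧
        dirD 1 S w = (2 : ℝ) • A ∧ dirD Complex.I S w = (2 : ℝ) • B ∧
        P * A * A * P = P * B * B * P ∧ P * A * B * P = -(P * B * A * P) := fun w hw hwL => by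
    obtain ⟨s, hws, hc, -, hs⟩ := exists_conformalSphereImmersion hy.1 hf hφ hw hwL
    have hs' : ∀ w ∈ s, S w = (2 : ℝ) • surfProj (inCoord y φ) 1 Complex.I w - 1 := by
      rw [hS]; exact hs
    refine ⟨_, _, _, ?_, dirD_two_smul_sub_one hc.isOpen hc.smooth_surfProj hs' 1 hws,
      dirD_two_smul_sub_one hc.isOpen hc.smooth_surfProj hs' Complex.I hws,
      hc.strongly_conformal hws⟩
    rw [hs' w hws, add_sub_cancel]
  constructor
  · refine eq_zero_of_dense (dense_willmoreLocus hy) ((hq 1 1).sub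
      (hq Complex.I Complex.I)).continuousOn (fun w hw hwL => ?_) hz
    obtain ⟨P, A, B, hP, hA, hB, h, -⟩ := hrel w hw hwL
    simp only [hP, hA, hB, Matrix.mul_smul, Matrix.smul_mul, h, sub_self]
  · refine eq_zero_of_dense (dense_willmoreLocus hy) ((hq 1 Complex.I).add
      (hq Complex.I 1)).continuousOn (fun w hw hwL => ?_) hz
    obtain ⟨P, A, B, hP, hA, hB, -, h⟩ := hrel w hw hwL
    simp only [hP, hA, hB, Matrix.mul_smul, Matrix.smul_mul, h, smul_neg, neg_add_cancel]

/-- The Maurer-Cartan form of a frame takes values in the Lie algebra. -/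
lemma IsFrameOn.inv_mul_dirD_skew (hF : IsFrameOn f F U) (hU : IsOpen U) (hφ : IsCoordinate φ)
    (hz : z ∈ φ.target ∩ φ.symm ⁻¹' U) (d : ℂ) {X : Matrix (MinkIdx n) (MinkIdx n) ℝ}
    (hX : X = LorentzG.mat (F (φ.symm z))⁻¹ *
      dirD d (fun w => LorentzG.mat (F (φ.symm w))) z) :
    Xᵀ * lorentzForm (Sum.inl 0) + lorentzForm (Sum.inl 0) * X = 0 := by
  have hA := (hF.contDiffOn_mat hφ).differentiableAt_of_isOpen (φ.isOpen_inter_preimage_symm hU) hz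
  let T := (Matrix.transposeLinearEquiv (MinkIdx n) (MinkIdx n) ℝ ℝ).toLinearMap
  let J := LinearMap.mulLeft ℝ (lorentzForm (Sum.inl 0 : MinkIdx n))
  have hT : DifferentiableAt ℝ (fun w => T (LorentzG.mat (F (φ.symm w)))) z :=
    T.toContinuousLinearMap.differentiableAt.comp z hA
  have hJ : DifferentiableAt ℝ (fun w => J (LorentzG.mat (F (φ.symm w)))) z :=
    J.toContinuousLinearMap.differentiableAt.comp z hA
  have h1 : (fun w => T (LorentzG.mat (F (φ.symm w))) * J (LorentzG.mat (F (φ.symm w)))) =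
      fun _ => lorentzForm (Sum.inl 0) := funext fun w => by
    rw [← LorentzG.transpose_mul_form (F (φ.symm w)), Matrix.mul_assoc]
    rfl
  have h2 := dirD_mul hT hJ d
  rw [h1, dirD_const, dirD_linear T hA, dirD_linear J hA] at h2
  have h3 := LorentzG.form_mul_inv (F (φ.symm z))
  have h4 := congrArg Matrix.transpose h3
  simp only [Matrix.transpose_mul, lorentzForm_transpose, Matrix.transpose_transpose] at h4
  rw [hX, Matrix.transpose_mul, Matrix.mul_assoc, h4, ← Matrix.mul_assoc (lorentzForm _), h3,
    Matrix.mul_assoc (LorentzG.mat _)ᵀ]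
  exact h2.symm

/-- The relation lives in the lower right block by `conj_block_product`. Skewness expresses the
lower left blocks through the upper right ones, which brings in $I_{1,3}$ and cancels the sign of
$-16$. -/
lemma toBlocks₁₂_relation {A B C D : Matrix (MinkIdx n) (MinkIdx n) ℝ} (c : ℝ)
    (hA : Aᵀ * lorentzForm (Sum.inl 0) + lorentzForm (Sum.inl 0) * A = 0)
    (hC : Cᵀ * lorentzForm (Sum.inl 0) + lorentzForm (Sum.inl 0) * C = 0)
    (h : (1 + involD n) * (A * involD n - involD n * A) * (B * involD n - involD n * B) *
      (1 + involD n) + c • ((1 + involD n) * (C * involD n - involD n * C) *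
        (D * involD n - involD n * D) * (1 + involD n)) = 0) :
    A.toBlocks₁₂ᵀ * lorentzForm (0 : Fin 4) * B.toBlocks₁₂ +
      c • (C.toBlocks₁₂ᵀ * lorentzForm (0 : Fin 4) * D.toBlocks₁₂) = 0 := by
  rw [conj_block_product, conj_block_product, Matrix.fromBlocks_smul, Matrix.fromBlocks_add,
    toBlocks₂₁_of_skew hA, toBlocks₂₁_of_skew hC, ← Matrix.fromBlocks_zero,
    Matrix.fromBlocks_inj] at h
  have h2 := h.2.2.2
  have : (16 : ℝ) • (A.toBlocks₁₂ᵀ * lorentzForm (0 : Fin 4) * B.toBlocks₁₂ +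
      c • (C.toBlocks₁₂ᵀ * lorentzForm (0 : Fin 4) * D.toBlocks₁₂)) = 0 := by
    rw [← h2]
    simp only [Matrix.neg_mul]
    module
  exact (smul_eq_zero.1 this).resolve_left (by norm_num)

/-- Every frame of the extended conformal Gauss map satisfies `B₁ᵗ I_{1,3} B₁ = 0`. -/
lemma IsExtendedConformalGaussMap.blockB_isotropic [T2Space M] (hy : IsWillmoreMap y)
    (hf : IsExtendedConformalGaussMap y f) (hF : IsFrameOn f F U) (hU : IsOpen U)
    (hφ : IsCoordinate φ) (hz : z ∈ φ.target ∩ φ.symm ⁻¹' U) :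
    (blockB F φ z)ᵀ * (lorentzForm (0 : Fin 4)).map Complex.ofReal * blockB F φ z = 0 := by
  have ho := φ.isOpen_inter_preimage_symm hU
  have hA := (hF.contDiffOn_mat hφ).differentiableAt_of_isOpen ho hz
  obtain ⟨S, hS⟩ : ∃ S : ℂ → Matrix (MinkIdx n) (MinkIdx n) ℝ,
    S = fun w => LorentzGr.cartan (f (φ.symm w)) := ⟨_, rfl⟩
  obtain ⟨A, hAe⟩ : ∃ A : ℂ → Matrix (MinkIdx n) (MinkIdx n) ℝ,
    A = fun w => LorentzG.mat (F (φ.symm w)) := ⟨_, rfl⟩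
  obtain ⟨B, hB⟩ : ∃ B, B = LorentzG.mat (F (φ.symm z))⁻¹ := ⟨_, rfl⟩
  have hSd : DifferentiableAt ℝ S z :=
    hS ▸ (hf.1.contDiffOn_cartan hφ).differentiableAt_of_isOpen φ.open_target hz.1
  have hBA : B * A z = 1 := by rw [hB, hAe]; exact LorentzG.mat_inv_mul _
  have hAB : A z * B = 1 := mul_eq_one_comm.1 hBA
  have hSA : ∀ w ∈ φ.target ∩ φ.symm ⁻¹' U, S w * A w = A w * involD n := fun w hw => by
    simp only [hS, hAe]
    rw [hF.cartan_eq hw.2, cartanMat, Matrix.mul_assoc, LorentzG.mat_inv_mul, Matrix.mul_one]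
  have hconj := conj_dirD_cartan ho hz hSd (hAe ▸ hA) hBA hSA
  have hskew : ∀ d, (B * dirD d A z)ᵀ * lorentzForm (Sum.inl 0) +
      lorentzForm (Sum.inl 0) * (B * dirD d A z) = 0 := fun d =>
    hF.inv_mul_dirD_skew hU hφ hz d (by rw [hB, hAe])
  have h1S : B * (1 + S z) * A z = 1 + involD n := by
    rw [Matrix.mul_assoc, Matrix.add_mul, hSA z hz, Matrix.mul_add, Matrix.one_mul, hBA,
      ← Matrix.mul_assoc, hBA, Matrix.one_mul]
  -- Conjugation by the frame carries $1+S$ to $1+D$ and each derivative of $S$ to a commutator with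
  -- $D$, so the relations for $S$ become block relations for $F^{-1}F_u$ and $F^{-1}F_v$.
  have hprod : ∀ c d, (1 + involD n) *
      (B * dirD c A z * involD n - involD n * (B * dirD c A z)) *
      (B * dirD d A z * involD n - involD n * (B * dirD d A z)) * (1 + involD n) =
      B * ((1 + S z) * dirD c S z * dirD d S z * (1 + S z)) * A z := fun c d => by
    rw [← hconj c, ← hconj d, ← h1S]
    have e : ∀ Y : Matrix (MinkIdx n) (MinkIdx n) ℝ, A z * (B * Y) = Y := fun Y => by
      rw [← Matrix.mul_assoc, hAB, Matrix.one_mul]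
    simp only [Matrix.mul_assoc, e]
  obtain ⟨r1, r2⟩ := hf.cartan_relations hy hφ hz.1 hS
  have q1 := toBlocks₁₂_relation (-1) (hskew 1) (hskew Complex.I) (B := B * dirD 1 A z)
    (D := B * dirD Complex.I A z) (by
      rw [hprod, hprod, neg_one_smul, ← sub_eq_add_neg, ← Matrix.sub_mul, ← Matrix.mul_sub, r1,
        Matrix.mul_zero, Matrix.zero_mul])
  have q2 := toBlocks₁₂_relation 1 (hskew 1) (hskew Complex.I) (B := B * dirD Complex.I A z)
    (D := B * dirD 1 A z) (by
      rw [hprod, hprod, one_smul, ← Matrix.add_mul, ← Matrix.mul_add, r2,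
        Matrix.mul_zero, Matrix.zero_mul])
  -- $B_1=\frac12(a-ib)$, with $a$ and $b$ the blocks of $F^{-1}F_u$ and $F^{-1}F_v$. Hence
  -- $4B_1^tI_{1,3}B_1$ has real part $a^tI_{1,3}a-b^tI_{1,3}b$ and imaginary part
  -- $-(a^tI_{1,3}b+b^tI_{1,3}a)$; these are `q1` and `q2`.
  have hb : blockB F φ z = (1 / 2 : ℂ) • ((B * dirD 1 A z).toBlocks₁₂.map Complex.ofReal -
      Complex.I • (B * dirD Complex.I A z).toBlocks₁₂.map Complex.ofReal) := by
    have e : ∀ d i j, dirD d (fun w => LorentzG.mat (F (φ.symm w)) i j) z = dirD d A z i j :=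
      fun d i j => by rw [hAe]; exact dirD_entry hA d i j
    ext i j
    simp only [blockB, maurerCartanZ, Matrix.toBlocks₁₂, Matrix.of_apply, Matrix.mul_apply,
      Matrix.map_apply, dZ, dU_eq_dirD, dV_eq_dirD, e, ← hB, Matrix.smul_apply, Matrix.sub_apply,
      smul_eq_mul, Complex.ofReal_sum, Complex.ofReal_mul, Finset.mul_sum,
      ← Finset.sum_sub_distrib]
    exact Finset.sum_congr rfl fun k _ => by ring
  generalize (B * dirD 1 A z).toBlocks₁₂ = a at *
  generalize (B * dirD Complex.I A z).toBlocks₁₂ = b at *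
  have hmul : ∀ X Y : Matrix (Fin 4) (Fin n) ℝ, (Xᵀ * lorentzForm (0 : Fin 4) * Y).map
      Complex.ofReal = (X.map Complex.ofReal)ᵀ * (lorentzForm (0 : Fin 4)).map Complex.ofReal *
        Y.map Complex.ofReal := fun X Y => by
    ext i j
    simp [Matrix.mul_apply]
  have p1 : (a.map Complex.ofReal)ᵀ * (lorentzForm (0 : Fin 4)).map Complex.ofReal *
      a.map Complex.ofReal = (b.map Complex.ofReal)ᵀ * (lorentzForm (0 : Fin 4)).map
        Complex.ofReal * b.map Complex.ofReal := by
    rw [neg_one_smul, ← sub_eq_add_neg, sub_eq_zero] at q1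
    rw [← hmul, ← hmul, q1]
  have p2 : (b.map Complex.ofReal)ᵀ * (lorentzForm (0 : Fin 4)).map Complex.ofReal *
      a.map Complex.ofReal = -((a.map Complex.ofReal)ᵀ * (lorentzForm (0 : Fin 4)).map
        Complex.ofReal * b.map Complex.ofReal) := by
    rw [one_smul] at q2
    rw [← hmul, ← hmul, eq_neg_of_add_eq_zero_right q2]
    ext i j
    simp
  rw [hb]
  simp only [Matrix.transpose_smul, Matrix.transpose_sub, Matrix.smul_mul, Matrix.mul_smul,
    Matrix.sub_mul, Matrix.mul_sub, p1, p2, smul_sub, smul_neg, smul_smul]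
  rw [show (1 / 2 * Complex.I * (1 / 2 * Complex.I) : ℂ) = -(1 / 2 * (1 / 2)) by
    rw [mul_mul_mul_comm, Complex.I_mul_I]; ring]
  module

end ConformalGaussMap

end

theorem mainTheorem8 {M : Type*} [TopologicalSpace M] [T2Space M] [ChartedSpace ℂ M]
    [IsManifold 𝓘(ℂ) ω M] (n : ℕ) (y : M → Sph n) (hy : IsStrongWillmoreMap y)
    (f : M → LorentzGr n) (hf : IsExtendedConformalGaussMap y f) :
    IsStronglyConformallyHarmonic f := by
  refine ⟨hf.isHarmonicGrMap hy.1, fun p => ?_⟩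
  -- The isotropy relation holds for every smooth frame, so the local frame supplied by the
  -- smoothness of $f$ will do.
  obtain ⟨U, hU, hp, F, hF⟩ := hf.1 p
  refine ⟨U, hU, hp, F, hF, fun φ hφ q hq => ?_⟩
  exact hf.blockB_isotropic hy.1 hF hU hφ ⟨φ.map_source hq.1, by
    rw [Set.mem_preimage, φ.left_inv hq.1]; exact hq.2⟩
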